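/- Let $\mathcal C$ be a rigid C$^*$-tensor category, that is, a C$^*$-tensor category (with finite direct sums and subobjects) which is semisimple, has an irreducible tensor unit $\varepsilon$, and in which every object $\alpha$ has an object $\overline\alpha$ that is both a left and a right dual of $\alpha$. Let $\operatorname{Irr}(\mathcal C)$ be the set of isomorphism classes of irreducible objects and $d(\alpha)$ the categorical dimension of $\alpha$, i.e. $d(\alpha)=s^*s$ for a standard solution $s:\varepsilon\to\alpha\otimes\overline\alpha$, $t:\varepsilon\to\overline\alpha\otimes\alpha$ of the conjugate equations (one with $t^*(1\otimes X)t=s^*(X\otimes1)s$ for all $X\in\operatorname{End}(\alpha)$). A multiplier on $\mathcal C$ is a family of linear maps $\theta_{\alpha,\beta}:\operatorname{End}(\alpha\otimes\beta)\to\operatorname{End}(\alpha\otimes\beta)$ with $\theta_{\alpha_2,\beta_2}(UXV^*)=U\theta_{\alpha_1,\beta_1}(X)V^*$ and $\theta_{\alpha_2\otimes\alpha_1,\beta_1\otimes\beta_2}(1\otimes X\otimes1)=1\otimes\theta_{\alpha_1,\beta_1}(X)\otimes1$ for all $X\in\operatorname{End}(\alpha_1\otimes\beta_1)$ and all $U,V$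 in the span of the morphisms $u\otimes v$ with $u:\alpha_1\to\alpha_2$, $v:\beta_1\to\beta_2$. It has a unique extension, with the same compatibility with composition by such tensor products, to the spaces of morphisms $\gamma\otimes\delta\to\alpha\otimes\beta$; on morphisms $\varepsilon\otimes\varepsilon\to\alpha\otimes\overline\alpha$, $\alpha\in\operatorname{Irr}(\mathcal C)$, it is the multiplication by a scalar $\varphi(\alpha)$. This identifies multipliers with functions $\varphi:\operatorname{Irr}(\mathcal C)\to\mathbb C$. The function $\varphi$ is called a cp-multiplier if all $\theta_{\alpha,\beta}$ are completely positive. $\mathcal C$ has property (T) if every net of cp-multipliers $\varphi_n:\operatorname{Irr}(\mathcal C)\to\mathbb C$ that converges to $1$ pointwise converges to $1$ uniformly on $\operatorname{Irr}(\mathcal C)$. The fusion $*$-algebra $\mathbb C[\mathcal C]$ has vector space basis $\operatorname{Irr}(\mathcal C)$, product $\alpha\beta=\sum_\gamma\operatorname{mult}(\gamma,\alpha\otimes\beta)\,\gamma$ and involution $\alpha^*=\overline\alpha$; an object $\alpha\in\mathcal C$ is viewed as the element $\sum_\gamma\operatorname{mult}(\gamma,\alpha)\,\gamma$. A unital $*$-representation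 $\Theta:\mathbb C[\mathcal C]\to B(\mathcal K)$ is admissible if for every $\xi\in\mathcal K$ the function $\alpha\mapsto d(\alpha)^{-1}\langle\Theta(\alpha)\xi,\xi\rangle$ on $\operatorname{Irr}(\mathcal C)$ is a cp-multiplier. The universal C$^*$-algebra $C_u(\mathcal C)$ is the completion of $\mathbb C[\mathcal C]$ in a universal admissible representation. Then there is a unique unital $*$-homomorphism $\epsilon:C_u(\mathcal C)\to\mathbb C$ with $\epsilon(\alpha)=d(\alpha)$ for all $\alpha\in\mathcal C$ (the trivial representation), and the following conditions are equivalent. 1. $\mathcal C$ has property (T). 2. There exists a nonzero projection $p\in C_u(\mathcal C)$ such that $\alpha p=d(\alpha)p$ for all $\alpha\in\mathcal C$. 3. If $(\omega_n)$ is a net of states on $C_u(\mathcal C)$ and $\omega_n\to\epsilon$ in the weak$^*$ topology, then $\|\omega_n-\epsilon\|\to0$. Moreover, a nonzero projection $p$ as in 2 is unique and satisfies $\epsilon(p)=1$. -/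

import Mathlib

open CategoryTheory MonoidalCategory
open scoped CStarAlgebra

universe v u

set_option linter.unusedSectionVars false

/-- A C*-tensor category: a `ℂ`-linear monoidal category with an antilinear involutive
contravariant operation `dag` (the adjoint `f*`) and complete norms on the morphism spaces
satisfying the C*-identity and the positivity of `f* f`; the tensor product is compatible with
adjoints, the structure isomorphisms are unitary, and there are orthogonal direct sums and
subobjects. Composition is written in diagrammatic order, so `f ≫ dag f` is `f* f`. -/
class CStarTensorCategory (C : Type u) [Category.{v} C] [Preadditive C] [Linear ℂ C]
    [MonoidalCategory C] [MonoidalPreadditive C] [MonoidalLinear ℂ C] where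
  dag {X Y : C} : (X ⟶ Y) → (Y ⟶ X)
  dag_dag {X Y : C} (f : X ⟶ Y) : dag (dag f) = f
  dag_id (X : C) : dag (𝟙 X) = 𝟙 X
  dag_comp {X Y Z : C} (f : X ⟶ Y) (g : Y ⟶ Z) : dag (f ≫ g) = dag g ≫ dag f
  dag_add {X Y : C} (f g : X ⟶ Y) : dag (f + g) = dag f + dag g
  dag_smul {X Y : C} (c : ℂ) (f : X ⟶ Y) : dag (c • f) = star c • dag f
  homNorm (X Y : C) : Norm (X ⟶ Y)
  homCore (X Y : C) : NormedSpace.Core ℂ (X ⟶ Y)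
  hom_complete (X Y : C) :
    letI := NormedAddCommGroup.ofCore (homCore X Y)
    CompleteSpace (X ⟶ Y)
  norm_comp_le {X Y Z : C} (f : X ⟶ Y) (g : Y ⟶ Z) : ‖f ≫ g‖ ≤ ‖f‖ * ‖g‖
  norm_comp_dag {X Y : C} (f : X ⟶ Y) : ‖f ≫ dag f‖ = ‖f‖ * ‖f‖
  exists_comp_dag_eq {X Y : C} (f : X ⟶ Y) : ∃ g : X ⟶ X, f ≫ dag f = g ≫ dag g
  dag_tensor {X Y X' Y' : C} (f : X ⟶ Y) (g : X' ⟶ Y') : dag (f ⊗ₘ g) = dag f ⊗ₘ dag g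
  dag_associator (X Y Z : C) : dag (α_ X Y Z).hom = (α_ X Y Z).inv
  dag_leftUnitor (X : C) : dag (λ_ X).hom = (λ_ X).inv
  dag_rightUnitor (X : C) : dag (ρ_ X).hom = (ρ_ X).inv
  exists_directSum (X Y : C) : ∃ (Z : C) (a : X ⟶ Z) (b : Y ⟶ Z),
    a ≫ dag a = 𝟙 X ∧ b ≫ dag b = 𝟙 Y ∧ dag a ≫ a + dag b ≫ b = 𝟙 Z
  exists_subobject {X : C} (p : X ⟶ X) : p ≠ 0 → p ≫ p = p → dag p = p →
    ∃ (Y : C) (a : Y ⟶ X), a ≫ dag a = 𝟙 Y ∧ dag a ≫ a = p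

namespace CStarTensorCategory

section Basic

variable {C : Type u} [Category.{v} C] [Preadditive C] [Linear ℂ C]
  [MonoidalCategory C] [MonoidalPreadditive C] [MonoidalLinear ℂ C] [CStarTensorCategory C]

attribute [reducible, instance] homNorm

noncomputable instance (X : C) : NormedRing (End X) :=
  letI N : NormedAddCommGroup (X ⟶ X) := NormedAddCommGroup.ofCore (homCore (C := C) X X)
  { (inferInstance : Ring (End X)) with
    norm := (homNorm (C := C) X X).norm
    dist := N.dist
    dist_self := N.dist_self
    dist_comm := N.dist_comm
    dist_triangle := N.dist_triangle
    edist := N.edist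
    edist_dist := N.edist_dist
    toUniformSpace := N.toUniformSpace
    uniformity_dist := N.uniformity_dist
    toBornology := N.toBornology
    cobounded_sets := N.cobounded_sets
    eq_of_dist_eq_zero := N.eq_of_dist_eq_zero
    dist_eq := N.dist_eq
    norm_mul_le := fun a b => (norm_comp_le (C := C) b a).trans_eq (mul_comm _ _) }

instance (X : C) : CompleteSpace (End X) := hom_complete (C := C) X X

noncomputable instance (X : C) : NormedAlgebra ℂ (End X) where
  norm_smul_le c x := ((homCore (C := C) X X).norm_smul c x).le

instance (X : C) : StarRing (End X) where
  star a := dag (C := C) a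
  star_involutive a := dag_dag (C := C) a
  star_mul a b := dag_comp (C := C) b a
  star_add a b := dag_add (C := C) a b

/-- `End X` is a C*-algebra. -/
noncomputable instance (X : C) : CStarAlgebra (End X) where
  star_smul c a := dag_smul (C := C) c a
  norm_mul_self_le a := (norm_comp_dag (C := C) (show X ⟶ X from a)).ge

noncomputable instance (X : C) : PartialOrder (End X) := CStarAlgebra.spectralOrder (End X)

instance (X : C) : StarOrderedRing (End X) := CStarAlgebra.spectralOrderedRing (End X)

/-- The endomorphism `1 ⊗ x ⊗ 1` of `(X₂ ⊗ X₁) ⊗ (Y₁ ⊗ Y₂)`. -/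
def amplification (X₂ Y₂ : C) {X₁ Y₁ : C} (x : X₁ ⊗ Y₁ ⟶ X₁ ⊗ Y₁) :
    (X₂ ⊗ X₁) ⊗ (Y₁ ⊗ Y₂) ⟶ (X₂ ⊗ X₁) ⊗ (Y₁ ⊗ Y₂) :=
  (α_ X₂ X₁ (Y₁ ⊗ Y₂)).hom ≫
    X₂ ◁ ((α_ X₁ Y₁ Y₂).inv ≫ x ▷ Y₂ ≫ (α_ X₁ Y₁ Y₂).hom) ≫ (α_ X₂ X₁ (Y₁ ⊗ Y₂)).inv

theorem amplification_smul (X₂ Y₂ : C) {X₁ Y₁ : C} (c : ℂ) (x : X₁ ⊗ Y₁ ⟶ X₁ ⊗ Y₁) :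
    amplification X₂ Y₂ (c • x) = c • amplification X₂ Y₂ x := by
  simp [amplification]

/-- An object is irreducible if its endomorphisms are exactly the scalars. -/
def IsIrreducible (X : C) : Prop := 𝟙 X ≠ 0 ∧ ∀ f : X ⟶ X, ∃ c : ℂ, f = c • 𝟙 X

theorem dag_zero {X Y : C} : dag (0 : X ⟶ Y) = 0 := by
  simpa using dag_smul (C := C) 0 (0 : X ⟶ Y)

theorem dag_whiskerLeft (X : C) {Y Z : C} (f : Y ⟶ Z) : dag (X ◁ f) = X ◁ dag f := by
  rw [← id_tensorHom, dag_tensor, dag_id, id_tensorHom]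

theorem dag_whiskerRight {Y Z : C} (f : Y ⟶ Z) (X : C) : dag (f ▷ X) = dag f ▷ X := by
  rw [← tensorHom_id, dag_tensor, dag_id, tensorHom_id]

theorem eq_zero_of_comp_dag {X Y : C} {f : X ⟶ Y} (h : f ≫ dag f = 0) : f = 0 := by
  have h1 := norm_comp_dag f
  rw [h, (homCore X X).norm_eq_zero_iff 0 |>.2 rfl] at h1
  exact (homCore X Y).norm_eq_zero_iff f |>.1 (mul_self_eq_zero.1 h1.symm)

/-- Taking adjoints turns a right dual into a left dual. -/
@[reducible]
def dualPairing {X Y : C} (p : ExactPairing X Y) : ExactPairing Y X where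
  coevaluation' := dag (ε_ X Y)
  evaluation' := dag (η_ X Y)
  coevaluation_evaluation' := by
    have h := congrArg dag (ExactPairing.evaluation_coevaluation X Y)
    have e : dag (ρ_ X).inv = (ρ_ X).hom := by rw [← dag_rightUnitor, dag_dag]
    simpa only [dag_comp, dag_whiskerLeft, dag_whiskerRight, dag_associator, dag_leftUnitor, e,
      Category.assoc] using h
  evaluation_coevaluation' := by
    have h := congrArg dag (ExactPairing.coevaluation_evaluation X Y)
    have e : dag (λ_ Y).inv = (λ_ Y).hom := by rw [← dag_leftUnitor, dag_dag]
    have e' : dag (α_ Y X Y).inv = (α_ Y X Y).hom := by rw [← dag_associator, dag_dag]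
    simpa only [dag_comp, dag_whiskerLeft, dag_whiskerRight, e', dag_rightUnitor, e,
      Category.assoc] using h

theorem IsIrreducible.congr {X Y : C} (hX : IsIrreducible X) (e : X ≅ Y) : IsIrreducible Y := by
  refine ⟨fun h => hX.1 ?_, fun f => ?_⟩
  · rw [← e.hom_inv_id, ← Category.id_comp e.inv, h]; simp
  · obtain ⟨c, hc⟩ := hX.2 (e.hom ≫ f ≫ e.inv)
    refine ⟨c, ?_⟩
    have : f = e.inv ≫ (e.hom ≫ f ≫ e.inv) ≫ e.hom := by simp
    rw [this, hc]; simp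

theorem directSum_orthogonal {X Y Z : C} {a : X ⟶ Z} {b : Y ⟶ Z} (ha : a ≫ dag a = 𝟙 X)
    (hb : b ≫ dag b = 𝟙 Y) (h : dag a ≫ a + dag b ≫ b = 𝟙 Z) : a ≫ dag b = 0 := by
  have h1 : a ≫ dag b ≫ b = 0 := by
    have h2 := congrArg (a ≫ ·) h
    simp only [Preadditive.comp_add, Category.comp_id, ← Category.assoc] at h2
    rw [ha, Category.id_comp] at h2
    simpa using h2
  have h3 := congrArg (· ≫ dag b) h1
  simpa [hb] using h3

theorem IsIrreducible.isIso {X Y : C} (hX : IsIrreducible X) (hY : IsIrreducible Y) {f : X ⟶ Y}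
    (hf : f ≠ 0) : IsIso f := by
  obtain ⟨c, hc⟩ := hX.2 (f ≫ dag f)
  obtain ⟨d, hd⟩ := hY.2 (dag f ≫ f)
  have hc0 : c ≠ 0 := by
    rintro rfl
    exact hf (eq_zero_of_comp_dag (by simpa using hc))
  have hcd : c = d := by
    have h1 : c • f = d • f := by
      calc c • f = (f ≫ dag f) ≫ f := by simp [hc]
        _ = f ≫ (dag f ≫ f) := Category.assoc _ _ _
        _ = d • f := by simp [hd]
    by_contra hne
    have h2 : (c - d) • f = 0 := by rw [sub_smul, h1, sub_self]
    exact hf ((smul_eq_zero.1 h2).resolve_left (sub_ne_zero.2 hne))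
  refine ⟨c⁻¹ • dag f, ?_, ?_⟩
  · rw [Linear.comp_smul, hc, smul_smul, inv_mul_cancel₀ hc0, one_smul]
  · rw [Linear.smul_comp, hd, ← hcd, smul_smul, inv_mul_cancel₀ hc0, one_smul]

theorem IsIrreducible.finrank_self {X : C} (hX : IsIrreducible X) :
    Module.finrank ℂ (X ⟶ X) = 1 :=
  finrank_eq_one (𝟙 X) hX.1 fun f => (hX.2 f).imp fun _ h => h.symm

theorem IsIrreducible.finite_hom {X Y : C} (hX : IsIrreducible X) (hY : IsIrreducible Y) :
    Module.Finite ℂ (X ⟶ Y) := by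
  by_cases h : ∃ f : X ⟶ Y, f ≠ 0
  · obtain ⟨f, hf⟩ := h
    have := hX.isIso hY hf
    refine Module.Finite.of_surjective (LinearMap.toSpanSingleton ℂ (X ⟶ Y) f) fun g => ?_
    obtain ⟨c, hc⟩ := hY.2 (inv f ≫ g)
    refine ⟨c, ?_⟩
    have : g = f ≫ inv f ≫ g := by simp
    rw [this, hc]
    simp
  · push Not at h
    have : Subsingleton (X ⟶ Y) := ⟨fun f g => (h f).trans (h g).symm⟩
    infer_instance

/-- Post-composition with an isomorphism. -/
theorem finrank_hom_congr {X X' Y Y' : C} (e : X ≅ X') (e' : Y ≅ Y') :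
    Module.finrank ℂ (X ⟶ Y) = Module.finrank ℂ (X' ⟶ Y') :=
  LinearEquiv.finrank_eq (Linear.homCongr ℂ e e')

/-- `V`, with the morphisms `b i` and `b' i`, is a direct sum of the family `W`. -/
def IsDirectSum {n : ℕ} (V : C) (W : Fin n → C) (b : ∀ i, W i ⟶ V) (b' : ∀ i, V ⟶ W i) : Prop :=
  (∀ i, b i ≫ b' i = 𝟙 (W i)) ∧ (∀ i j, i ≠ j → b i ≫ b' j = 0) ∧ ∑ i, b' i ≫ b i = 𝟙 V

/-- Morphisms into a direct sum. -/
def IsDirectSum.homEquiv {n : ℕ} {V : C} {W : Fin n → C} {b : ∀ i, W i ⟶ V} {b' : ∀ i, V ⟶ W i}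
    (h : IsDirectSum V W b b') (Z : C) : (Z ⟶ V) ≃ₗ[ℂ] (∀ i, (Z ⟶ W i)) where
  toFun f i := f ≫ b' i
  map_add' f g := by ext; simp
  map_smul' c f := by ext; simp
  invFun g := ∑ i, g i ≫ b i
  left_inv f := by
    simp only [Category.assoc]
    rw [← Preadditive.comp_sum, h.2.2, Category.comp_id]
  right_inv g := by
    ext j
    simp only [Preadditive.sum_comp, Category.assoc]
    rw [Finset.sum_eq_single j]
    · simp [h.1]
    · intro i _ hij
      simp [h.2.1 i j hij]
    · simp

theorem IsDirectSum.whiskerLeft {n : ℕ} {V : C} {W : Fin n → C} {b : ∀ i, W i ⟶ V}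
    {b' : ∀ i, V ⟶ W i} (h : IsDirectSum V W b b') (Z : C) :
    IsDirectSum (Z ⊗ V) (fun i => Z ⊗ W i) (fun i => Z ◁ b i) (fun i => Z ◁ b' i) := by
  refine ⟨fun i => ?_, fun i j hij => ?_, ?_⟩
  · simp [← MonoidalCategory.whiskerLeft_comp, h.1]
  · simp [← MonoidalCategory.whiskerLeft_comp, h.2.1 i j hij]
  · simp only [← MonoidalCategory.whiskerLeft_comp]
    rw [← whiskerLeft_sum, h.2.2, MonoidalCategory.whiskerLeft_id]

theorem IsDirectSum.whiskerRight {n : ℕ} {V : C} {W : Fin n → C} {b : ∀ i, W i ⟶ V}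
    {b' : ∀ i, V ⟶ W i} (h : IsDirectSum V W b b') (Z : C) :
    IsDirectSum (V ⊗ Z) (fun i => W i ⊗ Z) (fun i => b i ▷ Z) (fun i => b' i ▷ Z) := by
  refine ⟨fun i => ?_, fun i j hij => ?_, ?_⟩
  · simp [← comp_whiskerRight, h.1]
  · simp [← comp_whiskerRight, h.2.1 i j hij]
  · simp only [← comp_whiskerRight]
    rw [← sum_whiskerRight, h.2.2, id_whiskerRight]

end Basic

end CStarTensorCategory

open CStarTensorCategory

/-- A rigid C*-tensor category: the tensor unit is irreducible, every object is an orthogonal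
direct sum of finitely many irreducible objects, and (through `RightRigidCategory`) every object
`X` has a dual `Xᘁ`, with `s = η_ X Xᘁ : 𝟙_ C ⟶ X ⊗ Xᘁ` and
`t = dag (ε_ X Xᘁ) : 𝟙_ C ⟶ Xᘁ ⊗ X` solving the conjugate equations. By taking adjoints, `Xᘁ` is
both a left and a right dual of `X`. -/
class RigidCStarTensorCategory (C : Type u) [Category.{v} C] [Preadditive C] [Linear ℂ C]
    [MonoidalCategory C] [MonoidalPreadditive C] [MonoidalLinear ℂ C] [RightRigidCategory C]
    [CStarTensorCategory C] : Prop where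
  irreducible_unit : IsIrreducible (𝟙_ C)
  semisimple (X : C) : ∃ (n : ℕ) (Y : Fin n → C) (a : ∀ i, Y i ⟶ X),
    (∀ i, IsIrreducible (Y i)) ∧ (∀ i, a i ≫ dag (a i) = 𝟙 (Y i)) ∧
    (∀ i j, i ≠ j → a i ≫ dag (a j) = 0) ∧ ∑ i, dag (a i) ≫ a i = 𝟙 X

namespace RigidCStarTensorCategory

section Fusion

variable {C : Type u} [Category.{v} C] [Preadditive C] [Linear ℂ C]
  [MonoidalCategory C] [MonoidalPreadditive C] [MonoidalLinear ℂ C] [RightRigidCategory C]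
  [CStarTensorCategory C] [RigidCStarTensorCategory C]

variable (C) in
/-- Isomorphism of irreducible objects. -/
instance irrSetoid : Setoid {X : C // IsIrreducible X} where
  r X Y := Nonempty (X.1 ≅ Y.1)
  iseqv := ⟨fun X => ⟨Iso.refl X.1⟩, fun ⟨e⟩ => ⟨e.symm⟩, fun ⟨e⟩ ⟨e'⟩ => ⟨e.trans e'⟩⟩

variable (C) in
/-- `Irr C`, the set of isomorphism classes of irreducible objects. -/
def Irr : Type u := Quotient (irrSetoid C)

/-- The class of an irreducible object. -/
def Irr.mk (X : C) (hX : IsIrreducible X) : Irr C := Quotient.mk _ ⟨X, hX⟩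

/-- A representative of a class in `Irr C`. -/
noncomputable def Irr.rep (π : Irr C) : C := (Quotient.out π).1

theorem Irr.irreducible_rep (π : Irr C) : IsIrreducible π.rep := (Quotient.out π).2

theorem Irr.mk_rep (π : Irr C) : Irr.mk π.rep π.irreducible_rep = π := Quotient.out_eq π

theorem Irr.mk_eq_iff {X Y : C} {hX : IsIrreducible X} {hY : IsIrreducible Y} :
    Irr.mk X hX = Irr.mk Y hY ↔ Nonempty (X ≅ Y) := Quotient.eq

theorem Irr.rep_mk {X : C} (hX : IsIrreducible X) : Nonempty ((Irr.mk X hX).rep ≅ X) :=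
  Irr.mk_eq_iff.1 (Irr.mk_rep _)

/-- `mult π X`, the multiplicity of `π` in `X`, is the dimension of the space of morphisms from
`π` to `X`. -/
noncomputable def mult (π : Irr C) (X : C) : ℕ := Module.finrank ℂ (π.rep ⟶ X)

theorem mult_congr (π : Irr C) {X Y : C} (e : X ≅ Y) : mult π X = mult π Y :=
  finrank_hom_congr (Iso.refl _) e

open scoped Classical in
theorem mult_irreducible (π : Irr C) {X : C} (hX : IsIrreducible X) :
    mult π X = if π = Irr.mk X hX then 1 else 0 := by
  split_ifs with h
  · subst h
    obtain ⟨e⟩ := Irr.rep_mk hX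
    exact (finrank_hom_congr e (Iso.refl X)).trans hX.finrank_self
  · have : Subsingleton (π.rep ⟶ X) := by
      refine ⟨fun f g => ?_⟩
      by_contra hne
      have := π.irreducible_rep.isIso hX (sub_ne_zero.2 hne)
      exact h (by rw [← π.mk_rep]; exact Irr.mk_eq_iff.2 ⟨asIso (f - g)⟩)
    exact Module.finrank_zero_of_subsingleton

theorem exists_isDirectSum (X : C) : ∃ (n : ℕ) (Y : Fin n → C) (b : ∀ i, Y i ⟶ X)
    (b' : ∀ i, X ⟶ Y i), (∀ i, IsIrreducible (Y i)) ∧ IsDirectSum X Y b b' := by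
  obtain ⟨n, Y, a, h1, h2, h3, h4⟩ := semisimple X
  exact ⟨n, Y, a, fun i => dag (a i), h1, h2, h3, h4⟩

theorem finite_hom {X : C} (hX : IsIrreducible X) (Y : C) : Module.Finite ℂ (X ⟶ Y) := by
  obtain ⟨n, Z, b, b', hZ, h⟩ := exists_isDirectSum Y
  have : ∀ i, Module.Finite ℂ (X ⟶ Z i) := fun i => hX.finite_hom (hZ i)
  exact Module.Finite.equiv (h.homEquiv X).symm

theorem mult_isDirectSum (π : Irr C) {n : ℕ} {V : C} {W : Fin n → C} {b : ∀ i, W i ⟶ V}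
    {b' : ∀ i, V ⟶ W i} (h : IsDirectSum V W b b') : mult π V = ∑ i, mult π (W i) := by
  have : ∀ i, Module.Finite ℂ (π.rep ⟶ W i) := fun i => finite_hom π.irreducible_rep _
  rw [mult, (h.homEquiv π.rep).finrank_eq, Module.finrank_pi_fintype]
  rfl

theorem finite_support_mult (X : C) : (Function.support fun π : Irr C => (mult π X : ℂ)).Finite := by
  classical
  obtain ⟨n, Z, b, b', hZ, h⟩ := exists_isDirectSum X
  refine (Set.finite_range fun i => Irr.mk (Z i) (hZ i)).subset fun π hπ => ?_
  by_contra hne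
  apply hπ
  have : mult π X = 0 := by
    rw [mult_isDirectSum π h]
    refine Finset.sum_eq_zero fun i _ => ?_
    rw [mult_irreducible π (hZ i), if_neg]
    exact fun hi => hne ⟨i, hi.symm⟩
  simp [this]

/-- The dual of an irreducible object is irreducible. -/
theorem irreducible_dual {X : C} (hX : IsIrreducible X) : IsIrreducible (Xᘁ) := by
  constructor
  · intro h
    apply hX.1
    have h1 : η_ X (Xᘁ) = 0 := by
      rw [← Category.comp_id (η_ X (Xᘁ)), ← MonoidalCategory.whiskerLeft_id, h]
      simp
    have h2 := ExactPairing.evaluation_coevaluation X (Xᘁ)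
    rw [h1] at h2
    have h3 : (λ_ X).inv ≫ ((λ_ X).hom ≫ (ρ_ X).inv) ≫ (ρ_ X).hom = 0 := by
      rw [← h2]; simp
    simpa using h3
  · intro f
    let h := tensorRightHomEquiv (𝟙_ C) X (Xᘁ) X
    obtain ⟨c, hc⟩ := hX.2 ((λ_ X).inv ≫ h.symm (η_ X (Xᘁ) ≫ X ◁ f))
    refine ⟨c, ?_⟩
    have h1 : h.symm (η_ X (Xᘁ) ≫ X ◁ f) = h.symm (η_ X (Xᘁ) ≫ X ◁ (c • 𝟙 (Xᘁ))) := by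
      have h2 : η_ X (Xᘁ) ≫ X ◁ (c • 𝟙 (Xᘁ)) = η_ X (Xᘁ) ≫ (c • 𝟙 X) ▷ (Xᘁ) := by simp
      rw [h2, tensorRightHomEquiv_symm_coevaluation_comp_whiskerRight, ← hc]
      simp
    have h2 := congrArg (tensorLeftHomEquiv (𝟙_ C) X (Xᘁ) (Xᘁ)).symm (h.symm.injective h1)
    rw [tensorLeftHomEquiv_symm_coevaluation_comp_whiskerLeft,
      tensorLeftHomEquiv_symm_coevaluation_comp_whiskerLeft] at h2
    exact (cancel_epi _).1 h2

/-- An isomorphism of objects gives an isomorphism of the duals. -/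
def dualCongr {X Y : C} (e : X ≅ Y) : Xᘁ ≅ Yᘁ where
  hom := e.invᘁ
  inv := e.homᘁ
  hom_inv_id := by rw [← comp_rightAdjointMate, e.hom_inv_id, rightAdjointMate_id]
  inv_hom_id := by rw [← comp_rightAdjointMate, e.inv_hom_id, rightAdjointMate_id]

/-- `conj π` is the class of the dual of `π`. -/
noncomputable def Irr.conj (π : Irr C) : Irr C := Irr.mk (π.repᘁ) (irreducible_dual π.irreducible_rep)

theorem Irr.conj_mk {X : C} (hX : IsIrreducible X) :
    (Irr.mk X hX).conj = Irr.mk (Xᘁ) (irreducible_dual hX) :=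
  Irr.mk_eq_iff.2 ⟨dualCongr (Irr.rep_mk hX).some⟩

theorem Irr.conj_conj (π : Irr C) : π.conj.conj = π := by
  conv_rhs => rw [← π.mk_rep]
  rw [Irr.conj, Irr.mk_eq_iff]
  obtain ⟨e⟩ := Irr.rep_mk (irreducible_dual π.irreducible_rep)
  exact ⟨(dualCongr e).trans (rightDualIso HasRightDual.exact (dualPairing HasRightDual.exact))⟩

theorem IsDirectSum.dual {n : ℕ} {V : C} {W : Fin n → C} {b : ∀ i, W i ⟶ V}
    {b' : ∀ i, V ⟶ W i} (h : IsDirectSum V W b b') :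
    IsDirectSum (Vᘁ) (fun i => (W i)ᘁ) (fun i => (b' i)ᘁ) (fun i => (b i)ᘁ) := by
  have hz : ∀ {X Y : C}, (0 : X ⟶ Y)ᘁ = 0 := by intros; simp [rightAdjointMate]
  have hs : ∀ {X Y : C} (f : Fin n → (X ⟶ Y)), (∑ i, f i)ᘁ = ∑ i, (f i)ᘁ := by
    intro X Y f
    simp only [rightAdjointMate, sum_whiskerRight, whiskerLeft_sum, Preadditive.sum_comp,
      Preadditive.comp_sum]
  refine ⟨fun i => ?_, fun i j hij => ?_, ?_⟩
  · rw [← comp_rightAdjointMate, h.1, rightAdjointMate_id]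
  · rw [← comp_rightAdjointMate, h.2.1 j i hij.symm, hz]
  · simp only [← comp_rightAdjointMate]
    rw [← hs, h.2.2, rightAdjointMate_id]

variable (C) in
/-- The fusion *-algebra `ℂ[C]`: the vector space with basis `Irr C`, with the product given by the
fusion rules and the involution given by duality. -/
def FusionAlgebra : Type u := Irr C →₀ ℂ

namespace FusionAlgebra

noncomputable instance : AddCommGroup (FusionAlgebra C) := inferInstanceAs (AddCommGroup (Irr C →₀ ℂ))

noncomputable instance : Module ℂ (FusionAlgebra C) := inferInstanceAs (Module ℂ (Irr C →₀ ℂ))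

/-- The basis element `π` of the fusion algebra. -/
noncomputable def basis (π : Irr C) : FusionAlgebra C := Finsupp.single π 1

/-- The element `∑ π, mult π X • π` of the fusion algebra defined by an object `X`. -/
noncomputable def of (X : C) : FusionAlgebra C :=
  Finsupp.ofSupportFinite (fun π => (mult π X : ℂ)) (finite_support_mult X)

/-- The product: `π * ρ = ∑ γ, mult γ (π ⊗ ρ) • γ`, extended bilinearly. -/
noncomputable def mulAux : (Irr C →₀ ℂ) →ₗ[ℂ] (Irr C →₀ ℂ) →ₗ[ℂ] FusionAlgebra C :=
  Finsupp.lift ((Irr C →₀ ℂ) →ₗ[ℂ] FusionAlgebra C) ℂ (Irr C) fun π =>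
    Finsupp.lift (FusionAlgebra C) ℂ (Irr C) fun ρ => of (π.rep ⊗ ρ.rep)

/-- The product as a bilinear map. -/
noncomputable def mulHom : FusionAlgebra C →ₗ[ℂ] FusionAlgebra C →ₗ[ℂ] FusionAlgebra C := mulAux

noncomputable instance : Mul (FusionAlgebra C) := ⟨fun x y => mulHom x y⟩

noncomputable instance : One (FusionAlgebra C) := ⟨basis (Irr.mk (𝟙_ C) irreducible_unit)⟩

/-- The involution: `star (∑ π, x π • π) = ∑ π, conj (x π) • π.conj`. -/
noncomputable instance : Star (FusionAlgebra C) :=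
  ⟨fun x => Finsupp.sum x fun π c => star c • basis π.conj⟩

theorem basis_mul_basis (π ρ : Irr C) : basis π * basis ρ = of (π.rep ⊗ ρ.rep) := by
  change mulAux (Finsupp.single π 1) (Finsupp.single ρ 1) = _
  simp [mulAux]

theorem of_congr {X Y : C} (e : X ≅ Y) : of X = of Y :=
  Finsupp.ext fun π => congrArg Nat.cast (mult_congr π e)

theorem of_irreducible {X : C} (hX : IsIrreducible X) : of X = basis (Irr.mk X hX) := by
  classical
  refine Finsupp.ext fun π => ?_
  change (mult π X : ℂ) = Finsupp.single (Irr.mk X hX) (1 : ℂ) π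
  rw [mult_irreducible π hX, Finsupp.single_apply]
  simp [eq_comm]

theorem of_rep (π : Irr C) : of π.rep = basis π := by
  rw [of_irreducible π.irreducible_rep, π.mk_rep]

theorem of_isDirectSum {n : ℕ} {V : C} {W : Fin n → C} {b : ∀ i, W i ⟶ V}
    {b' : ∀ i, V ⟶ W i} (h : IsDirectSum V W b b') : of V = ∑ i, of (W i) := by
  refine Finsupp.ext fun π => ?_
  have : (∑ i, of (W i) : Irr C →₀ ℂ) π = ∑ i, (mult π (W i) : ℂ) := Finsupp.finsetSum_apply _ _ _
  refine Eq.trans ?_ this.symm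
  change (mult π V : ℂ) = _
  rw [mult_isDirectSum π h]
  push_cast
  rfl

theorem of_mul_of (X Y : C) : of X * of Y = of (X ⊗ Y) := by
  obtain ⟨n, V, b, b', hV, h⟩ := exists_isDirectSum X
  obtain ⟨m, W, d, d', hW, k⟩ := exists_isDirectSum Y
  have hi : ∀ i j, of (V i) * of (W j) = of (V i ⊗ W j) := fun i j => by
    rw [of_irreducible (hV i), of_irreducible (hW j), basis_mul_basis]
    exact of_congr (tensorIso (Irr.rep_mk (hV i)).some (Irr.rep_mk (hW j)).some)
  change mulHom (of X) (of Y) = _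
  rw [of_isDirectSum h, of_isDirectSum k, of_isDirectSum (h.whiskerRight Y),
    map_sum mulHom (fun i => of (V i)) Finset.univ, LinearMap.sum_apply]
  refine Finset.sum_congr rfl fun i _ => ?_
  rw [map_sum, of_isDirectSum (k.whiskerLeft (V i))]
  exact Finset.sum_congr rfl fun j _ => hi i j

theorem induction_on {p : FusionAlgebra C → Prop} (x : FusionAlgebra C) (h0 : p 0)
    (hadd : ∀ x y, p x → p y → p (x + y)) (hb : ∀ (c : ℂ) (π : Irr C), p (c • basis π)) : p x := by
  refine Finsupp.induction_linear x h0 hadd fun π c => ?_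
  have h : c • basis π = (Finsupp.single π c : Irr C →₀ ℂ) :=
    (Finsupp.smul_single c π (1 : ℂ)).trans (by simp)
  exact h ▸ hb c π

noncomputable instance : NonUnitalNonAssocRing (FusionAlgebra C) where
  left_distrib x y z := map_add (mulHom x) y z
  right_distrib x y z := LinearMap.map_add₂ mulHom x y z
  zero_mul x := LinearMap.map_zero₂ mulHom x
  mul_zero x := map_zero (mulHom x)

theorem smul_mul (c : ℂ) (x y : FusionAlgebra C) : c • x * y = c • (x * y) :=
  LinearMap.map_smul₂ mulHom c x y

theorem mul_smul' (c : ℂ) (x y : FusionAlgebra C) : x * c • y = c • (x * y) :=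
  map_smul (mulHom x) c y

noncomputable instance : Ring (FusionAlgebra C) where
  mul_assoc x y z := by
    induction x using induction_on with
    | h0 => simp only [zero_mul]
    | hadd x x' h h' => simp only [add_mul, h, h']
    | hb c π =>
    induction y using induction_on with
    | h0 => simp only [zero_mul, mul_zero]
    | hadd x x' h h' => simp only [add_mul, mul_add, h, h']
    | hb d ρ =>
    induction z using induction_on with
    | h0 => simp only [mul_zero]
    | hadd x x' h h' => simp only [mul_add, h, h']
    | hb e σ =>
    simp only [smul_mul, mul_smul', ← of_rep, of_mul_of, of_congr (α_ π.rep ρ.rep σ.rep)]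
  one_mul x := by
    induction x using induction_on with
    | h0 => simp only [mul_zero]
    | hadd x x' h h' => simp only [mul_add, h, h']
    | hb c π =>
    change basis _ * _ = _
    rw [mul_smul', ← of_irreducible, ← of_rep, of_mul_of, of_congr (λ_ π.rep)]
  mul_one x := by
    induction x using induction_on with
    | h0 => simp only [zero_mul]
    | hadd x x' h h' => simp only [add_mul, h, h']
    | hb c π =>
    change _ * basis _ = _
    rw [smul_mul, ← of_irreducible, ← of_rep, of_mul_of, of_congr (ρ_ π.rep)]
  neg_add_cancel := neg_add_cancel
  zsmul := fun n x => n • x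
  zsmul_zero' := SubNegMonoid.zsmul_zero'
  zsmul_succ' := SubNegMonoid.zsmul_succ'
  zsmul_neg' := SubNegMonoid.zsmul_neg'
  sub_eq_add_neg := sub_eq_add_neg

noncomputable instance : Algebra ℂ (FusionAlgebra C) := Algebra.ofModule smul_mul mul_smul'

theorem star_basis (π : Irr C) : star (basis π) = basis π.conj := by
  change Finsupp.sum (Finsupp.single π 1) _ = _
  simp

theorem star_add' (x y : FusionAlgebra C) : star (x + y) = star x + star y :=
  Finsupp.sum_add_index' (by simp) (by simp [add_smul])

theorem star_smul' (c : ℂ) (x : FusionAlgebra C) : star (c • x) = star c • star x := by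
  refine (Finsupp.sum_smul_index (g := (x : Irr C →₀ ℂ)) (b := c) (by simp)).trans ?_
  refine Eq.trans ?_ Finsupp.smul_sum.symm
  refine Finsupp.sum_congr fun π _ => ?_
  rw [star_mul, smul_smul, mul_comm]

theorem star_of (X : C) : star (of X) = of (Xᘁ) := by
  obtain ⟨n, V, b, b', hV, h⟩ := exists_isDirectSum X
  have hs : ∀ f : Fin n → FusionAlgebra C, star (∑ i, f i) = ∑ i, star (f i) := fun f =>
    map_sum (AddMonoidHom.mk' (star : FusionAlgebra C → FusionAlgebra C) star_add') f Finset.univ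
  rw [of_isDirectSum h, hs, of_isDirectSum (IsDirectSum.dual h)]
  refine Finset.sum_congr rfl fun i _ => ?_
  rw [of_irreducible (hV i), star_basis, Irr.conj_mk, of_irreducible]

noncomputable instance : StarRing (FusionAlgebra C) where
  star_add := star_add'
  star_involutive x := by
    induction x using induction_on with
    | h0 =>
      have h0 : star (0 : FusionAlgebra C) = 0 := by simpa using star_smul' 0 (0 : FusionAlgebra C)
      rw [h0, h0]
    | hadd x x' h h' => rw [star_add', star_add', h, h']
    | hb c π => rw [star_smul', star_smul', star_star, star_basis, star_basis, Irr.conj_conj]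
  star_mul x y := by
    have h0 : star (0 : FusionAlgebra C) = 0 := by simpa using star_smul' 0 (0 : FusionAlgebra C)
    induction x using induction_on with
    | h0 => simp only [zero_mul, mul_zero, h0]
    | hadd x x' h h' => simp only [add_mul, mul_add, h, h', star_add']
    | hb c π =>
    induction y using induction_on with
    | h0 => simp only [zero_mul, mul_zero, h0]
    | hadd x x' h h' => simp only [add_mul, mul_add, h, h', star_add']
    | hb d ρ =>
    simp only [smul_mul, mul_smul', star_smul', ← of_rep, of_mul_of, star_of]
    rw [smul_comm, of_congr (rightDualTensorIso π.rep ρ.rep)]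

instance : StarModule ℂ (FusionAlgebra C) := ⟨star_smul'⟩

end FusionAlgebra

/-- A solution `s = η_ X Y`, `t = dag (ε_ X Y)` of the conjugate equations is standard if
`t* (1 ⊗ f) t = s* (f ⊗ 1) s` for all endomorphisms `f` of `X`. -/
def IsStandard {X Y : C} (p : ExactPairing X Y) : Prop :=
  ∀ f : X ⟶ X, dag (ε_ X Y) ≫ Y ◁ f ≫ ε_ X Y = η_ X Y ≫ f ▷ Y ≫ dag (η_ X Y)

/-- `d` is the trace `s* s` of the identity of `X` for a standard solution of the conjugate
equations. -/
def IsDimension (X : C) (d : ℝ) : Prop :=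
  ∃ (Y : C) (p : ExactPairing X Y), IsStandard p ∧ η_ X Y ≫ dag (η_ X Y) = (d : ℂ) • 𝟙 (𝟙_ C)

/-- The categorical dimension `d(X)`: the unique number `d` with `IsDimension X d`. -/
noncomputable def dim (X : C) : ℝ := Classical.epsilon (IsDimension X)

theorem exists_scalar {X Y : C} (hX : IsIrreducible X) (f : X ⟶ Y) :
    ∃ c : ℝ, 0 ≤ c ∧ f ≫ dag f = (c : ℂ) • 𝟙 X := by
  obtain ⟨g, hg⟩ := exists_comp_dag_eq f
  obtain ⟨z, rfl⟩ := hX.2 g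
  refine ⟨‖z‖ ^ 2, by positivity, ?_⟩
  rw [hg, dag_smul, dag_id, Linear.comp_smul, Linear.smul_comp, Category.id_comp, smul_smul]
  congr 1
  rw [mul_comm, Complex.star_def, Complex.mul_conj, Complex.normSq_eq_norm_sq]

theorem exists_scalar_pos {X Y : C} (hX : IsIrreducible X) {f : X ⟶ Y} (hf : f ≠ 0) :
    ∃ c : ℝ, 0 < c ∧ f ≫ dag f = (c : ℂ) • 𝟙 X := by
  obtain ⟨c, hc, h⟩ := exists_scalar hX f
  refine ⟨c, hc.lt_of_ne ?_, h⟩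
  rintro rfl
  exact hf (eq_zero_of_comp_dag (by simpa using h))

theorem coevaluation_ne_zero {X Y : C} (hX : IsIrreducible X) (p : ExactPairing X Y) :
    η_ X Y ≠ 0 := by
  intro h1
  apply hX.1
  have h2 := ExactPairing.evaluation_coevaluation X Y
  rw [h1] at h2
  have h3 : (λ_ X).inv ≫ ((λ_ X).hom ≫ (ρ_ X).inv) ≫ (ρ_ X).hom = 0 := by
    rw [← h2]; simp
  simpa using h3

theorem evaluation_ne_zero {X Y : C} (hX : IsIrreducible X) (p : ExactPairing X Y) :
    ε_ X Y ≠ 0 := by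
  intro h1
  apply hX.1
  have h2 := ExactPairing.evaluation_coevaluation X Y
  rw [h1] at h2
  have h3 : (λ_ X).inv ≫ ((λ_ X).hom ≫ (ρ_ X).inv) ≫ (ρ_ X).hom = 0 := by
    rw [← h2]; simp
  simpa using h3

/-- Rescaling a solution of the conjugate equations. -/
@[reducible]
noncomputable def scalePairing {X Y : C} (p : ExactPairing X Y) (r : ℂ) (hr : r ≠ 0) : ExactPairing X Y where
  coevaluation' := r • η_ X Y
  evaluation' := r⁻¹ • ε_ X Y
  coevaluation_evaluation' := by
    have := ExactPairing.coevaluation_evaluation X Y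
    simp [smul_smul, hr, this]
  evaluation_coevaluation' := by
    have := ExactPairing.evaluation_coevaluation X Y
    simp [smul_smul, hr, this]

theorem exists_isDimension {X : C} (hX : IsIrreducible X) : ∃ d, IsDimension X d := by
  obtain ⟨a, ha, hη⟩ := exists_scalar_pos irreducible_unit
    (coevaluation_ne_zero hX (HasRightDual.exact (X := X)))
  have hne : dag (ε_ X (Xᘁ)) ≠ 0 := fun h =>
    evaluation_ne_zero hX (HasRightDual.exact (X := X)) (by rw [← dag_dag (ε_ X (Xᘁ)), h, dag_zero])
  obtain ⟨b, hb, hε⟩ := exists_scalar_pos irreducible_unit hne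
  rw [dag_dag] at hε
  have hr : ((b / a) ^ (1 / 4 : ℝ) : ℝ) ≠ 0 := by positivity
  set r : ℝ := (b / a) ^ (1 / 4 : ℝ) with hrdef
  have hr4 : r ^ 4 = b / a := by
    rw [hrdef, ← Real.rpow_natCast, ← Real.rpow_mul (by positivity)]
    norm_num
  have hrC : (r : ℂ) ≠ 0 := by exact_mod_cast hr
  have e1 : (scalePairing HasRightDual.exact (r : ℂ) hrC).coevaluation' = (r : ℂ) • η_ X (Xᘁ) := rfl
  have e2 : (scalePairing HasRightDual.exact (r : ℂ) hrC).evaluation' =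
    (r : ℂ)⁻¹ • ε_ X (Xᘁ) := rfl
  generalize scalePairing (HasRightDual.exact (X := X)) (r : ℂ) hrC = p at e1 e2
  refine ⟨r ^ 2 * a, Xᘁ, p, fun f => ?_, ?_⟩
  · obtain ⟨c, rfl⟩ := hX.2 f
    change dag p.evaluation' ≫ _ ≫ p.evaluation' = p.coevaluation' ≫ _ ≫ dag p.coevaluation'
    rw [e1, e2]
    simp only [dag_smul, MonoidalLinear.whiskerLeft_smul, MonoidalLinear.smul_whiskerRight,
      MonoidalCategory.whiskerLeft_id, id_whiskerRight, Linear.smul_comp, Linear.comp_smul,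
      Category.id_comp, hη, hε, smul_smul]
    congr 1
    have : r⁻¹ * r⁻¹ * b = r * r * a := by
      have : b = r ^ 4 * a := by rw [hr4]; field_simp
      rw [this]; field_simp
    have h := congrArg (fun t : ℝ => (t : ℂ)) this
    push_cast at h
    simp only [star_inv₀, Complex.star_def, Complex.conj_ofReal]
    linear_combination c * h
  · change p.coevaluation' ≫ dag p.coevaluation' = _
    rw [e1]
    simp only [dag_smul, Linear.smul_comp, Linear.comp_smul, hη, smul_smul]
    congr 1
    simp only [Complex.star_def, Complex.conj_ofReal]
    push_cast
    ring

theorem dim_ne_zero {X : C} (hX : IsIrreducible X) : dim X ≠ 0 := by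
  obtain ⟨Y, p, -, h⟩ := Classical.epsilon_spec (exists_isDimension hX)
  intro h0
  have h1 : Classical.epsilon (IsDimension X) = 0 := h0
  rw [h1] at h
  exact coevaluation_ne_zero hX p (eq_zero_of_comp_dag (by simpa using h))

variable (C) in
/-- A multiplier on `C`: a family of linear maps `θ X Y` on `End (X ⊗ Y)` with
`θ (U x V) = U θ(x) V` for `U = a ⊗ b` and `V = a' ⊗ b'`, and with
`θ (1 ⊗ x ⊗ 1) = 1 ⊗ θ(x) ⊗ 1` (up to the associativity isomorphisms). -/
structure Multiplier where
  /-- The maps `θ X Y`. -/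
  toFun (X Y : C) : End (X ⊗ Y) →ₗ[ℂ] End (X ⊗ Y)
  natural {X₁ Y₁ X₂ Y₂ : C} (x : X₁ ⊗ Y₁ ⟶ X₁ ⊗ Y₁) (a : X₁ ⟶ X₂) (b : Y₁ ⟶ Y₂)
    (a' : X₂ ⟶ X₁) (b' : Y₂ ⟶ Y₁) :
    toFun X₂ Y₂ ((a' ⊗ₘ b') ≫ x ≫ (a ⊗ₘ b)) = (a' ⊗ₘ b') ≫ toFun X₁ Y₁ x ≫ (a ⊗ₘ b)
  amplify (X₂ X₁ Y₁ Y₂ : C) (x : X₁ ⊗ Y₁ ⟶ X₁ ⊗ Y₁) :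
    toFun (X₂ ⊗ X₁) (Y₁ ⊗ Y₂) (amplification X₂ Y₂ x) = amplification X₂ Y₂ (toFun X₁ Y₁ x)

/-- A multiplier is of positive type if all its maps are completely positive. -/
def Multiplier.IsPositiveType (θ : Multiplier C) : Prop :=
  ∀ X Y : C, ∃ T : End (X ⊗ Y) →CP End (X ⊗ Y), T.toLinearMap = θ.toFun X Y

/-- The extension of a multiplier to the spaces of morphisms `Z ⊗ W ⟶ X ⊗ Y`, with the same
naturality. It exists and is unique. -/
structure Multiplier.Extension (θ : Multiplier C) where
  /-- The extended maps. -/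
  toFun (X Y Z W : C) : (Z ⊗ W ⟶ X ⊗ Y) →ₗ[ℂ] (Z ⊗ W ⟶ X ⊗ Y)
  natural {X₁ Y₁ Z₁ W₁ X₂ Y₂ Z₂ W₂ : C} (x : Z₁ ⊗ W₁ ⟶ X₁ ⊗ Y₁) (a : X₁ ⟶ X₂) (b : Y₁ ⟶ Y₂)
    (a' : Z₂ ⟶ Z₁) (b' : W₂ ⟶ W₁) :
    toFun X₂ Y₂ Z₂ W₂ ((a' ⊗ₘ b') ≫ x ≫ (a ⊗ₘ b)) =
      (a' ⊗ₘ b') ≫ toFun X₁ Y₁ Z₁ W₁ x ≫ (a ⊗ₘ b)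
  restrict (X Y : C) (x : X ⊗ Y ⟶ X ⊗ Y) : toFun X Y X Y x = θ.toFun X Y x

/-- The multiplier `θ` corresponds to the function `φ` on `Irr C`: its extension acts on the
morphisms from `𝟙 ⊗ 𝟙` to `π ⊗ πᘁ` as multiplication by `φ π`. -/
def Multiplier.HasSymbol (θ : Multiplier C) (φ : Irr C → ℂ) : Prop :=
  ∃ Θ : θ.Extension, ∀ (X : C) (hX : IsIrreducible X) (v : 𝟙_ C ⊗ 𝟙_ C ⟶ X ⊗ Xᘁ),
    Θ.toFun X (Xᘁ) (𝟙_ C) (𝟙_ C) v = φ (Irr.mk X hX) • v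

/-- A function on `Irr C` is a cp-multiplier if the multiplier corresponding to it is of positive
type. -/
def IsCPMultiplier (φ : Irr C → ℂ) : Prop :=
  ∃ θ : Multiplier C, θ.IsPositiveType ∧ θ.HasSymbol φ

variable (C) in
/-- The class of the tensor unit. -/
def Irr.unit : Irr C := Irr.mk (𝟙_ C) irreducible_unit

theorem Multiplier.toFun_id {θ : Multiplier C} {φ : Irr C → ℂ} (h : θ.HasSymbol φ) (X Y : C) :
    θ.toFun X Y (𝟙 (X ⊗ Y)) = φ (Irr.unit C) • 𝟙 (X ⊗ Y) := by
  obtain ⟨Θ, hΘ⟩ := h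
  have h1 : θ.toFun (𝟙_ C) (𝟙_ C) (𝟙 (𝟙_ C ⊗ 𝟙_ C)) = φ (Irr.unit C) • 𝟙 (𝟙_ C ⊗ 𝟙_ C) := by
    let D : C := @HasRightDual.rightDual C _ _ (𝟙_ C) (RightRigidCategory.rightDual (𝟙_ C))
    let w : 𝟙_ C ≅ D := rightDualIso (exactPairingUnit (C := C))
      (@HasRightDual.exact C _ _ (𝟙_ C) (RightRigidCategory.rightDual (𝟙_ C)))
    have h2 := hΘ (𝟙_ C) irreducible_unit (𝟙 (𝟙_ C) ⊗ₘ w.hom)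
    have h3 := Θ.natural (𝟙 (𝟙_ C ⊗ 𝟙_ C)) (𝟙 (𝟙_ C)) w.hom (𝟙 (𝟙_ C)) (𝟙 (𝟙_ C))
    simp only [id_tensorHom, MonoidalCategory.whiskerLeft_id, Category.id_comp] at h2 h3
    rw [Θ.restrict] at h3
    have h4 := h3.symm.trans h2
    have h5 := congrArg (· ≫ (𝟙_ C) ◁ w.inv) h4
    have h6 : θ.toFun (𝟙_ C) (𝟙_ C) (𝟙 (𝟙_ C ⊗ 𝟙_ C)) ≫ (𝟙_ C) ◁ w.hom ≫ (𝟙_ C) ◁ w.inv =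
        φ (Irr.unit C) • ((𝟙_ C) ◁ w.hom ≫ (𝟙_ C) ◁ w.inv) := by
      rw [← Category.assoc, ← Linear.smul_comp]
      exact h5
    rw [← MonoidalCategory.whiskerLeft_comp, w.hom_inv_id, MonoidalCategory.whiskerLeft_id] at h6
    exact (Category.comp_id _).symm.trans h6
  have h2 := θ.amplify X (𝟙_ C) (𝟙_ C) Y (𝟙 _)
  rw [h1] at h2
  have h3 := θ.natural (𝟙 ((X ⊗ 𝟙_ C) ⊗ (𝟙_ C ⊗ Y))) (ρ_ X).hom (λ_ Y).hom (ρ_ X).inv (λ_ Y).inv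
  have h4 : amplification X Y (𝟙 (𝟙_ C ⊗ 𝟙_ C)) = 𝟙 _ := by simp [amplification]
  rw [amplification_smul, h4] at h2
  rw [h2] at h3
  simpa using h3

/-- A cp-multiplier is bounded. -/
theorem IsCPMultiplier.norm_le {φ : Irr C → ℂ} (h : IsCPMultiplier φ) (π : Irr C) :
    ‖φ π‖ ≤ 2 * ‖φ (Irr.unit C)‖ := by
  obtain ⟨θ, hpos, hsym⟩ := h
  have hid := θ.toFun_id hsym
  obtain ⟨Θ, hΘ⟩ := hsym
  set X : C := π.rep
  have hX : IsIrreducible X := π.irreducible_rep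
  obtain ⟨Z, a, b, ha, hb, hab⟩ := exists_directSum X (𝟙_ C)
  obtain ⟨Z', a', b', ha', hb', hab'⟩ := exists_directSum (Xᘁ) (𝟙_ C)
  -- the unit object `I = 𝟙 ⊗ 𝟙` and an isometry `r` from it to `X ⊗ Xᘁ`
  have hI : IsIrreducible (𝟙_ C ⊗ 𝟙_ C) := irreducible_unit.congr (λ_ (𝟙_ C)).symm
  obtain ⟨r, hr⟩ : ∃ r : 𝟙_ C ⊗ 𝟙_ C ⟶ X ⊗ Xᘁ, r ≫ dag r = 𝟙 _ := by
    have hne : (λ_ (𝟙_ C)).hom ≫ η_ X (Xᘁ) ≠ 0 := fun h0 =>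
      coevaluation_ne_zero hX (HasRightDual.exact (X := X))
        ((cancel_epi (λ_ (𝟙_ C)).hom).1 (by rw [h0, Limits.comp_zero]))
    obtain ⟨c, hc, hcc⟩ := exists_scalar_pos hI hne
    refine ⟨((Real.sqrt c)⁻¹ : ℂ) • ((λ_ (𝟙_ C)).hom ≫ η_ X (Xᘁ)), ?_⟩
    rw [dag_smul, Linear.comp_smul, Linear.smul_comp, hcc, smul_smul, smul_smul]
    have h1 : star ((Real.sqrt c : ℂ)⁻¹) * (Real.sqrt c : ℂ)⁻¹ * c = 1 := by
      have h2 : (Real.sqrt c)⁻¹ * (Real.sqrt c)⁻¹ * c = 1 := by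
        rw [← mul_inv, Real.mul_self_sqrt hc.le, inv_mul_cancel₀ hc.ne']
      have h3 := congrArg (fun t : ℝ => (t : ℂ)) h2
      simpa using h3
    rw [h1, one_smul]
  set e₁ : 𝟙_ C ⊗ 𝟙_ C ⟶ Z ⊗ Z' := b ⊗ₘ b' with he₁
  set m : X ⊗ Xᘁ ⟶ Z ⊗ Z' := a ⊗ₘ a' with hm
  set e₂ : 𝟙_ C ⊗ 𝟙_ C ⟶ Z ⊗ Z' := r ≫ m with he₂
  have h11 : e₁ ≫ dag e₁ = 𝟙 _ := by
    rw [he₁, dag_tensor, tensorHom_comp_tensorHom, hb, hb', id_tensorHom_id]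
  have hmm : m ≫ dag m = 𝟙 _ := by
    rw [hm, dag_tensor, tensorHom_comp_tensorHom, ha, ha', id_tensorHom_id]
  have h1m : e₁ ≫ dag m = 0 := by
    rw [he₁, hm, dag_tensor, tensorHom_comp_tensorHom, directSum_orthogonal hb ha
      (by rw [add_comm]; exact hab)]
    simp
  have h12 : e₁ ≫ dag e₂ = 0 := by
    rw [he₂, dag_comp, reassoc_of% h1m]; simp
  have h21 : e₂ ≫ dag e₁ = 0 := by
    rw [← dag_dag (e₂ ≫ dag e₁), dag_comp, dag_dag, h12, dag_zero]
  have h22 : e₂ ≫ dag e₂ = 𝟙 _ := by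
    rw [he₂, dag_comp, Category.assoc, reassoc_of% hmm, hr]
  -- the values of the multiplier
  set t : End (Z ⊗ Z') →ₗ[ℂ] End (Z ⊗ Z') := θ.toFun Z Z'
  have t11 : t (dag e₁ ≫ e₁) = φ (Irr.unit C) • (dag e₁ ≫ e₁) := by
    have := θ.natural (𝟙 (𝟙_ C ⊗ 𝟙_ C)) b b' (dag b) (dag b')
    rw [hid, ← dag_tensor] at this
    simpa using this
  have tm : t (dag m ≫ m) = φ (Irr.unit C) • (dag m ≫ m) := by
    have := θ.natural (𝟙 (X ⊗ Xᘁ)) a a' (dag a) (dag a')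
    rw [hid, ← dag_tensor] at this
    simpa using this
  have t21 : t (dag e₁ ≫ e₂) = φ π • (dag e₁ ≫ e₂) := by
    have h1 := Θ.natural r a a' (dag b) (dag b')
    rw [hΘ X hX, Θ.restrict, ← dag_tensor, π.mk_rep] at h1
    simpa using h1
  -- positivity
  have key : ∀ {W : C} (k : W ⟶ Z ⊗ Z') (κ : 𝟙_ C ⊗ 𝟙_ C ⟶ Z ⊗ Z'),
      ∃ c : ℝ, 0 ≤ c ∧ κ ≫ t (dag k ≫ k) ≫ dag κ = (c : ℂ) • 𝟙 _ := by
    intro W k κ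
    obtain ⟨T, hT⟩ := hpos Z Z'
    obtain ⟨g, hg⟩ := exists_comp_dag_eq (dag k)
    rw [dag_dag] at hg
    have h0 : (0 : End (Z ⊗ Z')) ≤ dag k ≫ k := by
      rw [hg]; exact star_mul_self_nonneg (R := End (Z ⊗ Z')) g
    have h1 : 0 ≤ T (dag k ≫ k) := map_nonneg T h0
    obtain ⟨N, hN⟩ := CStarAlgebra.nonneg_iff_eq_star_mul_self.1 h1
    have h2 : t (dag k ≫ k) = N ≫ dag (C := C) N := (LinearMap.congr_fun hT _).symm.trans hN
    obtain ⟨c, hc, h3⟩ := exists_scalar hI (κ ≫ (show Z ⊗ Z' ⟶ Z ⊗ Z' from N))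
    refine ⟨c, hc, ?_⟩
    rw [h2, ← h3, dag_comp]
    simp
  set κ := e₁ + e₂ with hκ
  have c1 : κ ≫ dag e₁ = 𝟙 _ := by rw [hκ, Preadditive.add_comp, h11, h21, add_zero]
  have c2 : κ ≫ dag e₂ = 𝟙 _ := by rw [hκ, Preadditive.add_comp, h12, h22, zero_add]
  have cm : κ ≫ dag m = r := by
    rw [hκ, Preadditive.add_comp, h1m, zero_add, he₂, Category.assoc, hmm, Category.comp_id]
  have c1' : e₁ ≫ dag κ = 𝟙 _ := by
    rw [← dag_dag e₁, ← dag_comp, c1, dag_id]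
  have c2' : e₂ ≫ dag κ = 𝟙 _ := by
    rw [← dag_dag e₂, ← dag_comp, c2, dag_id]
  have cm' : m ≫ dag κ = dag r := by
    rw [← dag_dag m, ← dag_comp, cm]
  have cancel : ∀ {x y : ℂ}, x • 𝟙 (𝟙_ C ⊗ 𝟙_ C) = y • 𝟙 (𝟙_ C ⊗ 𝟙_ C) → x = y := by
    intro x y hxy
    have : (x - y) • 𝟙 (𝟙_ C ⊗ 𝟙_ C) = 0 := by rw [sub_smul, hxy, sub_self]
    exact sub_eq_zero.1 ((smul_eq_zero.1 this).resolve_right hI.1)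
  have k11 : κ ≫ t (dag e₁ ≫ e₁) ≫ dag κ = φ (Irr.unit C) • 𝟙 _ := by
    rw [t11, Linear.smul_comp, Linear.comp_smul, Category.assoc, c1', Category.comp_id, c1]
  have k21 : κ ≫ t (dag e₁ ≫ e₂) ≫ dag κ = φ π • 𝟙 _ := by
    rw [t21, Linear.smul_comp, Linear.comp_smul, Category.assoc, c2', Category.comp_id, c1]
  have kmm : κ ≫ t (dag m ≫ m) ≫ dag κ = φ (Irr.unit C) • 𝟙 _ := by
    rw [tm, Linear.smul_comp, Linear.comp_smul, Category.assoc, cm', reassoc_of% cm, hr]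
  obtain ⟨ψ, k12⟩ := hI.2 (κ ≫ t (dag e₂ ≫ e₁) ≫ dag κ)
  obtain ⟨τ, -, k22⟩ := key e₂ κ
  obtain ⟨σ, hσ, kσ⟩ := key ((𝟙 _ - dag r ≫ r) ≫ m) κ
  have hτ : φ (Irr.unit C) = (τ + σ : ℝ) := by
    have h1 : dag ((𝟙 _ - dag r ≫ r) ≫ m) ≫ (𝟙 _ - dag r ≫ r) ≫ m =
        dag m ≫ m - dag e₂ ≫ e₂ := by
      have h2 : dag (𝟙 _ - dag r ≫ r) = 𝟙 _ - dag r ≫ r := by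
        rw [sub_eq_add_neg, dag_add, dag_id, ← neg_one_smul ℂ, dag_smul, dag_comp, dag_dag]
        simp
      have h3 : (𝟙 _ - dag r ≫ r) ≫ (𝟙 _ - dag r ≫ r) = 𝟙 _ - dag r ≫ r := by
        simp [Preadditive.sub_comp, Preadditive.comp_sub, reassoc_of% hr]
      rw [dag_comp, h2, Category.assoc, reassoc_of% h3, he₂, dag_comp]
      simp [Preadditive.sub_comp, Preadditive.comp_sub]
    have h4 : t (dag m ≫ m - dag e₂ ≫ e₂) = t (dag m ≫ m) - t (dag e₂ ≫ e₂) := map_sub t _ _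
    rw [h1, h4, Preadditive.sub_comp, Preadditive.comp_sub, kmm, k22, ← sub_smul] at kσ
    have := cancel kσ
    push_cast
    linear_combination this
  have hz : ∀ z : ℂ, ∃ c : ℝ, 0 ≤ c ∧
      φ (Irr.unit C) + z * φ π + star z * ψ + star z * z * τ = c := by
    intro z
    obtain ⟨c, hc, h1⟩ := key (e₁ + z • e₂) κ
    refine ⟨c, hc, cancel ?_⟩
    have h2 : dag (e₁ + z • e₂) ≫ (e₁ + z • e₂) = dag e₁ ≫ e₁ + z • (dag e₁ ≫ e₂) +
        star z • (dag e₂ ≫ e₁) + (star z * z) • (dag e₂ ≫ e₂) := by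
      simp only [dag_add, dag_smul, Preadditive.add_comp, Preadditive.comp_add, Linear.smul_comp,
        Linear.comp_smul, smul_smul, smul_add]
      rw [mul_comm]
      abel
    have h3 : t (dag (e₁ + z • e₂) ≫ (e₁ + z • e₂)) = t (dag e₁ ≫ e₁) + z • t (dag e₁ ≫ e₂) +
        star z • t (dag e₂ ≫ e₁) + (star z * z) • t (dag e₂ ≫ e₂) := by
      rw [h2]
      refine (map_add t _ _).trans (congrArg₂ _ ((map_add t _ _).trans (congrArg₂ _
        ((map_add t _ _).trans (congrArg₂ _ rfl (map_smul t _ _))) (map_smul t _ _)))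
        (map_smul t _ _))
    have h4 : ∀ (f₁ f₂ f₃ f₄ : Z ⊗ Z' ⟶ Z ⊗ Z') (u v w : ℂ),
        κ ≫ (f₁ + u • f₂ + v • f₃ + w • f₄) ≫ dag κ = κ ≫ f₁ ≫ dag κ + u • (κ ≫ f₂ ≫ dag κ) +
          v • (κ ≫ f₃ ≫ dag κ) + w • (κ ≫ f₄ ≫ dag κ) := by
      intros; simp
    rw [← h1]
    refine Eq.trans ?_ ((h4 _ _ _ _ _ _ _).symm.trans
      (congrArg (fun f => κ ≫ f ≫ dag κ) h3.symm))
    simp only [k11, k21, k12, k22, smul_smul, add_smul]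
  obtain ⟨x1, p1, q1⟩ := hz 1
  obtain ⟨x2, p2, q2⟩ := hz (-1)
  obtain ⟨x3, p3, q3⟩ := hz Complex.I
  obtain ⟨x4, p4, q4⟩ := hz (-Complex.I)
  have ht : τ ≤ τ + σ := by linarith
  rw [hτ] at q1 q2 q3 q4 ⊢
  have hu : 0 ≤ τ + σ := by
    obtain ⟨c, hc, hcc⟩ := key e₁ κ
    rw [k11, hτ] at hcc
    have := cancel hcc
    have : τ + σ = c := by exact_mod_cast this
    linarith
  have r1 := congrArg Complex.re q1
  have r2 := congrArg Complex.re q2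
  have r3 := congrArg Complex.re q3
  have r4 := congrArg Complex.re q4
  have i1 := congrArg Complex.im q1
  have i3 := congrArg Complex.im q3
  simp at r1 r2 r3 r4 i1 i3
  have hre : |(φ π).re| ≤ τ + σ := abs_le.2 ⟨by linarith, by linarith⟩
  have him : |(φ π).im| ≤ τ + σ := abs_le.2 ⟨by linarith, by linarith⟩
  rw [Complex.norm_real, Real.norm_eq_abs, abs_of_nonneg hu]
  have := Complex.norm_le_abs_re_add_abs_im (φ π)
  linarith

/-- A *-representation `Θ` of the fusion algebra is admissible if for all vectors `ξ` the function
`π ↦ d(π)⁻¹ ⟨Θ(π) ξ, ξ⟩` is a cp-multiplier. -/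
def IsAdmissible {K : Type*} [NormedAddCommGroup K] [InnerProductSpace ℂ K] [CompleteSpace K]
    (Θ : FusionAlgebra C →⋆ₐ[ℂ] (K →L[ℂ] K)) : Prop :=
  ∀ ξ : K, IsCPMultiplier fun π : Irr C =>
    (dim π.rep : ℂ)⁻¹ * inner ℂ ξ (Θ (FusionAlgebra.basis π) ξ)

theorem IsAdmissible.norm_le {K : Type*} [NormedAddCommGroup K] [InnerProductSpace ℂ K]
    [CompleteSpace K] {Θ : FusionAlgebra C →⋆ₐ[ℂ] (K →L[ℂ] K)} (h : IsAdmissible Θ) (π : Irr C) :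
    ‖Θ (FusionAlgebra.basis π)‖ ≤
      4 * (|dim π.rep| * |dim (Irr.unit C).rep|⁻¹) := by
  set T := Θ (FusionAlgebra.basis π)
  set B : ℝ := |dim π.rep| * |dim (Irr.unit C).rep|⁻¹ with hB
  have hB0 : 0 ≤ B := by positivity
  have h1 : ∀ ξ : K, ‖inner ℂ (T ξ) ξ‖ ≤ 2 * B * ‖ξ‖ ^ 2 := by
    intro ξ
    have h2 := (h ξ).norm_le π
    have h3 : Θ (FusionAlgebra.basis (Irr.unit C)) = 1 := map_one Θ
    have hd : 0 < |dim π.rep| := abs_pos.2 (dim_ne_zero π.irreducible_rep)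
    rw [h3] at h2
    simp only [norm_mul, norm_inv, Complex.norm_real, Real.norm_eq_abs,
      one_apply_eq_self, inner_self_eq_norm_sq_to_K] at h2
    rw [norm_inner_symm]
    have h4 : ‖(((‖ξ‖ : ℝ) : ℂ)) ^ 2‖ = ‖ξ‖ ^ 2 := by simp
    have h5 : ‖inner ℂ ξ (T ξ)‖ = |dim π.rep| * (|dim π.rep|⁻¹ * ‖inner ℂ ξ (T ξ)‖) := by
      field_simp
    rw [h5]
    refine (mul_le_mul_of_nonneg_left h2 hd.le).trans_eq ?_
    rw [show ‖((RCLike.ofReal ‖ξ‖ : ℂ)) ^ 2‖ = ‖ξ‖ ^ 2 from h4, hB]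
    ring
  refine ContinuousLinearMap.opNorm_le_of_re_inner_le (by positivity) fun x y hx hy => ?_
  refine (RCLike.re_le_norm _).trans ?_
  have hpol := inner_map_polarization' (T : K →ₗ[ℂ] K) x y
  simp only [ContinuousLinearMap.coe_coe] at hpol
  rw [hpol, norm_div]
  have e1 := parallelogram_law_with_norm ℂ x y
  have e2 := parallelogram_law_with_norm ℂ x (Complex.I • y)
  have hI : ‖Complex.I • y‖ = 1 := by rw [norm_smul, Complex.norm_I, hy, one_mul]
  rw [hx, hy] at e1
  rw [hx, hI] at e2
  have n1 := h1 (x + y)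
  have n2 := h1 (x - y)
  have n3 := h1 (x + Complex.I • y)
  have n4 := h1 (x - Complex.I • y)
  have tri : ∀ p q u w : ℂ, ‖p - q - Complex.I * u + Complex.I * w‖ ≤ ‖p‖ + ‖q‖ + ‖u‖ + ‖w‖ := by
    intro p q u w
    refine (norm_add_le _ _).trans ?_
    rw [norm_mul, Complex.norm_I, one_mul]
    gcongr
    refine (norm_sub_le _ _).trans ?_
    rw [norm_mul, Complex.norm_I, one_mul]
    gcongr
    exact norm_sub_le _ _
  have h4 : ‖(4 : ℂ)‖ = 4 := by simp
  rw [h4, div_le_iff₀ (by norm_num)]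
  refine (tri _ _ _ _).trans ?_
  nlinarith

end Fusion
end RigidCStarTensorCategory

section BoundedFamilies
open scoped ENNReal

/-- The C*-algebra of bounded families `(a i)` with `a i` in the C*-algebra `A i`, with the
componentwise operations and the supremum norm. -/
def BoundedFamilies {I : Type*} (A : I → Type*) [∀ i, CStarAlgebra (A i)] : Type _ := lp A ∞

variable {I : Type*} (A : I → Type*) [∀ i, CStarAlgebra (A i)] [∀ i, Nontrivial (A i)]

noncomputable instance BoundedFamilies.instCStarAlgebra : CStarAlgebra (BoundedFamilies A) :=
  { (inferInstance : NormedRing (lp A ∞)), (inferInstance : StarRing (lp A ∞)),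
    (inferInstance : CompleteSpace (lp A ∞)), (inferInstance : CStarRing (lp A ∞)),
    (inferInstance : NormedAlgebra ℂ (lp A ∞)), (inferInstance : StarModule ℂ (lp A ∞)) with }

variable {A}

/-- A family of *-homomorphisms that is bounded at every element, as one *-homomorphism. -/
noncomputable def BoundedFamilies.lift {R : Type*} [Ring R] [StarRing R] [Algebra ℂ R]
    (Θ : ∀ i, R →⋆ₐ[ℂ] A i) (h : ∀ x, Memℓp (fun i => Θ i x) ∞) : R →⋆ₐ[ℂ] BoundedFamilies A where
  toFun x := (⟨fun i => Θ i x, h x⟩ : lp A ∞)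
  map_one' := by refine Subtype.ext (funext fun i => ?_); exact map_one (Θ i)
  map_mul' x y := by refine Subtype.ext (funext fun i => ?_); exact map_mul (Θ i) x y
  map_zero' := by refine Subtype.ext (funext fun i => ?_); exact map_zero (Θ i)
  map_add' x y := by refine Subtype.ext (funext fun i => ?_); exact map_add (Θ i) x y
  commutes' c := by refine Subtype.ext (funext fun i => ?_); exact AlgHomClass.commutes (Θ i) c
  map_star' x := by refine Subtype.ext (funext fun i => ?_); exact map_star (Θ i) x

end BoundedFamilies

section ClosedRange

variable {R A : Type*} [Ring R] [StarRing R] [Algebra ℂ R] [CStarAlgebra A] (Θ : R →⋆ₐ[ℂ] A)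

/-- The closure of the range of a *-homomorphism into a C*-algebra. -/
def ClosedRange : Type _ := Θ.range.topologicalClosure

noncomputable instance ClosedRange.instCStarAlgebra : CStarAlgebra (ClosedRange Θ) :=
  haveI : IsClosed (Θ.range.topologicalClosure : Set A) :=
    StarSubalgebra.isClosed_topologicalClosure _
  inferInstanceAs (CStarAlgebra Θ.range.topologicalClosure)

/-- The *-homomorphism `Θ` with its range restricted to the closure. -/
noncomputable def ClosedRange.restrict : R →⋆ₐ[ℂ] ClosedRange Θ :=
  (StarSubalgebra.inclusion (StarSubalgebra.le_topologicalClosure Θ.range)).comp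
    Θ.rangeRestrict

end ClosedRange

section States

open scoped ComplexOrder

variable {A : Type*} [CStarAlgebra A]

/-- A state on a C*-algebra: a positive bounded functional with value `1` at the unit. -/
def IsState (ω : A →L[ℂ] ℂ) : Prop := (∀ x, 0 ≤ ω (star x * x)) ∧ ω 1 = 1

/-- A character of a C*-algebra as a bounded functional. -/
noncomputable def characterFunctional (e : A →⋆ₐ[ℂ] ℂ) : A →L[ℂ] ℂ :=
  ⟨e.toAlgHom.toLinearMap, map_continuous e⟩

end States

namespace RigidCStarTensorCategory
section Fusion
variable {C : Type u} [Category.{v} C] [Preadditive C] [Linear ℂ C]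
  [MonoidalCategory C] [MonoidalPreadditive C] [MonoidalLinear ℂ C] [RightRigidCategory C]
  [CStarTensorCategory C] [RigidCStarTensorCategory C]

variable (C) in
/-- The admissible *-representations of the fusion algebra on (nonzero) Hilbert spaces. The
universe of the Hilbert spaces contains all cyclic representations. -/
structure AdmissibleRep where
  /-- The Hilbert space. -/
  K : Type u
  [normedAddCommGroup : NormedAddCommGroup K]
  [innerProductSpace : InnerProductSpace ℂ K]
  [completeSpace : CompleteSpace K]
  [nontrivial : Nontrivial K]
  /-- The representation. -/
  Θ : FusionAlgebra C →⋆ₐ[ℂ] (K →L[ℂ] K)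
  admissible : IsAdmissible Θ

attribute [instance] AdmissibleRep.normedAddCommGroup AdmissibleRep.innerProductSpace
  AdmissibleRep.completeSpace AdmissibleRep.nontrivial

open scoped ENNReal

theorem memℓp_admissible (x : FusionAlgebra C) :
    Memℓp (fun Θ : AdmissibleRep C => Θ.Θ x) ∞ := by
  induction x using FusionAlgebra.induction_on with
  | h0 =>
    have : (fun Θ : AdmissibleRep C => Θ.Θ 0) = 0 := by funext Θ; exact map_zero Θ.Θ
    rw [this]
    exact zero_memℓp
  | hadd x y hx hy =>
    have : (fun Θ : AdmissibleRep C => Θ.Θ (x + y)) =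
        (fun Θ : AdmissibleRep C => Θ.Θ x) + (fun Θ : AdmissibleRep C => Θ.Θ y) := by
      funext Θ; exact map_add Θ.Θ x y
    rw [this]
    exact hx.add hy
  | hb c π =>
    refine memℓp_infty ⟨‖c‖ * (4 * (|dim π.rep| * |dim (Irr.unit C).rep|⁻¹)), ?_⟩
    rintro _ ⟨Θ, rfl⟩
    change ‖Θ.Θ (c • FusionAlgebra.basis π)‖ ≤ _
    rw [map_smul, norm_smul]
    exact mul_le_mul_of_nonneg_left (Θ.admissible.norm_le π) (norm_nonneg c)

variable (C) in
/-- The direct sum of all admissible representations. -/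
noncomputable def universalRep :
    FusionAlgebra C →⋆ₐ[ℂ] BoundedFamilies fun Θ : AdmissibleRep C => Θ.K →L[ℂ] Θ.K :=
  BoundedFamilies.lift (fun Θ : AdmissibleRep C => Θ.Θ) memℓp_admissible

variable (C) in
/-- The universal C*-algebra `C_u(C)`: the completion of the fusion algebra in the direct sum of
all admissible representations. -/
abbrev UniversalCStarAlgebra : Type (u + 1) := ClosedRange (universalRep C)

variable (C) in
/-- The canonical map from the fusion algebra to `C_u(C)`. -/
noncomputable def toUniversal : FusionAlgebra C →⋆ₐ[ℂ] UniversalCStarAlgebra C :=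
  ClosedRange.restrict (universalRep C)

/-- The element of `C_u(C)` defined by an object `X` of `C`. -/
noncomputable def objElement (X : C) : UniversalCStarAlgebra C := toUniversal C (FusionAlgebra.of X)

variable (C) in
/-- Property (T): every net of cp-multipliers that converges to `1` pointwise converges to `1`
uniformly. -/
def HasPropertyT : Prop :=
  ∀ (ι : Type u) [Preorder ι] [IsDirectedOrder ι] [Nonempty ι] (φ : ι → Irr C → ℂ),
    (∀ n, IsCPMultiplier (φ n)) →
    (∀ π, Filter.Tendsto (fun n => φ n π) Filter.atTop (nhds 1)) →
    TendstoUniformly φ (fun _ => 1) Filter.atTop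

/-- A nonzero projection `p` with `X p = d(X) p` for all objects `X`. -/
def IsTrivialProjection (p : UniversalCStarAlgebra C) : Prop :=
  p ≠ 0 ∧ IsStarProjection p ∧ ∀ X : C, objElement X * p = (dim X : ℂ) • p

/-- `e` is the trivial representation: `e X = d(X)`. -/
def IsTrivialRep (e : UniversalCStarAlgebra C →⋆ₐ[ℂ] ℂ) : Prop := ∀ X : C, e (objElement X) = dim X

end Fusion

end RigidCStarTensorCategory

open RigidCStarTensorCategory

/-! The bridge between multipliers and C_u(C) is the functional ω_φ(π) = d(π)φ(π) on the fusion
algebra, `symbolFunctional`. If φ is a cp-multiplier, then for every x the conjugated functional y ↦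
ω_φ(x* y x) again comes from a cp-multiplier (`IsCPMultiplier.conj`), because it is obtained by
compressing the multiplier with cups. Positivity at the unit gives ω_φ(x* x) ≥ 0, and boundedness of
cp-multipliers makes left multiplication bounded. The GNS construction then realises φ, if φ(1) ≠ 0,
as a coefficient of an admissible representation and, after normalisation, as a state on C_u(C). All
vectors of that representation give cp-multipliers because pointwise limits of cp-multipliers are
cp-multipliers (`IsCPMultiplier.of_tendsto`): each component of a multiplier is a fixed linear
expression in finitely many values of its symbol. The constant 1 corresponds to the character ε;
that d is a character rests on the uniqueness of standard solutions up to unitaries and on their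
stability under sums and tensor products.

From (T) to a projection: (T) yields a finite set F and δ > 0 such that a cp-multiplier δ-close to 1
on F stays within 1/2 of 1 everywhere. For a unit vector ξ with such a coefficient, the vectors
d(π)⁻¹Θ(π)ξ have inner product with ξ of real part at least 1/2. Their closed convex hull is stable
under the contractions d(π)⁻¹Θ(π) by the fusion rules, so its element of least norm is invariant and
not orthogonal to ξ (`AdmissibleRep.exists_invariant`). Hence the lazy random walk element of F has
a spectral gap on the complement of the invariant vectors, uniform over all admissible
representations (`HasPropertyT.exists_gap`). Its powers converge in C_u(C), and the limit p acts in
every representation as the projection onto the invariant vectors.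

From a projection to norm convergence: x p = ε(x) p, so the distance of a state ω from ε is
controlled by |ω(p) − 1| alone. From norm convergence to (T): normalised cp-multipliers are states,
pointwise convergence is weak* convergence, and ‖π‖ ≤ d(π) turns norm convergence of the states into
uniform convergence of the symbols. Uniqueness of p follows from evaluating q p in two ways. -/

namespace RigidCStarTensorCategory

/-! ### Uniqueness of standard solutions and of the dimension -/

section Dimension

variable {C : Type u} [Category.{v} C] [Preadditive C] [Linear ℂ C]
  [MonoidalCategory C] [MonoidalPreadditive C] [MonoidalLinear ℂ C] [RightRigidCategory C]
  [CStarTensorCategory C] [RigidCStarTensorCategory C]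

theorem dag_sub {X Y : C} (f g : X ⟶ Y) : dag (f - g) = dag f - dag g := by
  rw [sub_eq_add_neg, dag_add, ← neg_one_smul ℂ, dag_smul]
  simp [sub_eq_add_neg]

theorem dag_sum {ι : Type*} (s : Finset ι) {X Y : C} (f : ι → (X ⟶ Y)) :
    dag (∑ i ∈ s, f i) = ∑ i ∈ s, dag (f i) := by
  classical
  induction s using Finset.induction_on with
  | empty => simp [dag_zero]
  | insert i s hi ih => rw [Finset.sum_insert hi, dag_add, ih, Finset.sum_insert hi]

theorem dag_leftUnitor_inv (X : C) : dag (λ_ X).inv = (λ_ X).hom := by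
  rw [← dag_leftUnitor, dag_dag]

theorem dag_rightUnitor_inv (X : C) : dag (ρ_ X).inv = (ρ_ X).hom := by
  rw [← dag_rightUnitor, dag_dag]

theorem dag_associator_inv (X Y Z : C) : dag (α_ X Y Z).inv = (α_ X Y Z).hom := by
  rw [← dag_associator, dag_dag]

theorem smul_id_injective {X : C} (hX : IsIrreducible X) {a b : ℂ}
    (h : a • 𝟙 X = b • 𝟙 X) : a = b := by
  have : (a - b) • 𝟙 X = 0 := by rw [sub_smul, h, sub_self]
  exact sub_eq_zero.1 ((smul_eq_zero.1 this).resolve_right hX.1)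

theorem whiskerLeft_sub (X : C) {Y Z : C} (f g : Y ⟶ Z) : X ◁ (f - g) = X ◁ f - X ◁ g :=
  eq_sub_of_add_eq (by rw [← MonoidalPreadditive.whiskerLeft_add, sub_add_cancel])

/-- For a standard solution of the conjugate equations, the two functionals on the endomorphisms
of the conjugate object coincide. -/
theorem IsStandard.trace_conj {X Y : C} {p : ExactPairing X Y} (hp : IsStandard p) (y : Y ⟶ Y) :
    η_ X Y ≫ X ◁ y ≫ dag (η_ X Y) = dag (ε_ X Y) ≫ y ▷ X ≫ ε_ X Y := by
  let _ : HasLeftDual Y := ⟨X⟩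
  -- The mate of `y` slides it along the cup and the cap to an endomorphism of `X`, where
  -- standardness applies.
  have h1 : η_ X Y ≫ (ᘁy) ▷ Y = η_ X Y ≫ X ◁ y := coevaluation_comp_leftAdjointMate y
  have h2 : Y ◁ (ᘁy) ≫ ε_ X Y = y ▷ X ≫ ε_ X Y := leftAdjointMate_comp_evaluation y
  rw [← Category.assoc, ← h1, Category.assoc, ← h2]
  exact (hp _).symm

theorem IsStandard.evaluation_eq {X Y : C} {p : ExactPairing X Y} (hp : IsStandard p) :
    dag (ε_ X Y) ≫ ε_ X Y = η_ X Y ≫ dag (η_ X Y) := by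
  simpa using hp (𝟙 X)

theorem IsStandard.dualPairing {X Y : C} {p : ExactPairing X Y} (hp : IsStandard p) :
    IsStandard (dualPairing p) := by
  intro y
  change dag (dag (η_ X Y)) ≫ X ◁ y ≫ dag (η_ X Y) = dag (ε_ X Y) ≫ y ▷ X ≫ dag (dag (ε_ X Y))
  rw [dag_dag, dag_dag]
  exact hp.trace_conj y

theorem coevaluation_rightDualIso {X Y Y' : C} (p : ExactPairing X Y) (p' : ExactPairing X Y') :
    η_ X Y ≫ X ◁ (rightDualIso p p').hom = η_ X Y' := by
  have := @coevaluation_comp_rightAdjointMate C _ _ X X ⟨Y'⟩ ⟨Y⟩ (𝟙 X)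
  rw [id_whiskerRight, Category.comp_id] at this
  exact this

theorem rightDualIso_evaluation {X Y Y' : C} (p : ExactPairing X Y) (p' : ExactPairing X Y') :
    (rightDualIso p p').hom ▷ X ≫ ε_ X Y' = ε_ X Y := by
  have := @rightAdjointMate_comp_evaluation C _ _ X X ⟨Y'⟩ ⟨Y⟩ (𝟙 X)
  rw [MonoidalCategory.whiskerLeft_id, Category.id_comp] at this
  exact this

theorem rightDualIso_inv_evaluation {X Y Y' : C} (p : ExactPairing X Y) (p' : ExactPairing X Y') :
    (rightDualIso p p').inv ▷ X ≫ ε_ X Y = ε_ X Y' := by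
  rw [← rightDualIso_evaluation p p', ← comp_whiskerRight_assoc, Iso.inv_hom_id]
  simp

/-- Comparison of two standard solutions. -/
theorem IsStandard.comparison {X Y Y' : C} {p : ExactPairing X Y} {p' : ExactPairing X Y'}
    (hp : IsStandard p) (hp' : IsStandard p') {d d' : ℝ}
    (hd : η_ X Y ≫ dag (η_ X Y) = (d : ℂ) • 𝟙 (𝟙_ C))
    (hd' : η_ X Y' ≫ dag (η_ X Y') = (d' : ℂ) • 𝟙 (𝟙_ C)) :
    (η_ X Y ≫ X ◁ ((rightDualIso p p').hom - dag (rightDualIso p p').inv)) ≫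
      dag (η_ X Y ≫ X ◁ ((rightDualIso p p').hom - dag (rightDualIso p p').inv)) =
      ((2 * (d' - d) : ℝ) : ℂ) • 𝟙 (𝟙_ C) := by
  set g := rightDualIso p p'
  have e1 : dag (η_ X Y') = X ◁ dag g.hom ≫ dag (η_ X Y) := by
    rw [← coevaluation_rightDualIso p p', dag_comp, dag_whiskerLeft]
  have e2 : dag (ε_ X Y') = dag (ε_ X Y) ≫ dag g.inv ▷ X := by
    rw [← rightDualIso_inv_evaluation p p', dag_comp, dag_whiskerRight]
  -- The squared length of `g.hom - dag g.inv` in the trace has two square terms, each equal to `d'`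
  -- (one from the cups, one from the caps through `trace_conj`), and two cross terms, each the
  -- trace `d` of the identity.
  have h1 : η_ X Y ≫ X ◁ (g.hom ≫ dag g.hom) ≫ dag (η_ X Y) = (d' : ℂ) • 𝟙 (𝟙_ C) := by
    rw [← hd', e1, ← coevaluation_rightDualIso p p']
    simp [g]
  have h2 : η_ X Y ≫ X ◁ (dag g.inv ≫ g.inv) ≫ dag (η_ X Y) = (d' : ℂ) • 𝟙 (𝟙_ C) := by
    rw [hp.trace_conj, ← hd', ← hp'.evaluation_eq, e2, ← rightDualIso_inv_evaluation p p']
    simp [g]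
  have h3 : g.hom ≫ g.inv = 𝟙 _ := g.hom_inv_id
  have h4 : dag g.inv ≫ dag g.hom = 𝟙 _ := by rw [← dag_comp, h3, dag_id]
  have h5 : (g.hom - dag g.inv) ≫ dag (g.hom - dag g.inv) =
      g.hom ≫ dag g.hom + dag g.inv ≫ g.inv - 𝟙 _ - 𝟙 _ := by
    rw [dag_sub, dag_dag, Preadditive.sub_comp, Preadditive.comp_sub, Preadditive.comp_sub, h3, h4]
    abel
  rw [dag_comp, dag_whiskerLeft, Category.assoc, ← whiskerLeft_comp_assoc, h5]
  simp only [whiskerLeft_sub, MonoidalPreadditive.whiskerLeft_add, Preadditive.sub_comp, Preadditive.add_comp,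
    Preadditive.comp_sub, Preadditive.comp_add, h1, h2, MonoidalCategory.whiskerLeft_id,
    Category.id_comp, hd, ← sub_smul, ← add_smul]
  congr 1
  push_cast
  ring

/-- `comparison` writes `2 * (d' - d)` as the scalar of some `f ≫ dag f`, which is nonnegative. -/
theorem IsStandard.dim_le {X Y Y' : C} {p : ExactPairing X Y} {p' : ExactPairing X Y'}
    (hp : IsStandard p) (hp' : IsStandard p') {d d' : ℝ}
    (hd : η_ X Y ≫ dag (η_ X Y) = (d : ℂ) • 𝟙 (𝟙_ C))
    (hd' : η_ X Y' ≫ dag (η_ X Y') = (d' : ℂ) • 𝟙 (𝟙_ C)) : d ≤ d' := by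
  have h := hp.comparison hp' hd hd'
  obtain ⟨c, hc, h'⟩ := exists_scalar irreducible_unit
    (η_ X Y ≫ X ◁ ((rightDualIso p p').hom - dag (rightDualIso p p').inv))
  have := smul_id_injective irreducible_unit (h.symm.trans h')
  have : 2 * (d' - d) = c := by exact_mod_cast this
  linarith

theorem IsDimension.unique {X : C} {d d' : ℝ} (h : IsDimension X d) (h' : IsDimension X d') :
    d = d' := by
  obtain ⟨Y, p, hp, hd⟩ := h
  obtain ⟨Y', p', hp', hd'⟩ := h'
  exact le_antisymm (hp.dim_le hp' hd hd') (hp'.dim_le hp hd' hd)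

/-- `dim` is an arbitrary choice by `Classical.epsilon`; uniqueness allows it to be computed from
any standard solution. -/
theorem IsDimension.dim_eq {X : C} {d : ℝ} (h : IsDimension X d) : dim X = d :=
  IsDimension.unique (Classical.epsilon_spec (p := IsDimension X) ⟨d, h⟩) h

theorem exists_real_scalar {X Y : C} (p : ExactPairing X Y) :
    ∃ d : ℝ, η_ X Y ≫ dag (η_ X Y) = (d : ℂ) • 𝟙 (𝟙_ C) := by
  obtain ⟨c, -, h⟩ := exists_scalar irreducible_unit (η_ X Y)
  exact ⟨c, h⟩

theorem IsStandard.coevaluation_comp_dag {X Y : C} {p : ExactPairing X Y} (hp : IsStandard p) :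
    η_ X Y ≫ dag (η_ X Y) = (dim X : ℂ) • 𝟙 (𝟙_ C) := by
  obtain ⟨d, hd⟩ := exists_real_scalar p
  have : IsDimension X d := ⟨Y, p, hp, hd⟩
  rw [hd, this.dim_eq]

/-- Two standard solutions differ by a unitary. -/
theorem IsStandard.rightDualIso_unitary {X Y Y' : C} {p : ExactPairing X Y}
    {p' : ExactPairing X Y'} (hp : IsStandard p) (hp' : IsStandard p') :
    (rightDualIso p p').hom = dag (rightDualIso p p').inv := by
  have h := hp.comparison hp' hp.coevaluation_comp_dag hp'.coevaluation_comp_dag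
  rw [sub_self, mul_zero, Complex.ofReal_zero, zero_smul] at h
  have h1 := eq_zero_of_comp_dag h
  -- Equal dimensions make the comparison vector vanish, and by rigidity a morphism out of `Y` is
  -- determined by its composite with the cup.
  have h2 : η_ X Y ≫ X ◁ ((rightDualIso p p').hom - dag (rightDualIso p p').inv) =
      η_ X Y ≫ X ◁ (0 : Y ⟶ Y') := by rw [h1]; simp
  have h3 := congrArg (tensorLeftHomEquiv (𝟙_ C) X Y Y').symm h2
  rw [tensorLeftHomEquiv_symm_coevaluation_comp_whiskerLeft,
      tensorLeftHomEquiv_symm_coevaluation_comp_whiskerLeft] at h3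
  exact sub_eq_zero.1 ((cancel_epi _).1 h3)

/-- The trace defined by a standard solution does not depend on the solution. -/
theorem IsStandard.trace_unique {X Y Y' : C} {p : ExactPairing X Y}
    {p' : ExactPairing X Y'} (hp : IsStandard p) (hp' : IsStandard p') (f : X ⟶ X) :
    η_ X Y ≫ f ▷ Y ≫ dag (η_ X Y) = η_ X Y' ≫ f ▷ Y' ≫ dag (η_ X Y') := by
  have h1 : dag (rightDualIso p p').hom = (rightDualIso p p').inv := by
    rw [hp.rightDualIso_unitary hp', dag_dag]
  rw [← coevaluation_rightDualIso p p', dag_comp, dag_whiskerLeft, h1, Category.assoc,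
    ← whisker_exchange_assoc, ← whiskerLeft_comp_assoc, Iso.hom_inv_id]
  simp

end Dimension

end RigidCStarTensorCategory

/-! ### Direct sums of standard solutions and additivity of the dimension -/

namespace RigidCStarTensorCategory

section DirectSums

variable {C : Type u} [Category.{v} C] [Preadditive C] [Linear ℂ C]
  [MonoidalCategory C] [MonoidalPreadditive C] [MonoidalLinear ℂ C] [RightRigidCategory C]
  [CStarTensorCategory C] [RigidCStarTensorCategory C]

/-- `V`, with the isometries `a i`, is an orthogonal direct sum of the family `W`. -/
abbrev IsOrthSum {n : ℕ} (V : C) (W : Fin n → C) (a : ∀ i, W i ⟶ V) : Prop :=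
  IsDirectSum V W a fun i => dag (a i)

theorem exists_irreducible_orthSum (X : C) : ∃ (n : ℕ) (Y : Fin n → C) (a : ∀ i, Y i ⟶ X),
    (∀ i, IsIrreducible (Y i)) ∧ IsOrthSum X Y a := by
  obtain ⟨n, Y, a, h1, h2, h3, h4⟩ := semisimple X
  exact ⟨n, Y, a, h1, h2, h3, h4⟩

/-- Only binary sums are given and no zero object is assumed, so the family must be nonempty. -/
theorem exists_orthSum (n : ℕ) (W : Fin (n + 1) → C) :
    ∃ (V : C) (a : ∀ i, W i ⟶ V), IsOrthSum V W a := by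
  induction n with
  | zero =>
    refine ⟨W 0, fun i => eqToHom (by rw [Fin.fin_one_eq_zero i]), fun i => ?_, fun i j h => ?_, ?_⟩
    · obtain rfl := Fin.fin_one_eq_zero i
      simp [dag_id]
    · exact absurd ((Fin.fin_one_eq_zero i).trans (Fin.fin_one_eq_zero j).symm) h
    · simp [dag_id]
  | succ n ih =>
    obtain ⟨V, a, h1, h2, h3⟩ := ih fun i => W i.succ
    obtain ⟨Z, b, c, hb, hc, hbc⟩ := exists_directSum (W 0) V
    have h0 : b ≫ dag c = 0 := directSum_orthogonal hb hc hbc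
    have h0' : c ≫ dag b = 0 := directSum_orthogonal hc hb (by rw [add_comm]; exact hbc)
    refine ⟨Z, fun i => Fin.cases (motive := fun i => W i ⟶ Z) b (fun i => a i ≫ c) i,
      fun i => ?_, fun i j hij => ?_, ?_⟩
    · cases i using Fin.cases with
      | zero => simpa using hb
      | succ i => simp [dag_comp, reassoc_of% hc, h1]
    · cases i using Fin.cases with
      | zero =>
        cases j using Fin.cases with
        | zero => exact absurd rfl hij
        | succ j => simp [dag_comp, reassoc_of% h0]
      | succ i =>
        cases j using Fin.cases with
        | zero => simp [h0']
        | succ j =>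
          simp [dag_comp, reassoc_of% hc, h2 i j fun h => hij (congrArg Fin.succ h)]
    · rw [Fin.sum_univ_succ]
      simp only [Fin.cases_zero, Fin.cases_succ, dag_comp, Category.assoc]
      have h4 : ∑ i, dag c ≫ dag (a i) ≫ a i ≫ c = dag c ≫ (∑ i, dag (a i) ≫ a i) ≫ c := by
        simp [Preadditive.sum_comp, Preadditive.comp_sum]
      rw [h4, h3, Category.id_comp, hbc]

/-- Isolates one cross term of the zigzag for a direct sum. The summands meet only through `a ≫ a'`,
which is zero for distinct indices; for equal indices it is the identity, the zigzag of the summand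
collapses, and the projection `b' ≫ b` remains. -/
theorem sumPairing_zigzag_right {V V' W W' Z Z' : C} (η : 𝟙_ C ⟶ W ⊗ W') (ε : Z' ⊗ Z ⟶ 𝟙_ C)
    (a : W ⟶ V) (b : W' ⟶ V') (a' : V ⟶ Z) (b' : V' ⟶ Z') :
    V' ◁ (η ≫ (a ⊗ₘ b)) ≫ (α_ V' V V').inv ≫ ((b' ⊗ₘ a') ≫ ε) ▷ V' =
      b' ▷ 𝟙_ C ≫ Z' ◁ (η ≫ (a ≫ a') ▷ W') ≫ (α_ Z' Z W').inv ≫ ε ▷ W' ≫ 𝟙_ C ◁ b := by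
  have e1 : V' ◁ V ◁ b ≫ (α_ V' V V').inv ≫ ((b' ⊗ₘ a') ≫ ε) ▷ V' =
      (α_ V' V W').inv ≫ ((b' ⊗ₘ a') ≫ ε) ▷ W' ≫ 𝟙_ C ◁ b := by
    rw [associator_inv_naturality_right_assoc, whisker_exchange]
  have e2 : V' ◁ (η ≫ a ▷ W') ≫ b' ▷ (V ⊗ W') = b' ▷ 𝟙_ C ≫ Z' ◁ (η ≫ a ▷ W') :=
    whisker_exchange _ _
  rw [MonoidalCategory.tensorHom_def a b, ← Category.assoc η, MonoidalCategory.whiskerLeft_comp,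
    Category.assoc, e1, MonoidalCategory.tensorHom_def b' a']
  simp only [comp_whiskerRight, Category.assoc] at e2 ⊢
  rw [← associator_inv_naturality_left_assoc, reassoc_of% e2]
  simp

theorem sumPairing_zigzag_left {V V' W W' Z Z' : C} (η : 𝟙_ C ⟶ W ⊗ W') (ε : Z' ⊗ Z ⟶ 𝟙_ C)
    (a : W ⟶ V) (b : W' ⟶ V') (a' : V ⟶ Z) (b' : V' ⟶ Z') :
    (η ≫ (a ⊗ₘ b)) ▷ V ≫ (α_ V V' V).hom ≫ V ◁ ((b' ⊗ₘ a') ≫ ε) =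
      𝟙_ C ◁ a' ≫ (η ≫ W ◁ (b ≫ b')) ▷ Z ≫ (α_ W Z' Z).hom ≫ W ◁ ε ≫ a ▷ 𝟙_ C := by
  have e1 : a ▷ V' ▷ V ≫ (α_ V V' V).hom ≫ V ◁ ((b' ⊗ₘ a') ≫ ε) =
      (α_ W V' V).hom ≫ W ◁ ((b' ⊗ₘ a') ≫ ε) ≫ a ▷ 𝟙_ C := by
    rw [associator_naturality_left_assoc, ← whisker_exchange]
  have e2 : (η ≫ W ◁ b) ▷ V ≫ (W ⊗ V') ◁ a' = 𝟙_ C ◁ a' ≫ (η ≫ W ◁ b) ▷ Z :=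
    (whisker_exchange _ _).symm
  rw [MonoidalCategory.tensorHom_def' a b, ← Category.assoc η, comp_whiskerRight,
    Category.assoc, e1, MonoidalCategory.tensorHom_def' b' a']
  simp only [MonoidalCategory.whiskerLeft_comp, Category.assoc] at e2 ⊢
  rw [← associator_naturality_right_assoc, reassoc_of% e2]
  simp

/-- The direct sum of solutions of the conjugate equations. -/
@[reducible]
def sumPairing {n : ℕ} {V V' : C} {W W' : Fin n → C} {a : ∀ i, W i ⟶ V} {b : ∀ i, W' i ⟶ V'}
    (h : IsOrthSum V W a) (h' : IsOrthSum V' W' b) (p : ∀ i, ExactPairing (W i) (W' i)) :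
    ExactPairing V V' where
  coevaluation' := ∑ i, η_ (W i) (W' i) ≫ (a i ⊗ₘ b i)
  evaluation' := ∑ i, (dag (b i) ⊗ₘ dag (a i)) ≫ ε_ (W i) (W' i)
  coevaluation_evaluation' := by
    simp only [whiskerLeft_sum, sum_whiskerRight, Preadditive.sum_comp, Preadditive.comp_sum,
      sumPairing_zigzag_right]
    have h1 : ∀ i j, dag (b j) ▷ 𝟙_ C ≫ W' j ◁ (η_ (W i) (W' i) ≫ (a i ≫ dag (a j)) ▷ W' i) ≫
        (α_ (W' j) (W j) (W' i)).inv ≫ ε_ (W j) (W' j) ▷ W' i ≫ 𝟙_ C ◁ b i =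
        if i = j then (ρ_ V').hom ≫ (dag (b i) ≫ b i) ≫ (λ_ V').inv else 0 := by
      intro i j
      split_ifs with hij
      · subst hij
        rw [h.1]
        simp
      · rw [h.2.1 i j hij]
        simp
    simp only [h1, Finset.sum_ite_eq', Finset.mem_univ, if_true]
    rw [← Preadditive.comp_sum, ← Preadditive.sum_comp, h'.2.2, Category.id_comp]
  evaluation_coevaluation' := by
    simp only [whiskerLeft_sum, sum_whiskerRight, Preadditive.sum_comp, Preadditive.comp_sum,
      sumPairing_zigzag_left]
    have h1 : ∀ i j, 𝟙_ C ◁ dag (a j) ≫ (η_ (W i) (W' i) ≫ W i ◁ (b i ≫ dag (b j))) ▷ W j ≫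
        (α_ (W i) (W' j) (W j)).hom ≫ W i ◁ ε_ (W j) (W' j) ≫ a i ▷ 𝟙_ C =
        if i = j then (λ_ V).hom ≫ (dag (a i) ≫ a i) ≫ (ρ_ V).inv else 0 := by
      intro i j
      split_ifs with hij
      · subst hij
        rw [h'.1]
        simp
      · rw [h'.2.1 i j hij]
        simp
    simp only [h1, Finset.sum_ite_eq', Finset.mem_univ, if_true]
    rw [← Preadditive.comp_sum, ← Preadditive.sum_comp, h.2.2, Category.id_comp]

section

variable {n : ℕ} {V V' : C} {W W' : Fin n → C} {a : ∀ i, W i ⟶ V} {b : ∀ i, W' i ⟶ V'}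
    (h : IsOrthSum V W a) (h' : IsOrthSum V' W' b) (p : ∀ i, ExactPairing (W i) (W' i))

/-- Orthogonality of the `b i` in the conjugate object removes the off-diagonal terms, so the trace
sees only the diagonal blocks of `f`. -/
theorem sumPairing_trace (f : V ⟶ V) :
    (sumPairing h h' p).coevaluation' ≫ f ▷ V' ≫ dag (sumPairing h h' p).coevaluation' =
      ∑ i, η_ (W i) (W' i) ≫ (a i ≫ f ≫ dag (a i)) ▷ W' i ≫ dag (η_ (W i) (W' i)) := by
  change (∑ i, η_ (W i) (W' i) ≫ (a i ⊗ₘ b i)) ≫ f ▷ V' ≫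
    dag (∑ i, η_ (W i) (W' i) ≫ (a i ⊗ₘ b i)) = _
  simp only [dag_sum, Preadditive.sum_comp, Preadditive.comp_sum, dag_comp, dag_tensor,
    Category.assoc]
  refine Finset.sum_congr rfl fun i _ => ?_
  rw [Finset.sum_eq_single i]
  · rw [← tensorHom_id, tensorHom_comp_tensorHom_assoc, tensorHom_comp_tensorHom_assoc]
    simp only [Category.assoc, Category.id_comp, h'.1, ← tensorHom_id]
  · intro j _ hij
    rw [← tensorHom_id, tensorHom_comp_tensorHom_assoc, tensorHom_comp_tensorHom_assoc]
    simp [h'.2.1 j i hij]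
  · simp

theorem sumPairing_trace' (f : V ⟶ V) :
    dag (sumPairing h h' p).evaluation' ≫ V' ◁ f ≫ (sumPairing h h' p).evaluation' =
      ∑ i, dag (ε_ (W i) (W' i)) ≫ W' i ◁ (a i ≫ f ≫ dag (a i)) ≫ ε_ (W i) (W' i) := by
  change dag (∑ i, (dag (b i) ⊗ₘ dag (a i)) ≫ ε_ (W i) (W' i)) ≫ V' ◁ f ≫
    (∑ i, (dag (b i) ⊗ₘ dag (a i)) ≫ ε_ (W i) (W' i)) = _
  simp only [dag_sum, Preadditive.sum_comp, Preadditive.comp_sum, dag_comp, dag_tensor,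
    Category.assoc, dag_dag]
  refine Finset.sum_congr rfl fun i _ => ?_
  rw [Finset.sum_eq_single i]
  · rw [← id_tensorHom, tensorHom_comp_tensorHom_assoc, tensorHom_comp_tensorHom_assoc]
    simp only [Category.assoc, Category.id_comp, h'.1, ← id_tensorHom]
  · intro j _ hij
    rw [← id_tensorHom, tensorHom_comp_tensorHom_assoc, tensorHom_comp_tensorHom_assoc]
    simp [h'.2.1 j i hij]
  · simp

theorem sumPairing_isStandard (hp : ∀ i, IsStandard (p i)) : IsStandard (sumPairing h h' p) := by
  intro f
  refine (sumPairing_trace' h h' p f).trans (Eq.trans ?_ (sumPairing_trace h h' p f).symm)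
  exact Finset.sum_congr rfl fun i _ => hp i _

end

/-- The pairing of zero objects. -/
@[reducible]
def zeroPairing {V : C} (hV : 𝟙 V = 0) : ExactPairing V V where
  coevaluation' := 0
  evaluation' := 0
  coevaluation_evaluation' := by
    rw [← Category.id_comp (ρ_ V).hom, ← id_whiskerRight, hV]
    simp
  evaluation_coevaluation' := by
    rw [← Category.id_comp (λ_ V).hom, ← MonoidalCategory.whiskerLeft_id, hV]
    simp

/-- Every object that is an orthogonal sum of objects with standard solutions has a standard
solution, and its trace is the sum of the traces of the summands. -/
theorem exists_standard_sum {n : ℕ} {V : C} {W W' : Fin n → C} {a : ∀ i, W i ⟶ V}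
    (h : IsOrthSum V W a) (p : ∀ i, ExactPairing (W i) (W' i)) (hp : ∀ i, IsStandard (p i)) :
    ∃ (V' : C) (P : ExactPairing V V'), IsStandard P ∧ ∀ f : V ⟶ V,
      η_ V V' ≫ f ▷ V' ≫ dag (η_ V V') =
      ∑ i, η_ (W i) (W' i) ≫ (a i ≫ f ≫ dag (a i)) ▷ W' i ≫ dag (η_ (W i) (W' i)) := by
  cases n with
  | zero =>
    -- An empty sum has zero identity; it is treated apart because `exists_orthSum` needs a summand.
    have hV : 𝟙 V = 0 := by rw [← h.2.2]; simp
    refine ⟨V, zeroPairing hV, fun f => ?_, fun f => ?_⟩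
    · change dag (0 : V ⊗ V ⟶ 𝟙_ C) ≫ _ ≫ 0 = (0 : 𝟙_ C ⟶ V ⊗ V) ≫ _
      simp
    · change (0 : 𝟙_ C ⟶ V ⊗ V) ≫ _ = _
      simp
  | succ n =>
    obtain ⟨V', b, h'⟩ := exists_orthSum n W'
    exact ⟨V', sumPairing h h' p, sumPairing_isStandard h h' p hp, sumPairing_trace h h' p⟩

theorem exists_standard (X : C) : ∃ (Y : C) (p : ExactPairing X Y), IsStandard p := by
  obtain ⟨n, Y, a, hY, h⟩ := exists_irreducible_orthSum X
  choose d hd using fun i => exists_isDimension (hY i)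
  choose W' p hp hd using hd
  obtain ⟨V', P, hP, -⟩ := exists_standard_sum h p hp
  exact ⟨V', P, hP⟩

theorem dim_orthSum {n : ℕ} {V : C} {W : Fin n → C} {a : ∀ i, W i ⟶ V}
    (h : IsOrthSum V W a) : dim V = ∑ i, dim (W i) := by
  choose W' p hp using fun i => exists_standard (W i)
  obtain ⟨V', P, hP, hP'⟩ := exists_standard_sum h p hp
  have h1 := hP' (𝟙 V)
  simp only [id_whiskerRight, Category.id_comp, h.1, hP.coevaluation_comp_dag,
    fun i => (hp i).coevaluation_comp_dag] at h1
  rw [← Finset.sum_smul] at h1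
  exact_mod_cast smul_id_injective irreducible_unit h1

/-- The trace of a projection onto a summand is the dimension of the summand. -/
theorem IsStandard.trace_summand {n : ℕ} {V V' : C} {W : Fin n → C} {a : ∀ i, W i ⟶ V}
    (h : IsOrthSum V W a) {P : ExactPairing V V'} (hP : IsStandard P) (i : Fin n) :
    η_ V V' ≫ (dag (a i) ≫ a i) ▷ V' ≫ dag (η_ V V') = (dim (W i) : ℂ) • 𝟙 (𝟙_ C) := by
  choose W' p hp using fun i => exists_standard (W i)
  obtain ⟨V'', Q, hQ, hQ'⟩ := exists_standard_sum h p hp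
  rw [hP.trace_unique hQ, hQ', Finset.sum_eq_single i]
  · simp only [Category.assoc, h.1, Category.comp_id, id_whiskerRight, Category.id_comp]
    rw [(hp i).coevaluation_comp_dag]
  · intro j _ hij
    simp only [Category.assoc]
    rw [reassoc_of% h.2.1 j i hij]
    simp
  · simp

theorem dim_pos {X : C} (hX : IsIrreducible X) : 0 < dim X := by
  obtain ⟨Y, p, hp⟩ := exists_standard X
  obtain ⟨c, hc, h⟩ := exists_scalar irreducible_unit (η_ X Y)
  have h1 : (dim X : ℂ) = c := smul_id_injective irreducible_unit (hp.coevaluation_comp_dag.symm.trans h)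
  have h2 : dim X = c := by exact_mod_cast h1
  exact lt_of_le_of_ne (h2 ▸ hc) (dim_ne_zero hX).symm

theorem dim_eq_of_unitary {X Y : C} (u : X ⟶ Y) (h1 : u ≫ dag u = 𝟙 X) (h2 : dag u ≫ u = 𝟙 Y) :
    dim X = dim Y := by
  have : IsOrthSum Y (fun _ : Fin 1 => X) (fun _ => u) :=
    ⟨fun _ => h1, fun i j h => absurd (Subsingleton.elim i j) h, by simpa using h2⟩
  simpa using (dim_orthSum this).symm

/-- Between irreducible objects an isomorphism is a scalar multiple of a unitary, and a unitary is a
direct sum with one term. -/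
theorem dim_eq_of_irreducible_iso {X Y : C} (hX : IsIrreducible X) (e : X ≅ Y) :
    dim X = dim Y := by
  have hY := hX.congr e
  have he : e.hom ≠ 0 := fun h => hX.1 (by rw [← e.hom_inv_id, h]; simp)
  obtain ⟨c, hc, h⟩ := exists_scalar_pos hX he
  have hs : star ((Real.sqrt c : ℂ)⁻¹) * (Real.sqrt c : ℂ)⁻¹ * c = 1 := by
    have h2 : (Real.sqrt c)⁻¹ * (Real.sqrt c)⁻¹ * c = 1 := by
      rw [← mul_inv, Real.mul_self_sqrt hc.le, inv_mul_cancel₀ hc.ne']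
    simpa using congrArg (fun t : ℝ => (t : ℂ)) h2
  have h1 : ((Real.sqrt c : ℂ)⁻¹ • e.hom) ≫ dag ((Real.sqrt c : ℂ)⁻¹ • e.hom) = 𝟙 X := by
    rw [dag_smul, Linear.comp_smul, Linear.smul_comp, h, smul_smul, smul_smul, hs, one_smul]
  have hi : IsIso ((Real.sqrt c : ℂ)⁻¹ • e.hom) :=
    hX.isIso hY (smul_ne_zero (by simpa using (Real.sqrt_pos.2 hc).ne') he)
  refine dim_eq_of_unitary _ h1 ?_
  rw [← cancel_epi ((Real.sqrt c : ℂ)⁻¹ • e.hom), reassoc_of% h1, Category.comp_id]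

theorem dim_rep_mk {X : C} (hX : IsIrreducible X) : dim (Irr.mk X hX).rep = dim X :=
  dim_eq_of_irreducible_iso (Irr.irreducible_rep _) (Irr.rep_mk hX).some

/-- The linear functional on the fusion algebra that takes the value `f π` at `π`. -/
noncomputable def FusionAlgebra.extend (f : Irr C → ℂ) : FusionAlgebra C →ₗ[ℂ] ℂ :=
  Finsupp.lift ℂ ℂ (Irr C) f

theorem FusionAlgebra.extend_basis (f : Irr C → ℂ) (π : Irr C) :
    FusionAlgebra.extend f (FusionAlgebra.basis π) = f π := by
  change Finsupp.lift ℂ ℂ (Irr C) f (Finsupp.single π 1) = _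
  simp

theorem FusionAlgebra.extend_of (f : Irr C → ℂ) {n : ℕ} {V : C} {W : Fin n → C}
    {b : ∀ i, W i ⟶ V} {b' : ∀ i, V ⟶ W i} (h : IsDirectSum V W b b')
    (hW : ∀ i, IsIrreducible (W i)) :
    FusionAlgebra.extend f (FusionAlgebra.of V) = ∑ i, f (Irr.mk (W i) (hW i)) := by
  rw [FusionAlgebra.of_isDirectSum h, map_sum]
  refine Finset.sum_congr rfl fun i _ => ?_
  rw [FusionAlgebra.of_irreducible (hW i), FusionAlgebra.extend_basis]

variable (C) in
/-- The dimension as a linear functional on the fusion algebra. -/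
noncomputable def dimFunctional : FusionAlgebra C →ₗ[ℂ] ℂ :=
  FusionAlgebra.extend fun π => (dim π.rep : ℂ)

theorem dimFunctional_of (X : C) : dimFunctional C (FusionAlgebra.of X) = dim X := by
  obtain ⟨n, Y, a, hY, h⟩ := exists_irreducible_orthSum X
  rw [dimFunctional, FusionAlgebra.extend_of _ h hY, dim_orthSum h]
  push_cast
  exact Finset.sum_congr rfl fun i _ => by rw [dim_rep_mk]

/-- An isomorphism need not be unitary; the passage through the fusion algebra, where `of` depends
only on the isomorphism class, avoids a polar decomposition. -/
theorem dim_congr {X Y : C} (e : X ≅ Y) : dim X = dim Y := by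
  have := dimFunctional_of X
  rw [FusionAlgebra.of_congr e, dimFunctional_of] at this
  exact_mod_cast this.symm

theorem dim_dual (X : C) : dim (Xᘁ) = dim X := by
  obtain ⟨Y, p, hp⟩ := exists_standard X
  rw [← dim_congr (rightDualIso p (HasRightDual.exact (X := X)))]
  refine IsDimension.dim_eq ⟨X, dualPairing p, hp.dualPairing, ?_⟩
  change dag (ε_ X Y) ≫ dag (dag (ε_ X Y)) = _
  rw [dag_dag, hp.evaluation_eq, hp.coevaluation_comp_dag]

end DirectSums

end RigidCStarTensorCategory

/-! ### Tensor products of standard solutions; the dimension as a character -/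

namespace RigidCStarTensorCategory

section Tensor

variable {C : Type u} [Category.{v} C] [Preadditive C] [Linear ℂ C]
  [MonoidalCategory C] [MonoidalPreadditive C] [MonoidalLinear ℂ C] [RightRigidCategory C]
  [CStarTensorCategory C] [RigidCStarTensorCategory C]

/-- The partial trace of an endomorphism of `A ⊗ B` over `B`. -/
def rightPartialTrace {A B B' : C} (s : 𝟙_ C ⟶ B ⊗ B') (f : A ⊗ B ⟶ A ⊗ B) : A ⟶ A :=
  (ρ_ A).inv ≫ A ◁ s ≫ (α_ A B B').inv ≫ f ▷ B' ≫ (α_ A B B').hom ≫ A ◁ dag s ≫ (ρ_ A).hom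

/-- The partial trace of an endomorphism of `A ⊗ B` over `A`. -/
def leftPartialTrace {A A' B : C} (t : A' ⊗ A ⟶ 𝟙_ C) (f : A ⊗ B ⟶ A ⊗ B) : B ⟶ B :=
  (λ_ B).inv ≫ dag t ▷ B ≫ (α_ A' A B).hom ≫ A' ◁ f ≫ (α_ A' A B).inv ≫ t ▷ B ≫ (λ_ B).hom

/-- The loop of `A` on the left and the loop of `B` on the right occupy disjoint regions of the
diagram, so the interchange law lets them be closed in either order. -/
theorem partialTrace_exchange {A A' B B' : C} (t : A' ⊗ A ⟶ 𝟙_ C) (s : 𝟙_ C ⟶ B ⊗ B')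
    (f : A ⊗ B ⟶ A ⊗ B) :
    dag t ≫ A' ◁ rightPartialTrace s f ≫ t = s ≫ leftPartialTrace t f ▷ B' ≫ dag s := by
  have e1 : ∀ t' : 𝟙_ C ⟶ A' ⊗ A, t' ▷ 𝟙_ C ≫ (A' ⊗ A) ◁ s = 𝟙_ C ◁ s ≫ t' ▷ (B ⊗ B') :=
    fun t' => (whisker_exchange _ _).symm
  have e2 : ∀ s' : B ⊗ B' ⟶ 𝟙_ C, (A' ⊗ A) ◁ s' ≫ t ▷ 𝟙_ C = t ▷ (B ⊗ B') ≫ 𝟙_ C ◁ s' :=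
    fun s' => whisker_exchange _ _
  calc dag t ≫ A' ◁ rightPartialTrace s f ≫ t
      = 𝟙 _ ⊗≫ (dag t ▷ 𝟙_ C ≫ (A' ⊗ A) ◁ s) ⊗≫ A' ◁ f ▷ B' ⊗≫
          ((A' ⊗ A) ◁ dag s ≫ t ▷ 𝟙_ C) ⊗≫ 𝟙 _ := by
        rw [rightPartialTrace]; monoidal
    _ = _ := by
        rw [e1, e2, leftPartialTrace]; monoidal

section

variable {A A' B B' : C} [ExactPairing A A'] [ExactPairing B B']

theorem tensor_coevaluation_eq : η_ (A ⊗ B) (B' ⊗ A') =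
    η_ A A' ≫ ((ρ_ A).inv ≫ A ◁ η_ B B' ≫ (α_ A B B').inv) ▷ A' ≫ (α_ (A ⊗ B) B' A').hom := by
  rw [ExactPairing.tensor_coevaluation]; monoidal

theorem tensor_evaluation_eq : ε_ (A ⊗ B) (B' ⊗ A') = (α_ B' A' (A ⊗ B)).hom ≫
    B' ◁ ((α_ A' A B).inv ≫ ε_ A A' ▷ B ≫ (λ_ B).hom) ≫ ε_ B B' := by
  rw [ExactPairing.tensor_evaluation]; monoidal

theorem tensor_trace (f : A ⊗ B ⟶ A ⊗ B) :
    η_ (A ⊗ B) (B' ⊗ A') ≫ f ▷ (B' ⊗ A') ≫ dag (η_ (A ⊗ B) (B' ⊗ A')) =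
      η_ A A' ≫ rightPartialTrace (η_ B B') f ▷ A' ≫ dag (η_ A A') := by
  rw [tensor_coevaluation_eq, rightPartialTrace]
  simp only [dag_comp, dag_whiskerRight, dag_whiskerLeft, dag_associator, dag_associator_inv,
    dag_rightUnitor_inv, comp_whiskerRight, Category.assoc]
  simp

theorem tensor_trace' (f : A ⊗ B ⟶ A ⊗ B) :
    dag (ε_ (A ⊗ B) (B' ⊗ A')) ≫ (B' ⊗ A') ◁ f ≫ ε_ (A ⊗ B) (B' ⊗ A') =
      dag (ε_ B B') ≫ B' ◁ leftPartialTrace (ε_ A A') f ≫ ε_ B B' := by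
  rw [tensor_evaluation_eq, leftPartialTrace]
  simp only [dag_comp, dag_whiskerRight, dag_whiskerLeft, dag_associator, dag_associator_inv,
    dag_leftUnitor, MonoidalCategory.whiskerLeft_comp, Category.assoc]
  simp

end

/-- In the left trace, standardness of `B` moves its loop to the right; after
`partialTrace_exchange`, standardness of `A` moves the other loop as well. -/
theorem IsStandard.tensor {A A' B B' : C} {p : ExactPairing A A'} {q : ExactPairing B B'}
    (hp : IsStandard p) (hq : IsStandard q) :
    IsStandard (ExactPairing.tensor : ExactPairing (A ⊗ B) (B' ⊗ A')) := by
  intro f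
  rw [tensor_trace', hq, ← partialTrace_exchange, hp, tensor_trace]

/-- The trace of a tensor product with the first factor closed on the left and the second factor
closed on the right. -/
theorem IsStandard.tensor_trace_mixed {A A' B B' : C} {p : ExactPairing A A'}
    {q : ExactPairing B B'} (hp : IsStandard p) (f : A ⊗ B ⟶ A ⊗ B) :
    η_ (A ⊗ B) (B' ⊗ A') ≫ f ▷ (B' ⊗ A') ≫ dag (η_ (A ⊗ B) (B' ⊗ A')) =
      η_ B B' ≫ leftPartialTrace (ε_ A A') f ▷ B' ≫ dag (η_ B B') := by
  rw [tensor_trace, ← hp, partialTrace_exchange]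

theorem dim_tensor (A B : C) : dim (A ⊗ B) = dim A * dim B := by
  obtain ⟨A', p, hp⟩ := exists_standard A
  obtain ⟨B', q, hq⟩ := exists_standard B
  have h1 := tensor_trace (A' := A') (B' := B') (𝟙 (A ⊗ B))
  rw [id_whiskerRight, Category.id_comp, (hp.tensor hq).coevaluation_comp_dag] at h1
  have h2 : rightPartialTrace (η_ B B') (𝟙 (A ⊗ B)) = (dim B : ℂ) • 𝟙 A := by
    have h3 : A ◁ η_ B B' ≫ A ◁ dag (η_ B B') = (dim B : ℂ) • 𝟙 _ := by
      rw [← MonoidalCategory.whiskerLeft_comp, hq.coevaluation_comp_dag,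
        MonoidalLinear.whiskerLeft_smul, MonoidalCategory.whiskerLeft_id]
    simp only [rightPartialTrace, id_whiskerRight, Category.id_comp, Iso.inv_hom_id_assoc]
    rw [reassoc_of% h3, Linear.smul_comp, Linear.comp_smul, Category.id_comp, Iso.inv_hom_id]
  rw [h2] at h1
  have h4 : (dim (A ⊗ B) : ℂ) = dim A * dim B := by
    refine smul_id_injective irreducible_unit (h1.trans ?_)
    simp only [MonoidalLinear.smul_whiskerRight, id_whiskerRight, Linear.smul_comp,
      Linear.comp_smul, Category.id_comp, hp.coevaluation_comp_dag, smul_smul]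
    rw [mul_comm]
  exact_mod_cast h4

theorem dim_unit : dim (𝟙_ C) = 1 := by
  have h1 := dim_tensor (𝟙_ C) (𝟙_ C)
  rw [dim_congr (λ_ (𝟙_ C))] at h1
  have h2 := (dim_pos (C := C) irreducible_unit).ne'
  exact (mul_left_cancel₀ h2 (by rw [mul_one]; exact h1)).symm

theorem dim_rep_unit : dim (Irr.unit C).rep = 1 :=
  (dim_rep_mk irreducible_unit).trans dim_unit

theorem dim_rep_conj (π : Irr C) : dim π.conj.rep = dim π.rep :=
  (dim_rep_mk _).trans (dim_dual _)

variable (C) in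
/-- The dimension as a *-homomorphism on the fusion algebra. -/
noncomputable def dimHom : FusionAlgebra C →⋆ₐ[ℂ] ℂ where
  toFun := dimFunctional C
  map_one' := by
    change dimFunctional C (FusionAlgebra.basis (Irr.unit C)) = 1
    rw [dimFunctional, FusionAlgebra.extend_basis, dim_rep_unit, Complex.ofReal_one]
  map_mul' x y := by
    induction x using FusionAlgebra.induction_on with
    | h0 => simp
    | hadd x x' h h' => simp only [add_mul, map_add, h, h']
    | hb c π =>
    induction y using FusionAlgebra.induction_on with
    | h0 => simp
    | hadd x x' h h' => simp only [mul_add, map_add, h, h']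
    | hb d ρ =>
    rw [smul_mul_smul_comm, ← FusionAlgebra.of_rep, ← FusionAlgebra.of_rep,
      FusionAlgebra.of_mul_of]
    simp only [map_smul, dimFunctional_of, dim_tensor, smul_eq_mul]
    push_cast
    ring
  map_zero' := map_zero _
  map_add' := map_add _
  commutes' c := by
    rw [Algebra.algebraMap_eq_smul_one, map_smul]
    change c • dimFunctional C (FusionAlgebra.basis (Irr.unit C)) = c
    rw [dimFunctional, FusionAlgebra.extend_basis, dim_rep_unit]
    simp
  map_star' x := by
    induction x using FusionAlgebra.induction_on with
    | h0 => simp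
    | hadd x x' h h' => simp only [star_add, map_add, h, h']
    | hb c π =>
    rw [star_smul, FusionAlgebra.star_basis, map_smul, map_smul, dimFunctional,
      FusionAlgebra.extend_basis, FusionAlgebra.extend_basis, dim_rep_conj]
    simp

theorem dimHom_of (X : C) : dimHom C (FusionAlgebra.of X) = dim X := dimFunctional_of X

theorem dimHom_basis (π : Irr C) : dimHom C (FusionAlgebra.basis π) = dim π.rep := by
  rw [← FusionAlgebra.of_rep, dimHom_of]

end Tensor

end RigidCStarTensorCategory

/-! ### Recovering a multiplier from its symbol -/

namespace RigidCStarTensorCategory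

section Amplification

variable {C : Type u} [Category.{v} C] [Preadditive C] [Linear ℂ C]
  [MonoidalCategory C] [MonoidalPreadditive C] [MonoidalLinear ℂ C] [RightRigidCategory C]
  [CStarTensorCategory C] [RigidCStarTensorCategory C]

/-- The morphism `1 ⊗ x ⊗ 1` for a morphism `x : Z ⊗ W ⟶ X ⊗ Y`. -/
def ampHom (X₂ Y₂ : C) {X Y Z W : C} (x : Z ⊗ W ⟶ X ⊗ Y) :
    (X₂ ⊗ Z) ⊗ (W ⊗ Y₂) ⟶ (X₂ ⊗ X) ⊗ (Y ⊗ Y₂) :=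
  (α_ X₂ Z (W ⊗ Y₂)).hom ≫
    X₂ ◁ ((α_ Z W Y₂).inv ≫ x ▷ Y₂ ≫ (α_ X Y Y₂).hom) ≫ (α_ X₂ X (Y ⊗ Y₂)).inv

theorem amplification_eq_ampHom (X₂ Y₂ : C) {X Y : C} (x : X ⊗ Y ⟶ X ⊗ Y) :
    amplification X₂ Y₂ x = ampHom X₂ Y₂ x := rfl

theorem ampHom_comp (X₂ Y₂ : C) {X Y Z W Z' W' : C} (x : Z ⊗ W ⟶ X ⊗ Y) (y : X ⊗ Y ⟶ Z' ⊗ W') :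
    ampHom X₂ Y₂ (x ≫ y) = ampHom X₂ Y₂ x ≫ ampHom X₂ Y₂ y := by
  simp [ampHom]

theorem ampHom_add (X₂ Y₂ : C) {X Y Z W : C} (x y : Z ⊗ W ⟶ X ⊗ Y) :
    ampHom X₂ Y₂ (x + y) = ampHom X₂ Y₂ x + ampHom X₂ Y₂ y := by
  simp [ampHom]

theorem ampHom_smul (X₂ Y₂ : C) {X Y Z W : C} (c : ℂ) (x : Z ⊗ W ⟶ X ⊗ Y) :
    ampHom X₂ Y₂ (c • x) = c • ampHom X₂ Y₂ x := by
  simp [ampHom]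

/-- `ampHom` as a linear map. -/
def ampHomₗ (X₂ Y₂ X Y Z W : C) :
    (Z ⊗ W ⟶ X ⊗ Y) →ₗ[ℂ] ((X₂ ⊗ Z) ⊗ (W ⊗ Y₂) ⟶ (X₂ ⊗ X) ⊗ (Y ⊗ Y₂)) where
  toFun := ampHom X₂ Y₂
  map_add' := ampHom_add X₂ Y₂
  map_smul' := ampHom_smul X₂ Y₂

theorem ampHom_sum (X₂ Y₂ : C) {X Y Z W : C} {ι : Type*} (s : Finset ι)
    (x : ι → (Z ⊗ W ⟶ X ⊗ Y)) : ampHom X₂ Y₂ (∑ i ∈ s, x i) = ∑ i ∈ s, ampHom X₂ Y₂ (x i) :=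
  map_sum (ampHomₗ X₂ Y₂ X Y Z W) x s

theorem ampHom_tensorHom (X₂ Y₂ : C) {X Y Z W : C} (a : Z ⟶ X) (b : W ⟶ Y) :
    ampHom X₂ Y₂ (a ⊗ₘ b) = (X₂ ◁ a) ⊗ₘ (b ▷ Y₂) := by
  simp [ampHom, MonoidalCategory.tensorHom_def]

theorem dag_ampHom (X₂ Y₂ : C) {X Y Z W : C} (x : Z ⊗ W ⟶ X ⊗ Y) :
    dag (ampHom X₂ Y₂ x) = ampHom X₂ Y₂ (dag x) := by
  simp [ampHom, dag_comp, dag_whiskerLeft, dag_whiskerRight, dag_associator, dag_associator_inv]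

theorem ampHom_naturality {X₂ X₂' Y₂ Y₂' X Y Z W : C} (f : X₂ ⟶ X₂') (g : Y₂ ⟶ Y₂')
    (x : Z ⊗ W ⟶ X ⊗ Y) :
    (f ▷ Z ⊗ₘ W ◁ g) ≫ ampHom X₂' Y₂' x = ampHom X₂ Y₂ x ≫ (f ▷ X ⊗ₘ Y ◁ g) := by
  calc (f ▷ Z ⊗ₘ W ◁ g) ≫ ampHom X₂' Y₂' x
      = 𝟙 _ ⊗≫ f ▷ (Z ⊗ W ⊗ Y₂) ⊗≫ X₂' ◁ ((Z ⊗ W) ◁ g ≫ x ▷ Y₂') ⊗≫ 𝟙 _ := by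
        rw [MonoidalCategory.tensorHom_def, ampHom]; monoidal
    _ = 𝟙 _ ⊗≫ (f ▷ ((Z ⊗ W) ⊗ Y₂) ≫ X₂' ◁ (x ▷ Y₂)) ⊗≫ (X₂' ⊗ X ⊗ Y) ◁ g ⊗≫ 𝟙 _ := by
        rw [whisker_exchange]; monoidal
    _ = _ := by
        rw [← whisker_exchange, MonoidalCategory.tensorHom_def, ampHom]; monoidal

theorem ampHom_ampHom (X₃ Y₃ X₂ Y₂ : C) {X Y Z W : C} (x : Z ⊗ W ⟶ X ⊗ Y) :
    ampHom (X₃ ⊗ X₂) (Y₂ ⊗ Y₃) x = ((α_ X₃ X₂ Z).hom ⊗ₘ (α_ W Y₂ Y₃).inv) ≫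
      ampHom X₃ Y₃ (ampHom X₂ Y₂ x) ≫ ((α_ X₃ X₂ X).inv ⊗ₘ (α_ Y Y₂ Y₃).hom) := by
  simp only [MonoidalCategory.tensorHom_def, ampHom]
  monoidal

variable {θ : Multiplier C}

/-- The extension of a multiplier is compatible with amplification. -/
theorem extension_ampHom (Θ : θ.Extension) (X₂ Y₂ : C) {X Y Z W : C} (x : Z ⊗ W ⟶ X ⊗ Y) :
    Θ.toFun _ _ _ _ (ampHom X₂ Y₂ x) = ampHom X₂ Y₂ (Θ.toFun _ _ _ _ x) := by
  -- The axiom `amplify` concerns endomorphisms only. With `P` the sum of `X` and `Z` and `Q` the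
  -- sum of `Y` and `W`, the morphism `x` is a corner of an endomorphism of `P ⊗ Q`; it is amplified
  -- there and then cut back.
  obtain ⟨P, a, c, ha, hc, -⟩ := exists_directSum X Z
  obtain ⟨Q, b, e, hb, he, -⟩ := exists_directSum Y W
  have h1 := Θ.natural x a b (dag c) (dag e)
  rw [Θ.restrict] at h1
  have h2 := θ.amplify X₂ P Q Y₂ ((dag c ⊗ₘ dag e) ≫ x ≫ (a ⊗ₘ b))
  rw [← Θ.restrict, h1, amplification_eq_ampHom, amplification_eq_ampHom] at h2
  simp only [ampHom_comp, ampHom_tensorHom] at h2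
  rw [Θ.natural] at h2
  have h3 := congrArg (fun f => (X₂ ◁ c ⊗ₘ e ▷ Y₂) ≫ f ≫ (X₂ ◁ dag a ⊗ₘ dag b ▷ Y₂)) h2
  have h4 : (X₂ ◁ c ⊗ₘ e ▷ Y₂) ≫ (X₂ ◁ dag c ⊗ₘ dag e ▷ Y₂) = 𝟙 _ := by
    rw [tensorHom_comp_tensorHom, ← MonoidalCategory.whiskerLeft_comp, ← comp_whiskerRight, hc, he]
    simp
  have h5 : (X₂ ◁ a ⊗ₘ b ▷ Y₂) ≫ (X₂ ◁ dag a ⊗ₘ dag b ▷ Y₂) = 𝟙 _ := by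
    rw [tensorHom_comp_tensorHom, ← MonoidalCategory.whiskerLeft_comp, ← comp_whiskerRight, ha, hb]
    simp
  simp only [Category.assoc, h5, Category.comp_id, reassoc_of% h4] at h3
  exact h3

section Components

variable {X' X : C} [ExactPairing X' X]

/-- Inserting an endomorphism `g` of `X' ⊗ Z`, where `X'` is conjugate to `X`, into a morphism
`X ⊗ Y ⟶ Z ⊗ W`. -/
def insertEnd {Y Z W : C} (g : X' ⊗ Z ⟶ X' ⊗ Z) (x : X ⊗ Y ⟶ Z ⊗ W) : X ⊗ Y ⟶ Z ⊗ W :=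
  X ◁ ((λ_ Y).inv ≫ η_ X' X ▷ Y ≫ (α_ X' X Y).hom ≫ X' ◁ x ≫ (α_ X' Z W).inv ≫ g ▷ W) ≫
    (α_ X (X' ⊗ Z) W).inv ≫ ((α_ X X' Z).inv ≫ ε_ X' X ▷ Z ≫ (λ_ Z).hom) ▷ W

theorem insertEnd_id {Y Z W : C} (x : X ⊗ Y ⟶ Z ⊗ W) : insertEnd (𝟙 (X' ⊗ Z)) x = x := by
  calc insertEnd (𝟙 (X' ⊗ Z)) x = 𝟙 _ ⊗≫ X ◁ η_ X' X ▷ Y ⊗≫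
        ((X ⊗ X') ◁ x ≫ ε_ X' X ▷ (Z ⊗ W)) ⊗≫ 𝟙 _ := by
        rw [insertEnd]; monoidal
    _ = 𝟙 _ ⊗≫ (X ◁ η_ X' X ⊗≫ ε_ X' X ▷ X) ▷ Y ⊗≫ x := by
        rw [whisker_exchange]; monoidal
    _ = x := by
        rw [ExactPairing.coevaluation_evaluation'']; monoidal

theorem insertEnd_sum {Y Z W : C} {ι : Type*} (s : Finset ι) (g : ι → (X' ⊗ Z ⟶ X' ⊗ Z))
    (x : X ⊗ Y ⟶ Z ⊗ W) : insertEnd (∑ i ∈ s, g i) x = ∑ i ∈ s, insertEnd (g i) x := by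
  simp only [insertEnd, sum_whiskerRight, Preadditive.comp_sum, whiskerLeft_sum,
    Preadditive.sum_comp]

/-- `insertEnd` as a linear map in the second variable. -/
def insertEndₗ (Y W : C) {Z : C} (g : X' ⊗ Z ⟶ X' ⊗ Z) :
    (X ⊗ Y ⟶ Z ⊗ W) →ₗ[ℂ] (X ⊗ Y ⟶ Z ⊗ W) where
  toFun := insertEnd g
  map_add' x y := by simp [insertEnd]
  map_smul' c x := by simp [insertEnd]

/-- Splitting the inserted endomorphism through `K` and bending the strand of `K` places a cup of
`K` in the middle and leaves a product morphism `A ⊗ B` outside. Naturality and amplification thus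
reduce a multiplier on this morphism to its action on the cup. -/
theorem insertEnd_factor {Y Z W K K' : C} [ExactPairing K K'] (a : K ⟶ X' ⊗ Z) (a' : X' ⊗ Z ⟶ K)
    (x : X ⊗ Y ⟶ Z ⊗ W) : ∃ (A : X ⊗ K ⟶ Z) (B : K' ⊗ Y ⟶ W), insertEnd (a' ≫ a) x =
      ((ρ_ X).inv ⊗ₘ (λ_ Y).inv) ≫ ampHom X Y ((λ_ (𝟙_ C)).hom ≫ η_ K K') ≫ (A ⊗ₘ B) := by
  set n : Y ⟶ K ⊗ W :=
    (λ_ Y).inv ≫ η_ X' X ▷ Y ≫ (α_ X' X Y).hom ≫ X' ◁ x ≫ (α_ X' Z W).inv ≫ a' ▷ W with hn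
  set A : X ⊗ K ⟶ Z := X ◁ a ≫ (α_ X X' Z).inv ≫ ε_ X' X ▷ Z ≫ (λ_ Z).hom with hA
  set B : K' ⊗ Y ⟶ W := (tensorLeftHomEquiv Y K K' W).symm n with hB
  refine ⟨A, B, ?_⟩
  have h1 : n = (λ_ Y).inv ≫ η_ K K' ▷ Y ≫ (α_ K K' Y).hom ≫ K ◁ B :=
    ((tensorLeftHomEquiv Y K K' W).apply_symm_apply n).symm
  calc insertEnd (a' ≫ a) x = X ◁ n ≫ (α_ X K W).inv ≫ A ▷ W := by
        rw [insertEnd, hn, hA]; monoidal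
    _ = _ := by
        rw [h1, MonoidalCategory.tensorHom_def' A B, ampHom, MonoidalCategory.tensorHom_def]
        monoidal

theorem extension_insertEnd {φ : Irr C → ℂ} (Θ : θ.Extension)
    (hΘ : ∀ (X : C) (hX : IsIrreducible X) (v : 𝟙_ C ⊗ 𝟙_ C ⟶ X ⊗ Xᘁ),
      Θ.toFun X (Xᘁ) (𝟙_ C) (𝟙_ C) v = φ (Irr.mk X hX) • v)
    {Y Z W K : C} (hK : IsIrreducible K) (a : K ⟶ X' ⊗ Z) (a' : X' ⊗ Z ⟶ K)
    (x : X ⊗ Y ⟶ Z ⊗ W) :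
    Θ.toFun _ _ _ _ (insertEnd (a' ≫ a) x) = φ (Irr.mk K hK) • insertEnd (a' ≫ a) x := by
  obtain ⟨A, B, h⟩ := insertEnd_factor (K' := Kᘁ) a a' x
  rw [h, Θ.natural, extension_ampHom, hΘ K hK, ampHom_smul]
  simp

/-- Inserting the decomposition of the identity of `X' ⊗ Z` into irreducible projections splits `x`
into components on which the extension is multiplication by a value of the symbol. -/
theorem extension_eq_sum {φ : Irr C → ℂ} (Θ : θ.Extension)
    (hΘ : ∀ (X : C) (hX : IsIrreducible X) (v : 𝟙_ C ⊗ 𝟙_ C ⟶ X ⊗ Xᘁ),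
      Θ.toFun X (Xᘁ) (𝟙_ C) (𝟙_ C) v = φ (Irr.mk X hX) • v)
    {Y Z W : C} {n : ℕ} {K : Fin n → C} (hK : ∀ i, IsIrreducible (K i)) {a : ∀ i, K i ⟶ X' ⊗ Z}
    (h : IsOrthSum (X' ⊗ Z) K a) (x : X ⊗ Y ⟶ Z ⊗ W) :
    Θ.toFun _ _ _ _ x = ∑ i, φ (Irr.mk (K i) (hK i)) • insertEnd (dag (a i) ≫ a i) x := by
  conv_lhs => rw [← insertEnd_id (X' := X') x, ← h.2.2, insertEnd_sum, map_sum]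
  exact Finset.sum_congr rfl fun i _ => extension_insertEnd Θ hΘ (hK i) _ _ x

end Components

/-- The extension of a multiplier is determined linearly by finitely many values of its symbol. -/
theorem exists_extension_formula (X Y Z W : C) : ∃ (n : ℕ) (π : Fin n → Irr C)
    (T : Fin n → (Z ⊗ W ⟶ X ⊗ Y) →ₗ[ℂ] (Z ⊗ W ⟶ X ⊗ Y)),
    ∀ (θ : Multiplier C) (φ : Irr C → ℂ) (Θ : θ.Extension),
    (∀ (X : C) (hX : IsIrreducible X) (v : 𝟙_ C ⊗ 𝟙_ C ⟶ X ⊗ Xᘁ),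
      Θ.toFun X (Xᘁ) (𝟙_ C) (𝟙_ C) v = φ (Irr.mk X hX) • v) →
    ∀ x, Θ.toFun X Y Z W x = ∑ i, φ (π i) • T i x := by
  -- `insertEnd` needs the source factor `Z` as the second member of a pairing, which the adjoint of
  -- the given duality supplies.
  let _ : ExactPairing (Zᘁ) Z := dualPairing HasRightDual.exact
  obtain ⟨n, K, a, hK, h⟩ := exists_irreducible_orthSum (Zᘁ ⊗ X)
  exact ⟨n, fun i => Irr.mk (K i) (hK i), fun i => insertEndₗ W Y (dag (a i) ≫ a i),
    fun θ φ Θ hΘ x => extension_eq_sum Θ hΘ hK h x⟩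

end Amplification

end RigidCStarTensorCategory

/-! ### Complete positivity and pointwise limits of cp-multipliers -/

namespace RigidCStarTensorCategory

section Positivity

variable {C : Type u} [Category.{v} C] [Preadditive C] [Linear ℂ C]
  [MonoidalCategory C] [MonoidalPreadditive C] [MonoidalLinear ℂ C] [RightRigidCategory C]
  [CStarTensorCategory C] [RigidCStarTensorCategory C]

theorem exists_eq_star_mul_self {A : Type*} [CStarAlgebra A] [PartialOrder A] [StarOrderedRing A]
    {x : A} (hx : 0 ≤ x) : ∃ y, x = star y * y :=
  CStarAlgebra.nonneg_iff_eq_star_mul_self.1 hx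

theorem comp_dag_nonneg {X Y : C} (f : X ⟶ Y) : (0 : End X) ≤ f ≫ dag f := by
  obtain ⟨g, hg⟩ := exists_comp_dag_eq f
  rw [hg]
  exact star_mul_self_nonneg (R := End X) g

theorem exists_eq_comp_dag {X : C} {x : X ⟶ X} (hx : (0 : End X) ≤ x) :
    ∃ g : X ⟶ X, x = g ≫ dag g := by
  obtain ⟨N, hN⟩ := CStarAlgebra.nonneg_iff_eq_star_mul_self.1 hx
  exact ⟨N, hN⟩

theorem compression_nonneg {X Y : C} (h : Y ⟶ X) {x : X ⟶ X} (hx : (0 : End X) ≤ x) :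
    (0 : End Y) ≤ h ≫ x ≫ dag h := by
  obtain ⟨g, rfl⟩ := exists_eq_comp_dag hx
  have := comp_dag_nonneg (h ≫ g)
  rw [dag_comp, Category.assoc] at this
  rwa [Category.assoc]

theorem Multiplier.IsPositiveType.map_nonneg {θ : Multiplier C} (hθ : θ.IsPositiveType) {X Y : C}
    {x : X ⊗ Y ⟶ X ⊗ Y} (hx : (0 : End (X ⊗ Y)) ≤ x) : 0 ≤ θ.toFun X Y x := by
  obtain ⟨T, hT⟩ := hθ X Y
  rw [← hT]
  exact _root_.map_nonneg T hx

/-- A multiplier with positive maps is of positive type: a matrix over `End (X ⊗ Y)` is an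
endomorphism of the tensor product of `X` with a direct sum of copies of `Y`. -/
theorem Multiplier.isPositiveType_of_nonneg {θ : Multiplier C}
    (h : ∀ (X Y : C) (x : X ⊗ Y ⟶ X ⊗ Y), (0 : End (X ⊗ Y)) ≤ x → 0 ≤ θ.toFun X Y x) :
    θ.IsPositiveType := by
  intro X Y
  refine ⟨⟨θ.toFun X Y, fun k M hM => ?_⟩, rfl⟩
  cases k with
  | zero => exact (CStarMatrix.ext fun i => i.elim0 : (0 : CStarMatrix (Fin 0) (Fin 0) _) = _).le
  | succ k =>
    obtain ⟨N, hN⟩ := exists_eq_star_mul_self hM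
    obtain ⟨V, b, hb⟩ := exists_orthSum k fun _ => Y
    let β : Fin (k + 1) → (X ⊗ Y ⟶ X ⊗ V) := fun i => 𝟙 X ⊗ₘ b i
    have hdβ : ∀ i, dag (β i) = 𝟙 X ⊗ₘ dag (b i) := fun i => by rw [dag_tensor, dag_id]
    have hβ : ∀ i j, β i ≫ dag (β j) = if i = j then 𝟙 _ else 0 := by
      intro i j
      rw [hdβ, tensorHom_comp_tensorHom, Category.id_comp]
      split_ifs with hij
      · subst hij; rw [hb.1]; simp
      · rw [hb.2.1 i j hij]; simp
    have hβ1 : ∑ i, dag (β i) ≫ β i = 𝟙 _ := by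
      simp only [hdβ]
      simp only [β, id_tensorHom, ← MonoidalCategory.whiskerLeft_comp]
      rw [← whiskerLeft_sum, hb.2.2, MonoidalCategory.whiskerLeft_id]
    let M' : Fin (k + 1) → Fin (k + 1) → (X ⊗ Y ⟶ X ⊗ Y) := fun i j => M i j
    let N' : Fin (k + 1) → Fin (k + 1) → (X ⊗ Y ⟶ X ⊗ Y) := fun i j => N i j
    have hMN : ∀ i j, M' i j = ∑ l, N' l j ≫ dag (N' l i) := by
      intro i j
      change M i j = _
      rw [hN, CStarMatrix.mul_apply]
      rfl
    -- The matrix is read as a single endomorphism of `X ⊗ V`, with `M i j` going from copy `j` to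
    -- copy `i` of `X ⊗ Y`. The factorisation of `M` as `star N * N` shows that it is positive;
    -- composites in `hMN` appear reversed since multiplication in `End` is opposite to `≫`.
    have hm : (0 : End (X ⊗ V)) ≤ ∑ i, ∑ j, dag (β j) ≫ M' i j ≫ β i := by
      have h1 : ∑ i, ∑ j, dag (β j) ≫ M' i j ≫ β i =
          ∑ l, (∑ j, dag (β j) ≫ N' l j) ≫ dag (∑ j, dag (β j) ≫ N' l j) := by
        simp only [hMN, dag_sum, Preadditive.sum_comp, Preadditive.comp_sum, dag_comp, dag_dag,
          Category.assoc]
        rw [Finset.sum_comm]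
        refine (Finset.sum_congr rfl fun i _ => Finset.sum_comm).trans ?_
        rw [Finset.sum_comm]
        refine Finset.sum_congr rfl fun l _ => Finset.sum_comm
      rw [h1]
      exact Finset.sum_nonneg fun l _ => comp_dag_nonneg _
    obtain ⟨g, hg⟩ := exists_eq_comp_dag (h X V _ hm)
    have h2 : θ.toFun X V (∑ i, ∑ j, dag (β j) ≫ M' i j ≫ β i) =
        ∑ i, ∑ j, dag (β j) ≫ θ.toFun X Y (M' i j) ≫ β i := by
      refine (map_sum (θ.toFun X V) _ _).trans (Finset.sum_congr rfl fun i _ => ?_)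
      refine (map_sum (θ.toFun X V) _ _).trans (Finset.sum_congr rfl fun j _ => ?_)
      rw [hdβ]
      exact θ.natural (M' i j) (𝟙 X) (b i) (𝟙 X) (dag (b j))
    have h3 : ∀ i j, θ.toFun X Y (M' i j) = ∑ l, (β j ≫ g ≫ dag (β l)) ≫
        dag (β i ≫ g ≫ dag (β l)) := by
      intro i j
      have h4 : β j ≫ θ.toFun X V (∑ i, ∑ j, dag (β j) ≫ M' i j ≫ β i) ≫ dag (β i) =
          θ.toFun X Y (M' i j) := by
        rw [h2]
        simp only [Preadditive.sum_comp, Preadditive.comp_sum, Category.assoc, hβ]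
        rw [Finset.sum_eq_single i]
        · rw [Finset.sum_eq_single j]
          · rw [reassoc_of% hβ j j]
            simp
          · intro j' _ hj'
            rw [reassoc_of% hβ j j', if_neg hj'.symm]
            simp
          · simp
        · intro i' _ hi'
          simp [hi']
        · simp
      rw [← h4, hg]
      simp only [dag_comp, dag_dag, Category.assoc]
      have h5 : g ≫ dag g = g ≫ (∑ l, dag (β l) ≫ β l) ≫ dag g := by rw [hβ1, Category.id_comp]
      rw [reassoc_of% h5]
      simp only [Preadditive.sum_comp, Preadditive.comp_sum, Category.assoc]
    -- `P` consists of the blocks of `g`, so `star P * P` reproduces the blocks of the positive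
    -- image `g ≫ dag g`.
    let P : CStarMatrix (Fin (k + 1)) (Fin (k + 1)) (End (X ⊗ Y)) :=
      CStarMatrix.ofMatrix fun l j => β j ≫ g ≫ dag (β l)
    have h6 : M.map (θ.toFun X Y) = star P * P := by
      ext i j
      rw [CStarMatrix.mul_apply]
      exact h3 i j
    rw [h6]
    exact star_mul_self_nonneg P

/-- Carries every linear identity between values of the symbols to the limit, by uniqueness of
limits in the normed space of morphisms. -/
theorem sum_smul_eq_of_tendsto {ι : Type*} {l : Filter ι} [l.NeBot] {φ : ι → Irr C → ℂ}
    {ψ : Irr C → ℂ} (h : ∀ π, Filter.Tendsto (fun i => φ i π) l (nhds (ψ π))) {X Y : C} {n m : ℕ}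
    (π : Fin n → Irr C) (ρ : Fin m → Irr C) (a : Fin n → (X ⟶ Y)) (b : Fin m → (X ⟶ Y))
    (hab : ∀ i, ∑ k, φ i (π k) • a k = ∑ k, φ i (ρ k) • b k) :
    ∑ k, ψ (π k) • a k = ∑ k, ψ (ρ k) • b k := by
  let _ := NormedAddCommGroup.ofCore (homCore (C := C) X Y)
  let _ : NormedSpace ℂ (X ⟶ Y) := NormedSpace.ofCore (homCore (C := C) X Y)
  have h1 : Filter.Tendsto (fun i => ∑ k, φ i (π k) • a k) l (nhds (∑ k, ψ (π k) • a k)) :=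
    tendsto_finsetSum _ fun k _ => (h (π k)).smul_const (a k)
  have h2 : Filter.Tendsto (fun i => ∑ k, φ i (ρ k) • b k) l (nhds (∑ k, ψ (ρ k) • b k)) :=
    tendsto_finsetSum _ fun k _ => (h (ρ k)).smul_const (b k)
  exact tendsto_nhds_unique h1 (h2.congr fun i => (hab i).symm)

/-- A pointwise limit of cp-multipliers is a cp-multiplier. -/
theorem IsCPMultiplier.of_tendsto {ι : Type*} {l : Filter ι} [l.NeBot] {φ : ι → Irr C → ℂ}
    {ψ : Irr C → ℂ} (h : ∀ π, Filter.Tendsto (fun i => φ i π) l (nhds (ψ π)))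
    (hφ : ∀ i, IsCPMultiplier (φ i)) : IsCPMultiplier ψ := by
  choose θ hθ Θ hΘ using hφ
  choose n π T hT using fun X Y Z W : C => exists_extension_formula X Y Z W
  have hΘ' : ∀ i X Y Z W x, (Θ i).toFun X Y Z W x = ∑ k, φ i (π X Y Z W k) • T X Y Z W k x :=
    fun i X Y Z W x => hT X Y Z W (θ i) (φ i) (Θ i) (hΘ i) x
  -- The operators `T` do not depend on the multiplier, so the limit is defined by putting `ψ` into
  -- the same finite formula.
  let L : ∀ X Y Z W : C, (Z ⊗ W ⟶ X ⊗ Y) →ₗ[ℂ] (Z ⊗ W ⟶ X ⊗ Y) :=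
    fun X Y Z W => ∑ k, ψ (π X Y Z W k) • T X Y Z W k
  have hL : ∀ X Y Z W x, L X Y Z W x = ∑ k, ψ (π X Y Z W k) • T X Y Z W k x := by
    intro X Y Z W x
    simp [L, LinearMap.sum_apply]
  have hnat : ∀ {X₁ Y₁ Z₁ W₁ X₂ Y₂ Z₂ W₂ : C} (x : Z₁ ⊗ W₁ ⟶ X₁ ⊗ Y₁) (a : X₁ ⟶ X₂)
      (b : Y₁ ⟶ Y₂) (a' : Z₂ ⟶ Z₁) (b' : W₂ ⟶ W₁),
      L X₂ Y₂ Z₂ W₂ ((a' ⊗ₘ b') ≫ x ≫ (a ⊗ₘ b)) =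
      (a' ⊗ₘ b') ≫ L X₁ Y₁ Z₁ W₁ x ≫ (a ⊗ₘ b) := by
    intro X₁ Y₁ Z₁ W₁ X₂ Y₂ Z₂ W₂ x a b a' b'
    have h1 := fun i => (Θ i).natural x a b a' b'
    simp only [hΘ', Preadditive.sum_comp, Preadditive.comp_sum, Linear.smul_comp,
      Linear.comp_smul] at h1
    simp only [hL, Preadditive.sum_comp, Preadditive.comp_sum, Linear.smul_comp, Linear.comp_smul]
    exact sum_smul_eq_of_tendsto h _ _ _ _ h1
  let ϑ : Multiplier C :=
    { toFun := fun X Y => L X Y X Y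
      natural := fun x a b a' b' => hnat x a b a' b'
      amplify := fun X₂ X₁ Y₁ Y₂ x => by
        have h1 := fun i => extension_ampHom (Θ i) X₂ Y₂ x
        simp only [hΘ', ampHom_sum, ampHom_smul] at h1
        rw [amplification_eq_ampHom, amplification_eq_ampHom]
        refine (hL _ _ _ _ _).trans (Eq.trans ?_ (congrArg _ (hL _ _ _ _ _).symm))
        simp only [ampHom_sum, ampHom_smul]
        exact sum_smul_eq_of_tendsto h _ _ _ _ h1 }
  refine ⟨ϑ, Multiplier.isPositiveType_of_nonneg fun X Y x hx => ?_,
    { toFun := L, natural := hnat, restrict := fun X Y x => rfl }, fun X hX v => ?_⟩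
  -- Positivity survives because the positive cone of `End (X ⊗ Y)` is closed.
  · have h1 : Filter.Tendsto (fun i => (θ i).toFun X Y x) l (nhds (ϑ.toFun X Y x)) := by
      have h2 : ∀ i, (θ i).toFun X Y x =
          ∑ k, φ i (π X Y X Y k) • (show End (X ⊗ Y) from T X Y X Y k x) :=
        fun i => ((Θ i).restrict X Y x).symm.trans (hΘ' i X Y X Y x)
      have h3 : ϑ.toFun X Y x =
          ∑ k, ψ (π X Y X Y k) • (show End (X ⊗ Y) from T X Y X Y k x) := hL X Y X Y x
      simp only [h2, h3]
      exact tendsto_finsetSum _ fun k _ => (h _).smul_const _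
    exact ge_of_tendsto' h1 fun i => (hθ i).map_nonneg hx
  · have h1 := fun i => hΘ i X hX v
    simp only [hΘ'] at h1
    rw [hL]
    have h2 := sum_smul_eq_of_tendsto h _ (fun _ : Fin 1 => Irr.mk X hX) _ (fun _ => v)
      (fun i => (h1 i).trans (by simp))
    simpa using h2

end Positivity

end RigidCStarTensorCategory

/-! ### Compression of a multiplier by inserted cups -/

namespace RigidCStarTensorCategory

section Conjugation

variable {C : Type u} [Category.{v} C] [Preadditive C] [Linear ℂ C]
  [MonoidalCategory C] [MonoidalPreadditive C] [MonoidalLinear ℂ C] [RightRigidCategory C]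
  [CStarTensorCategory C] [RigidCStarTensorCategory C]

/-- The morphism `1 ⊗ s ⊗ 1` from `X ⊗ Y` to `(X ⊗ V) ⊗ (V' ⊗ Y)`. -/
def insertPair (X Y : C) {V V' : C} (s : 𝟙_ C ⟶ V ⊗ V') : X ⊗ Y ⟶ (X ⊗ V) ⊗ (V' ⊗ Y) :=
  ((ρ_ X).inv ⊗ₘ (λ_ Y).inv) ≫ ampHom X Y ((λ_ (𝟙_ C)).hom ≫ s)

theorem insertPair_naturality {X X' Y Y' V V' : C} (a : X ⟶ X') (b : Y ⟶ Y')
    (s : 𝟙_ C ⟶ V ⊗ V') :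
    (a ⊗ₘ b) ≫ insertPair X' Y' s = insertPair X Y s ≫ (a ▷ V ⊗ₘ V' ◁ b) := by
  rw [insertPair, insertPair, Category.assoc, ← ampHom_naturality,
    tensorHom_comp_tensorHom_assoc, tensorHom_comp_tensorHom_assoc]
  simp

theorem dag_insertPair_naturality {X X' Y Y' V V' : C} (a : X ⟶ X') (b : Y ⟶ Y')
    (s : 𝟙_ C ⟶ V ⊗ V') :
    dag (insertPair X Y s) ≫ (a ⊗ₘ b) = (a ▷ V ⊗ₘ V' ◁ b) ≫ dag (insertPair X' Y' s) := by
  have h := congrArg dag (insertPair_naturality (dag a) (dag b) s)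
  simpa only [dag_comp, dag_tensor, dag_dag, dag_whiskerLeft, dag_whiskerRight] using h

theorem insertPair_comp_tensorHom (X Y : C) {V V' W W' : C} (s : 𝟙_ C ⟶ V ⊗ V') (c : V ⟶ W)
    (d : V' ⟶ W') :
    insertPair X Y (s ≫ (c ⊗ₘ d)) = insertPair X Y s ≫ (X ◁ c ⊗ₘ d ▷ Y) := by
  rw [insertPair, insertPair, ← Category.assoc (λ_ (𝟙_ C)).hom, ampHom_comp, ampHom_tensorHom,
    Category.assoc]

theorem insertPair_smul (X Y : C) {V V' : C} (c : ℂ) (s : 𝟙_ C ⟶ V ⊗ V') :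
    insertPair X Y (c • s) = c • insertPair X Y s := by
  simp only [insertPair, Linear.comp_smul, ampHom_smul]

theorem insertPair_sum (X Y : C) {V V' : C} {ι : Type*} (t : Finset ι)
    (s : ι → (𝟙_ C ⟶ V ⊗ V')) :
    insertPair X Y (∑ i ∈ t, s i) = ∑ i ∈ t, insertPair X Y (s i) := by
  simp only [insertPair, Preadditive.comp_sum, ampHom_sum]

theorem insertPair_tensor (X₂ X₁ Y₁ Y₂ : C) {V V' : C} (s : 𝟙_ C ⟶ V ⊗ V') :
    insertPair (X₂ ⊗ X₁) (Y₁ ⊗ Y₂) s = ampHom X₂ Y₂ (insertPair X₁ Y₁ s) ≫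
      ((α_ X₂ X₁ V).inv ⊗ₘ (α_ V' Y₁ Y₂).hom) := by
  rw [insertPair, insertPair, ampHom_comp, ampHom_tensorHom, ampHom_ampHom, Category.assoc,
    tensorHom_comp_tensorHom_assoc]
  congr 2
  · monoidal
  · monoidal

theorem insertPair_unit {V V' : C} (s : 𝟙_ C ⟶ V ⊗ V') :
    insertPair (𝟙_ C) (𝟙_ C) s = (λ_ (𝟙_ C)).hom ≫ s ≫ ((λ_ V).inv ⊗ₘ (ρ_ V').inv) := by
  simp only [insertPair, ampHom, MonoidalCategory.tensorHom_def]
  monoidal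

/-- Nested cups are the cup of a tensor product; this is how fusion products enter the symbol of a
compression. -/
theorem coevaluation_insertPair {X X' W W' : C} [ExactPairing X X'] [ExactPairing W W'] :
    η_ X X' ≫ insertPair X X' (η_ W W') = η_ (X ⊗ W) (W' ⊗ X') := by
  simp only [tensor_coevaluation_eq, insertPair, ampHom, MonoidalCategory.tensorHom_def]
  monoidal

variable {θ : Multiplier C}

/-- The compression of a multiplier by morphisms `u, v : 𝟙 ⟶ V ⊗ V'`. -/
def compressMap (Θ : θ.Extension) {V V' : C} (u v : 𝟙_ C ⟶ V ⊗ V') (X Y Z W : C) :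
    (Z ⊗ W ⟶ X ⊗ Y) →ₗ[ℂ] (Z ⊗ W ⟶ X ⊗ Y) where
  toFun x := insertPair Z W u ≫ Θ.toFun _ _ _ _
    (dag (insertPair Z W v) ≫ x ≫ insertPair X Y v) ≫ dag (insertPair X Y u)
  map_add' x y := by simp
  map_smul' c x := by simp

theorem compressMap_apply (Θ : θ.Extension) {V V' : C} (u v : 𝟙_ C ⟶ V ⊗ V') (X Y Z W : C)
    (x : Z ⊗ W ⟶ X ⊗ Y) : compressMap Θ u v X Y Z W x = insertPair Z W u ≫ Θ.toFun _ _ _ _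
    (dag (insertPair Z W v) ≫ x ≫ insertPair X Y v) ≫ dag (insertPair X Y u) := rfl

theorem compressMap_naturality (Θ : θ.Extension) {V V' : C} (u v : 𝟙_ C ⟶ V ⊗ V')
    {X₁ Y₁ Z₁ W₁ X₂ Y₂ Z₂ W₂ : C} (x : Z₁ ⊗ W₁ ⟶ X₁ ⊗ Y₁) (a : X₁ ⟶ X₂)
    (b : Y₁ ⟶ Y₂) (a' : Z₂ ⟶ Z₁) (b' : W₂ ⟶ W₁) :
    compressMap Θ u v X₂ Y₂ Z₂ W₂ ((a' ⊗ₘ b') ≫ x ≫ (a ⊗ₘ b)) =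
      (a' ⊗ₘ b') ≫ compressMap Θ u v X₁ Y₁ Z₁ W₁ x ≫ (a ⊗ₘ b) := by
  simp only [compressMap_apply, Category.assoc]
  rw [reassoc_of% dag_insertPair_naturality a' b' v, insertPair_naturality a b v,
    dag_insertPair_naturality a b u, reassoc_of% insertPair_naturality a' b' u]
  have h := Θ.natural (dag (insertPair Z₁ W₁ v) ≫ x ≫ insertPair X₁ Y₁ v) (a ▷ V) (V' ◁ b)
    (a' ▷ V) (V' ◁ b')
  simp only [Category.assoc] at h
  rw [h]
  simp only [Category.assoc]

/-- The compression of a multiplier, as a multiplier. -/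
def compressMultiplier (Θ : θ.Extension) {V V' : C} (u v : 𝟙_ C ⟶ V ⊗ V') : Multiplier C where
  toFun X Y := compressMap Θ u v X Y X Y
  natural x a b a' b' := compressMap_naturality Θ u v x a b a' b'
  amplify X₂ X₁ Y₁ Y₂ x := by
    rw [amplification_eq_ampHom, amplification_eq_ampHom]
    change compressMap Θ u v _ _ _ _ _ = ampHom X₂ Y₂ (compressMap Θ u v _ _ _ _ _)
    rw [compressMap_apply, compressMap_apply]
    simp only [insertPair_tensor, dag_comp, dag_tensor, dag_associator, dag_associator_inv,
      dag_ampHom, Category.assoc, ampHom_comp]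
    have h := Θ.natural (ampHom X₂ Y₂ (dag (insertPair X₁ Y₁ v) ≫ x ≫ insertPair X₁ Y₁ v))
      (α_ X₂ X₁ V).inv (α_ V' Y₁ Y₂).hom (α_ X₂ X₁ V).hom (α_ V' Y₁ Y₂).inv
    rw [extension_ampHom] at h
    simp only [ampHom_comp, Category.assoc] at h
    rw [h]
    have e : ((α_ X₂ X₁ V).inv ⊗ₘ (α_ V' Y₁ Y₂).hom) ≫ ((α_ X₂ X₁ V).hom ⊗ₘ (α_ V' Y₁ Y₂).inv) =
        𝟙 _ := by
      rw [tensorHom_comp_tensorHom]; simp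
    simp only [Category.assoc, reassoc_of% e]

/-- The extension of the compression of a multiplier. -/
def compressExtension (Θ : θ.Extension) {V V' : C} (u v : 𝟙_ C ⟶ V ⊗ V') :
    (compressMultiplier Θ u v).Extension where
  toFun := compressMap Θ u v
  natural x a b a' b' := compressMap_naturality Θ u v x a b a' b'
  restrict _ _ _ := rfl

/-- A compression is a conjugation, followed by `θ`, followed by another conjugation, and each of
the three preserves positivity. -/
theorem compressMultiplier_isPositiveType (hθ : θ.IsPositiveType) (Θ : θ.Extension) {V V' : C}
    (u v : 𝟙_ C ⟶ V ⊗ V') : (compressMultiplier Θ u v).IsPositiveType := by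
  refine Multiplier.isPositiveType_of_nonneg fun X Y x hx => ?_
  change (0 : End (X ⊗ Y)) ≤ compressMap Θ u v X Y X Y x
  rw [compressMap_apply]
  refine compression_nonneg _ ?_
  rw [Θ.restrict]
  refine hθ.map_nonneg ?_
  have := compression_nonneg (dag (insertPair X Y v)) hx
  rwa [dag_dag] at this

/-- The compression by direct sums of morphisms `s i : 𝟙 ⟶ V i ⊗ V' i`. -/
theorem compressMap_orthSum (Θ : θ.Extension) {n : ℕ} {U U' : C} {V V' : Fin n → C}
    {a : ∀ i, V i ⟶ U} {a' : ∀ i, V' i ⟶ U'} (h : IsOrthSum U V a) (h' : IsOrthSum U' V' a')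
    (s : ∀ i, 𝟙_ C ⟶ V i ⊗ V' i) (c : Fin n → ℂ) {X Y Z W : C} (x : Z ⊗ W ⟶ X ⊗ Y) :
    compressMap Θ (∑ i, s i ≫ (a i ⊗ₘ a' i)) (∑ i, c i • s i ≫ (a i ⊗ₘ a' i)) X Y Z W x =
      ∑ i, ∑ j, (star (c i) * c j) • insertPair Z W (s i) ≫ Θ.toFun _ _ _ _
        (dag (insertPair Z W (s i)) ≫ x ≫ insertPair X Y (s j)) ≫ dag (insertPair X Y (s j)) := by
  have e : ∀ (X Y : C) i, insertPair X Y (∑ i, s i ≫ (a i ⊗ₘ a' i)) ≫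
      (X ◁ dag (a i) ⊗ₘ dag (a' i) ▷ Y) = insertPair X Y (s i) := by
    intro X Y i
    rw [insertPair_sum, Preadditive.sum_comp, Finset.sum_eq_single i]
    · rw [insertPair_comp_tensorHom, Category.assoc, tensorHom_comp_tensorHom,
        ← MonoidalCategory.whiskerLeft_comp, ← comp_whiskerRight, h.1, h'.1]
      simp
    · intro j _ hij
      rw [insertPair_comp_tensorHom, Category.assoc, tensorHom_comp_tensorHom,
        ← MonoidalCategory.whiskerLeft_comp, h.2.1 j i hij]
      simp
    · simp
  have e' : ∀ (X Y : C) i, (X ◁ a i ⊗ₘ a' i ▷ Y) ≫ dag (insertPair X Y (∑ i, s i ≫ (a i ⊗ₘ a' i)))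
      = dag (insertPair X Y (s i)) := by
    intro X Y i
    have := congrArg dag (e X Y i)
    simpa only [dag_comp, dag_tensor, dag_whiskerLeft, dag_whiskerRight, dag_dag] using this
  rw [compressMap_apply]
  simp only [insertPair_sum _ _ _ fun i => c i • s i ≫ (a i ⊗ₘ a' i), insertPair_smul,
    insertPair_comp_tensorHom, dag_sum, dag_smul, dag_comp, dag_tensor, dag_whiskerLeft,
    dag_whiskerRight, Preadditive.sum_comp, Preadditive.comp_sum, Linear.smul_comp,
    Linear.comp_smul, Finset.smul_sum, smul_smul, map_sum, map_smul]
  rw [Finset.sum_comm]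
  refine Finset.sum_congr rfl fun i _ => Finset.sum_congr rfl fun j _ => ?_
  -- The embeddings of the summands leave `Θ` by naturality and meet the outer insertion, where
  -- orthogonality retains the matching cups `s i` and `s j`. The weights sit only in the inner
  -- insertion and therefore occur once on each side.
  have h1 := Θ.natural (dag (insertPair Z W (s i)) ≫ x ≫ insertPair X Y (s j)) (X ◁ a j) (a' j ▷ Y)
    (Z ◁ dag (a i)) (dag (a' i) ▷ W)
  simp only [Category.assoc] at h1 ⊢
  rw [h1]
  simp only [Category.assoc, e', reassoc_of% e]
  rw [mul_comm]

end Conjugation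

end RigidCStarTensorCategory

/-! ### The symbol of a compression -/

namespace RigidCStarTensorCategory

section ConjugationSymbol

variable {C : Type u} [Category.{v} C] [Preadditive C] [Linear ℂ C]
  [MonoidalCategory C] [MonoidalPreadditive C] [MonoidalLinear ℂ C] [RightRigidCategory C]
  [CStarTensorCategory C] [RigidCStarTensorCategory C]

/-- Frobenius reciprocity identifies these morphisms with endomorphisms of `X`. -/
theorem exists_smul_coevaluation {X X' : C} (hX : IsIrreducible X) (r : ExactPairing X X')
    (h : 𝟙_ C ⟶ X ⊗ X') : ∃ c : ℂ, h = c • η_ X X' := by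
  obtain ⟨c, hc⟩ := hX.2 ((λ_ X).inv ≫ (tensorRightHomEquiv (𝟙_ C) X X' X).symm h)
  refine ⟨c, (tensorRightHomEquiv (𝟙_ C) X X' X).symm.injective ?_⟩
  have h1 : c • η_ X X' = η_ X X' ≫ (c • 𝟙 X) ▷ X' := by simp
  rw [h1, tensorRightHomEquiv_symm_coevaluation_comp_whiskerRight, ← hc]
  simp

/-- A zigzag straightens the strand of `V`, whose closed-up form is the loop of a left partial
trace. -/
theorem insertEnd_closed {V V' B B' : C} (p : ExactPairing V V')
    (e : V' ⊗ B ⟶ V' ⊗ B) (R : 𝟙_ C ⟶ B ⊗ B') :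
    letI := dualPairing p
    η_ V V' ≫ insertEnd (X' := V') e (dag (η_ V V') ≫ R) =
      R ≫ leftPartialTrace (dag (η_ V V')) e ▷ B' := by
  let _ := dualPairing p
  have z : η_ V' V ▷ V' ⊗≫ V' ◁ dag (η_ V V') = ⊗𝟙.hom :=
    ExactPairing.evaluation_coevaluation'' V' V
  have hε : ε_ V' V = dag (η_ V V') := rfl
  calc η_ V V' ≫ insertEnd (X' := V') e (dag (η_ V V') ≫ R)
      = η_ V V' ⊗≫ V ◁ (η_ V' V ▷ V' ⊗≫ V' ◁ dag (η_ V V')) ⊗≫ (V ⊗ V') ◁ R ⊗≫ V ◁ e ▷ B' ⊗≫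
          dag (η_ V V') ▷ (B ⊗ B') ⊗≫ 𝟙 _ := by
        rw [insertEnd, hε]; monoidal
    _ = 𝟙 _ ⊗≫ (η_ V V' ▷ 𝟙_ C ≫ (V ⊗ V') ◁ R) ⊗≫ V ◁ e ▷ B' ⊗≫
          dag (η_ V V') ▷ (B ⊗ B') ⊗≫ 𝟙 _ := by
        rw [z]; monoidal
    _ = _ := by
        rw [← whisker_exchange, leftPartialTrace, dag_dag]; monoidal

variable {θ : Multiplier C} {φ : Irr C → ℂ}

/-- The linear functional on the fusion algebra defined by a function on `Irr C`. -/
noncomputable def symbolFunctional (φ : Irr C → ℂ) : FusionAlgebra C →ₗ[ℂ] ℂ :=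
  FusionAlgebra.extend fun π => dim π.rep * φ π

theorem symbolFunctional_basis (φ : Irr C → ℂ) (π : Irr C) :
    symbolFunctional φ (FusionAlgebra.basis π) = dim π.rep * φ π :=
  FusionAlgebra.extend_basis _ _

/-- Each irreducible summand `K` of `V' ⊗ B` contributes `φ(K)` from the extension and `d(K)` from
the trace of its projection. Their products add up to the functional at `V' ⊗ B`. -/
theorem extension_closed (Θ : θ.Extension)
    (hΘ : ∀ (X : C) (hX : IsIrreducible X) (v : 𝟙_ C ⊗ 𝟙_ C ⟶ X ⊗ Xᘁ),
      Θ.toFun X (Xᘁ) (𝟙_ C) (𝟙_ C) v = φ (Irr.mk X hX) • v)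
    {V V' B B' : C} {p : ExactPairing V V'} (hp : IsStandard p) {q : ExactPairing B B'}
    (hq : IsStandard q) :
    η_ V V' ≫ Θ.toFun _ _ _ _ (dag (η_ V V') ≫ η_ B B') ≫ dag (η_ B B') =
      symbolFunctional φ (FusionAlgebra.of (V' ⊗ B)) • 𝟙 (𝟙_ C) := by
  let p' := dualPairing p
  obtain ⟨n, K, a, hK, h⟩ := exists_irreducible_orthSum (V' ⊗ B)
  rw [extension_eq_sum (X' := V') Θ hΘ hK h, symbolFunctional, FusionAlgebra.extend_of _ h hK]
  simp only [Preadditive.sum_comp, Preadditive.comp_sum, Linear.smul_comp, Linear.comp_smul,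
    Finset.sum_smul]
  refine Finset.sum_congr rfl fun i _ => ?_
  have h1 := (hp.dualPairing.tensor hq).trace_summand h i
  have h2 := IsStandard.tensor_trace_mixed (p := p') (q := q) hp.dualPairing (dag (a i) ≫ a i)
  rw [h1] at h2
  rw [← Category.assoc, insertEnd_closed p, Category.assoc]
  have h3 : η_ B B' ≫ leftPartialTrace (dag (η_ V V')) (dag (a i) ≫ a i) ▷ B' ≫ dag (η_ B B') =
      (dim (K i) : ℂ) • 𝟙 (𝟙_ C) := h2.symm
  rw [h3, smul_smul, dim_rep_mk, mul_comm]

/-- The result is a multiple of the cup of the irreducible `X`. Pairing with that cup, whose square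
is `d(X)`, reduces the scalar to `extension_closed` with `B = X ⊗ W`. -/
theorem compress_cross (Θ : θ.Extension)
    (hΘ : ∀ (X : C) (hX : IsIrreducible X) (v : 𝟙_ C ⊗ 𝟙_ C ⟶ X ⊗ Xᘁ),
      Θ.toFun X (Xᘁ) (𝟙_ C) (𝟙_ C) v = φ (Irr.mk X hX) • v)
    {V V' W W' X X' : C} {p : ExactPairing V V'} (hp : IsStandard p) {q : ExactPairing W W'}
    (hq : IsStandard q) {r : ExactPairing X X'} (hr : IsStandard r) (hX : IsIrreducible X) :
    insertPair (𝟙_ C) (𝟙_ C) (η_ V V') ≫ Θ.toFun _ _ _ _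
      (dag (insertPair (𝟙_ C) (𝟙_ C) (η_ V V')) ≫ ((λ_ (𝟙_ C)).hom ≫ η_ X X') ≫
        insertPair X X' (η_ W W')) ≫ dag (insertPair X X' (η_ W W')) =
      ((dim X : ℂ)⁻¹ * symbolFunctional φ (FusionAlgebra.of (V' ⊗ (X ⊗ W)))) •
        ((λ_ (𝟙_ C)).hom ≫ η_ X X') := by
  have h0 := extension_closed Θ hΘ hp (hr.tensor hq)
  obtain ⟨c, hc⟩ := exists_smul_coevaluation hX r (η_ V V' ≫
    Θ.toFun _ _ _ _ (dag (η_ V V') ≫ η_ (X ⊗ W) (W' ⊗ X')) ≫ dag (insertPair X X' (η_ W W')))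
  have h1 : c * dim X = symbolFunctional φ (FusionAlgebra.of (V' ⊗ (X ⊗ W))) := by
    refine smul_id_injective (irreducible_unit (C := C)) ?_
    rw [← h0, ← smul_smul, ← hr.coevaluation_comp_dag, ← Linear.smul_comp, ← hc, Category.assoc,
      Category.assoc, ← dag_comp, coevaluation_insertPair]
  have hd : (dim X : ℂ) ≠ 0 := by exact_mod_cast dim_ne_zero hX
  have h2 : (dim X : ℂ)⁻¹ * symbolFunctional φ (FusionAlgebra.of (V' ⊗ (X ⊗ W))) = c := by
    rw [← h1]; field_simp
  have h3 := Θ.natural (dag (η_ V V') ≫ η_ (X ⊗ W) (W' ⊗ X')) (𝟙 _) (𝟙 _) (λ_ V).hom (ρ_ V').hom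
  simp only [id_tensorHom_id, Category.comp_id] at h3
  have h4 : dag (insertPair (𝟙_ C) (𝟙_ C) (η_ V V')) ≫ ((λ_ (𝟙_ C)).hom ≫ η_ X X') ≫
      insertPair X X' (η_ W W') =
      ((λ_ V).hom ⊗ₘ (ρ_ V').hom) ≫ dag (η_ V V') ≫ η_ (X ⊗ W) (W' ⊗ X') := by
    rw [insertPair_unit, Category.assoc, coevaluation_insertPair]
    simp [dag_comp, dag_tensor, dag_leftUnitor, dag_leftUnitor_inv, dag_rightUnitor_inv]
  have h5 : ((λ_ V).inv ⊗ₘ (ρ_ V').inv) ≫ ((λ_ V).hom ⊗ₘ (ρ_ V').hom) = 𝟙 _ := by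
    rw [tensorHom_comp_tensorHom]; simp
  rw [h4, h3, insertPair_unit, h2]
  simp only [Category.assoc, reassoc_of% h5]
  rw [hc, Linear.comp_smul]

/-- At least one summand is kept, if need be with coefficient zero, to meet the requirement of
`exists_orthSum`. -/
theorem exists_sum_of (x : FusionAlgebra C) : ∃ (n : ℕ) (V : Fin (n + 1) → C) (c : Fin (n + 1) → ℂ),
    x = ∑ i, c i • FusionAlgebra.of (V i) := by
  induction x using FusionAlgebra.induction_on with
  | h0 => exact ⟨0, fun _ => 𝟙_ C, 0, by simp⟩
  | hb c π => exact ⟨0, fun _ => π.rep, fun _ => c, by simp [FusionAlgebra.of_rep]⟩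
  | hadd x y hx hy =>
    obtain ⟨n, V, c, rfl⟩ := hx
    obtain ⟨m, W, d, rfl⟩ := hy
    refine ⟨n + 1 + m, (Fin.append V W : Fin (n + 1 + (m + 1)) → C),
      (Fin.append c d : Fin (n + 1 + (m + 1)) → ℂ), ?_⟩
    refine Eq.trans ?_ (Fin.sum_univ_add (a := n + 1) (b := m + 1) _).symm
    simp

/-- For a cp-multiplier `φ` with functional `ω` on the fusion algebra and an element `x` of the
fusion algebra, the functional `y ↦ ω (x* y x)` comes from a cp-multiplier. -/
theorem IsCPMultiplier.conj (hφ : IsCPMultiplier φ) (x : FusionAlgebra C) :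
    IsCPMultiplier fun π => (dim π.rep : ℂ)⁻¹ *
      symbolFunctional φ (star x * (FusionAlgebra.basis π * x)) := by
  obtain ⟨θ, hθ, Θ, hΘ⟩ := hφ
  obtain ⟨n, V, c, rfl⟩ := exists_sum_of x
  choose V' p hp using fun i => exists_standard (V i)
  obtain ⟨U, a, ha⟩ := exists_orthSum n V
  obtain ⟨U', a', ha'⟩ := exists_orthSum n V'
  -- The outer morphism collects the cups of all `V i` in one sum; the inner one carries the weights
  -- `c i`. The compression then produces the double sum of `star (c i) * c j` times the values at
  -- `V' i ⊗ (X ⊗ V j)`, which is the functional at `x* X x`.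
  refine ⟨_, compressMultiplier_isPositiveType hθ Θ (∑ i, η_ (V i) (V' i) ≫ (a i ⊗ₘ a' i))
    (∑ i, c i • η_ (V i) (V' i) ≫ (a i ⊗ₘ a' i)), compressExtension Θ _ _, fun X hX v => ?_⟩
  change compressMap Θ _ _ X (Xᘁ) (𝟙_ C) (𝟙_ C) v = _
  obtain ⟨X', r, hr⟩ := exists_standard X
  have key : compressMap Θ (∑ i, η_ (V i) (V' i) ≫ (a i ⊗ₘ a' i))
      (∑ i, c i • η_ (V i) (V' i) ≫ (a i ⊗ₘ a' i)) X X' (𝟙_ C) (𝟙_ C)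
      ((λ_ (𝟙_ C)).hom ≫ η_ X X') = ((dim (Irr.mk X hX).rep : ℂ)⁻¹ *
      symbolFunctional φ (star (∑ i, c i • FusionAlgebra.of (V i)) *
        (FusionAlgebra.basis (Irr.mk X hX) * ∑ i, c i • FusionAlgebra.of (V i)))) •
      ((λ_ (𝟙_ C)).hom ≫ η_ X X') := by
    rw [compressMap_orthSum Θ ha ha']
    simp only [compress_cross Θ hΘ (hp _) (hp _) hr hX, smul_smul, ← Finset.sum_smul]
    congr 1
    rw [star_sum, Finset.sum_mul, map_sum, Finset.mul_sum]
    refine Finset.sum_congr rfl fun i _ => ?_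
    rw [Finset.mul_sum, Finset.mul_sum, map_sum, Finset.mul_sum]
    refine Finset.sum_congr rfl fun j _ => ?_
    have h1 : star (FusionAlgebra.of (V i)) = FusionAlgebra.of (V' i) := by
      rw [FusionAlgebra.star_of]
      exact FusionAlgebra.of_congr (rightDualIso HasRightDual.exact (p i))
    rw [star_smul, mul_smul_comm, smul_mul_smul_comm, map_smul, h1, dim_rep_mk,
      ← FusionAlgebra.of_irreducible, FusionAlgebra.of_mul_of, FusionAlgebra.of_mul_of, smul_eq_mul]
    ring
  -- The symbol is defined with the chosen dual `Xᘁ`, whose solution need not be standard;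
  -- naturality along `rightDualIso` transfers the computation made with `X'`.
  obtain ⟨w, hw⟩ := exists_smul_coevaluation hX (HasRightDual.exact (X := X)) ((λ_ (𝟙_ C)).inv ≫ v)
  have hv : v = w • (𝟙 _ ⊗ₘ 𝟙 _) ≫ ((λ_ (𝟙_ C)).hom ≫ η_ X X') ≫
      (𝟙 X ⊗ₘ (rightDualIso r (HasRightDual.exact (X := X))).hom) := by
    rw [id_tensorHom_id, Category.id_comp, id_tensorHom, Category.assoc, coevaluation_rightDualIso,
      ← Linear.comp_smul, ← hw]
    simp
  rw [hv, map_smul, compressMap_naturality, key, smul_comm]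
  simp

end ConjugationSymbol

end RigidCStarTensorCategory

/-! ### Positive functionals on *-algebras and the GNS construction -/

section PositiveFunctionals

open scoped ComplexOrder

variable {R : Type*} [Ring R] [StarRing R] [Algebra ℂ R] [StarModule ℂ R]

/-- The values at 1 and `star z * z` are real, so positivity at `1 + z` makes ω(z) + ω(z*) real, and
positivity at `1 + I • z` does so for i(ω(z) − ω(z*)). -/
theorem map_star_of_nonneg (ω : R →ₗ[ℂ] ℂ) (hpos : ∀ x, 0 ≤ ω (star x * x)) (z : R) :
    ω (star z) = star (ω z) := by
  have h1 := fun x => (Complex.nonneg_iff.1 (hpos x)).2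
  have a1 := h1 1
  have a2 := h1 z
  have a3 := h1 (1 + z)
  have a4 := h1 (1 + Complex.I • z)
  simp only [star_add, star_one, star_smul, add_mul, mul_add, one_mul, mul_one, map_add,
    smul_mul_assoc, mul_smul_comm, map_smul, Complex.add_im, smul_eq_mul, Complex.mul_im,
    Complex.mul_re, Complex.star_def, Complex.conj_I, Complex.neg_re, Complex.neg_im,
    Complex.I_re, Complex.I_im] at a1 a2 a3 a4
  refine Complex.ext ?_ ?_
  · rw [Complex.star_def, Complex.conj_re]; linarith
  · rw [Complex.star_def, Complex.conj_im]; linarith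

/-- The sesquilinear form of a positive functional on a *-algebra. -/
@[reducible]
def positiveCore (ω : R →ₗ[ℂ] ℂ) (hpos : ∀ x, 0 ≤ ω (star x * x)) :
    PreInnerProductSpace.Core ℂ R where
  inner x y := ω (star x * y)
  conj_inner_symm x y := by
    rw [← Complex.star_def, ← map_star_of_nonneg ω hpos, star_mul, star_star]
  re_inner_nonneg x := (Complex.nonneg_iff.1 (hpos x)).1
  add_left x y z := by rw [star_add, add_mul, map_add]
  smul_left x y c := by
    rw [star_smul, smul_mul_assoc, map_smul, smul_eq_mul, Complex.star_def]

/-- The Cauchy-Schwarz inequality for positive functionals. -/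
theorem norm_sq_le_of_nonneg (ω : R →ₗ[ℂ] ℂ) (hpos : ∀ x, 0 ≤ ω (star x * x)) (x y : R) :
    ‖ω (star x * y)‖ ^ 2 ≤ (ω (star x * x)).re * (ω (star y * y)).re := by
  have h := @InnerProductSpace.Core.inner_mul_inner_self_le ℂ R _ _ _ (positiveCore ω hpos) x y
  have h1 : ‖ω (star y * x)‖ = ‖ω (star x * y)‖ := by
    rw [← norm_star (ω (star x * y)), ← map_star_of_nonneg ω hpos, star_mul, star_star]
  rw [sq]
  nth_rw 2 [← h1]
  exact h

end PositiveFunctionals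

open scoped ComplexOrder in
/-- The GNS construction for a bounded positive functional on a *-algebra. -/
theorem exists_gns {R : Type u} [Ring R] [StarRing R] [Algebra ℂ R] [StarModule ℂ R]
    (ω : R →ₗ[ℂ] ℂ) (hpos : ∀ x, 0 ≤ ω (star x * x))
    (hbd : ∀ a, ∃ M : ℝ, ∀ x, (ω (star (a * x) * (a * x))).re ≤ M * (ω (star x * x)).re) :
    ∃ (K : Type u) (_ : NormedAddCommGroup K) (_ : InnerProductSpace ℂ K) (_ : CompleteSpace K)
      (Θ : R →⋆ₐ[ℂ] (K →L[ℂ] K)) (j : R → K), DenseRange j ∧ (∀ a x, Θ a (j x) = j (a * x)) ∧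
      ∀ x y, inner ℂ (j x) (j y) = ω (star x * y) := by
  let core := positiveCore ω hpos
  let _ : SeminormedAddCommGroup R :=
    InnerProductSpace.Core.toSeminormedAddCommGroup (c := core)
  let _ : InnerProductSpace ℂ R := InnerProductSpace.ofCore core
  have hinner : ∀ x y : R, inner ℂ x y = ω (star x * y) := fun _ _ => rfl
  have hnorm : ∀ x : R, ‖x‖ ^ 2 = (ω (star x * x)).re := fun x => by
    rw [← hinner, ← inner_self_eq_norm_sq (𝕜 := ℂ)]
    rfl
  have hex : ∀ a : R, ∃ T : R →L[ℂ] R, ∀ x, T x = a * x := by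
    intro a
    obtain ⟨M, hM⟩ := hbd a
    -- `M` is an arbitrary real number, so its positive part is taken before the square root.
    refine ⟨(LinearMap.mulLeft ℂ a).mkContinuous (Real.sqrt (max M 0)) fun x => ?_, fun x => rfl⟩
    rw [← sq_le_sq₀ (norm_nonneg _) (by positivity), mul_pow, Real.sq_sqrt (le_max_right _ _),
      hnorm, hnorm]
    exact (hM x).trans (mul_le_mul_of_nonneg_right (le_max_left _ _)
      (Complex.nonneg_iff.1 (hpos x)).1)
  choose T hT using hex
  -- The completion of a seminormed space identifies vectors at distance zero, so null vectors need
  -- no separate quotient.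
  let K := UniformSpace.Completion R
  have hcoe : ∀ (a x : R), (T a).completion (x : K) = ((a * x : R) : K) := by
    intro a x
    rw [ContinuousLinearMap.completion_apply_coe, hT]
  have hext : ∀ S S' : K →L[ℂ] K, (∀ x : R, S (x : K) = S' (x : K)) → S = S' := by
    intro S S' h
    ext c
    induction c using UniformSpace.Completion.induction_on with
    | hp => exact isClosed_eq S.continuous S'.continuous
    | ih c => exact h c
  let Θ : R →⋆ₐ[ℂ] (K →L[ℂ] K) :=
    { toFun := fun a => (T a).completion
      map_one' := hext _ _ fun x => by rw [hcoe, one_mul]; rfl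
      map_mul' := fun a b => hext _ _ fun x => by
        rw [mul_apply_eq_comp, hcoe, hcoe, hcoe, mul_assoc]
      map_zero' := hext _ _ fun x => by
        rw [hcoe, zero_mul]
        exact UniformSpace.Completion.coe_zero
      map_add' := fun a b => hext _ _ fun x => by
        rw [add_apply, hcoe, hcoe, hcoe, add_mul]
        exact UniformSpace.Completion.coe_add _ _
      commutes' := fun c => hext _ _ fun x => by
        rw [hcoe, ← Algebra.smul_def]
        exact UniformSpace.Completion.coe_smul c x
      map_star' := fun a => by
        refine (ContinuousLinearMap.eq_adjoint_iff _ _).mpr fun x y => ?_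
        induction x, y using UniformSpace.Completion.induction_on₂ with
        | hp => apply isClosed_eq <;> fun_prop
        | ih x y =>
          rw [hcoe, hcoe, UniformSpace.Completion.inner_coe, UniformSpace.Completion.inner_coe,
            hinner, hinner, star_mul, star_star, mul_assoc] }
  refine ⟨K, inferInstance, inferInstance, inferInstance, Θ, fun x => (x : K),
    UniformSpace.Completion.denseRange_coe, hcoe, fun x y => ?_⟩
  rw [UniformSpace.Completion.inner_coe, hinner]

/-! ### cp-multipliers as coefficients of admissible representations -/

namespace RigidCStarTensorCategory

section GNS

variable {C : Type u} [Category.{v} C] [Preadditive C] [Linear ℂ C]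
  [MonoidalCategory C] [MonoidalPreadditive C] [MonoidalLinear ℂ C] [RightRigidCategory C]
  [CStarTensorCategory C] [RigidCStarTensorCategory C]

open scoped ComplexOrder

/-- The value at the unit is the scalar by which the positive map multiplies an identity morphism.
-/
theorem IsCPMultiplier.unit_nonneg {φ : Irr C → ℂ} (h : IsCPMultiplier φ) :
    0 ≤ φ (Irr.unit C) := by
  obtain ⟨θ, hθ, hsym⟩ := h
  have h1 : (0 : End (𝟙_ C ⊗ 𝟙_ C)) ≤ θ.toFun (𝟙_ C) (𝟙_ C) (𝟙 (𝟙_ C ⊗ 𝟙_ C)) := by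
    refine hθ.map_nonneg ?_
    have := comp_dag_nonneg (𝟙 (𝟙_ C ⊗ 𝟙_ C))
    rwa [dag_id, Category.comp_id] at this
  rw [θ.toFun_id hsym] at h1
  obtain ⟨g, hg⟩ := exists_eq_comp_dag h1
  have hI : IsIrreducible (𝟙_ C ⊗ 𝟙_ C) := irreducible_unit.congr (λ_ (𝟙_ C)).symm
  obtain ⟨c, hc, h2⟩ := exists_scalar hI g
  rw [smul_id_injective hI (hg.trans h2)]
  exact_mod_cast hc

variable {φ : Irr C → ℂ}

/-- The number in question is the value at the unit of the cp-multiplier conjugated by `x`. -/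
theorem IsCPMultiplier.symbolFunctional_nonneg (h : IsCPMultiplier φ) (x : FusionAlgebra C) :
    0 ≤ symbolFunctional φ (star x * x) := by
  have h1 := (h.conj x).unit_nonneg
  have h2 : FusionAlgebra.basis (Irr.unit C) * x = x := one_mul x
  rwa [h2, dim_rep_unit, Complex.ofReal_one, inv_one, one_mul] at h1

/-- Boundedness of the conjugated cp-multiplier; this is what makes the GNS operators bounded. -/
theorem IsCPMultiplier.norm_symbolFunctional_le (h : IsCPMultiplier φ) (x : FusionAlgebra C)
    (π : Irr C) : ‖symbolFunctional φ (star x * (FusionAlgebra.basis π * x))‖ ≤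
      2 * dim π.rep * (symbolFunctional φ (star x * x)).re := by
  have h1 := (h.conj x).norm_le π
  have h2 : FusionAlgebra.basis (Irr.unit C) * x = x := one_mul x
  have hd : 0 < dim π.rep := dim_pos π.irreducible_rep
  have h3 := h.symbolFunctional_nonneg x
  rw [h2, dim_rep_unit, Complex.ofReal_one, inv_one, one_mul, norm_mul, norm_inv, Complex.norm_real,
    Real.norm_eq_abs, abs_of_pos hd, inv_mul_le_iff₀ hd] at h1
  rw [Complex.re_eq_norm.2 h3]
  linarith

theorem IsCPMultiplier.exists_bound (h : IsCPMultiplier φ) (a : FusionAlgebra C) :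
    ∃ M : ℝ, ∀ x, ‖symbolFunctional φ (star x * (a * x))‖ ≤
      M * (symbolFunctional φ (star x * x)).re := by
  induction a using FusionAlgebra.induction_on with
  | h0 => exact ⟨0, fun x => by simp⟩
  | hadd a b ha hb =>
    obtain ⟨M, hM⟩ := ha
    obtain ⟨N, hN⟩ := hb
    refine ⟨M + N, fun x => ?_⟩
    rw [add_mul, mul_add, map_add, add_mul]
    exact (norm_add_le _ _).trans (add_le_add (hM x) (hN x))
  | hb c π =>
    refine ⟨‖c‖ * (2 * dim π.rep), fun x => ?_⟩
    rw [smul_mul_assoc, mul_smul_comm, map_smul, norm_smul, mul_assoc]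
    exact mul_le_mul_of_nonneg_left (h.norm_symbolFunctional_le x π) (norm_nonneg c)

/-- Every nonzero cp-multiplier is a coefficient of an admissible representation. -/
theorem IsCPMultiplier.exists_admissibleRep (h : IsCPMultiplier φ) (h0 : φ (Irr.unit C) ≠ 0) :
    ∃ (Θ : AdmissibleRep C) (ξ : Θ.K), ∀ π,
      inner ℂ ξ (Θ.Θ (FusionAlgebra.basis π) ξ) = dim π.rep * φ π := by
  obtain ⟨K, _, _, _, Θ, j, hj, hΘ, hin⟩ := exists_gns (symbolFunctional φ)
    h.symbolFunctional_nonneg fun a => by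
      -- The squared norm of `a * x` is the functional at `star x * (star a * a) * x`.
      obtain ⟨M, hM⟩ := h.exists_bound (star a * a)
      refine ⟨M, fun x => ?_⟩
      have := hM x
      rw [mul_assoc, ← mul_assoc, ← star_mul] at this
      exact (Complex.re_le_norm _).trans this
  have hcoef : ∀ π, inner ℂ (j 1) (Θ (FusionAlgebra.basis π) (j 1)) = dim π.rep * φ π := by
    intro π
    rw [hΘ, hin, star_one, one_mul, mul_one, symbolFunctional_basis]
  have hne : j 1 ≠ 0 := by
    intro h1
    have h2 := hcoef (Irr.unit C)
    rw [h1, inner_zero_left, dim_rep_unit, Complex.ofReal_one, one_mul] at h2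
    exact h0 h2.symm
  have : Nontrivial K := ⟨⟨_, _, hne⟩⟩
  refine ⟨{ K := K, Θ := Θ, admissible := fun ξ => ?_ }, j 1, hcoef⟩
  -- Coefficients of the dense vectors `j x` are conjugates of `φ`; an arbitrary vector is a limit
  -- of these along this filter, and cp-multipliers are closed under pointwise limits.
  have : (Filter.comap j (nhds ξ)).NeBot := Filter.comap_neBot fun t ht => by
    obtain ⟨_, h1, x, rfl⟩ := mem_closure_iff_nhds.1 (hj ξ) t ht
    exact ⟨x, h1⟩
  have hlim : Filter.Tendsto j (Filter.comap j (nhds ξ)) (nhds ξ) := Filter.tendsto_comap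
  refine IsCPMultiplier.of_tendsto (l := Filter.comap j (nhds ξ)) (φ := fun x π =>
    (dim π.rep : ℂ)⁻¹ * inner ℂ (j x) (Θ (FusionAlgebra.basis π) (j x))) (fun π => ?_) fun x => ?_
  · exact (hlim.inner (((Θ (FusionAlgebra.basis π)).continuous.tendsto ξ).comp hlim)).const_mul _
  · simp only [hΘ, hin]
    exact h.conj x

end GNS

end RigidCStarTensorCategory


/-! ### Components of the universal C*-algebra -/

section BoundedFamilies

open scoped ENNReal

variable {I : Type*} {A : I → Type*} [∀ i, CStarAlgebra (A i)] [∀ i, Nontrivial (A i)]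

/-- The components of a bounded family. -/
noncomputable def BoundedFamilies.eval (i : I) : BoundedFamilies A →⋆ₐ[ℂ] A i where
  toFun x := (show lp A ∞ from x) i
  map_one' := rfl
  map_mul' _ _ := rfl
  map_zero' := rfl
  map_add' _ _ := rfl
  commutes' _ := rfl
  map_star' _ := rfl

theorem BoundedFamilies.norm_le_of_forall_le {x : BoundedFamilies A} {M : ℝ} (hM : 0 ≤ M)
    (h : ∀ i, ‖BoundedFamilies.eval i x‖ ≤ M) : ‖x‖ ≤ M :=
  lp.norm_le_of_forall_le (f := (show lp A ∞ from x)) hM h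

end BoundedFamilies

section ClosedRange

variable {R A : Type*} [Ring R] [StarRing R] [Algebra ℂ R] [CStarAlgebra A] (Θ : R →⋆ₐ[ℂ] A)

/-- The inclusion of the closure of the range of a *-homomorphism. -/
noncomputable def ClosedRange.incl : ClosedRange Θ →⋆ₐ[ℂ] A :=
  Θ.range.topologicalClosure.subtype

theorem ClosedRange.denseRange_restrict : DenseRange (ClosedRange.restrict Θ) := by
  intro x
  have hx : (x.1 : A) ∈ closure (Θ.range : Set A) := x.2
  rw [Metric.mem_closure_iff] at hx ⊢
  intro r hr
  obtain ⟨_, ⟨y, rfl⟩, hy⟩ := hx r hr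
  exact ⟨_, ⟨y, rfl⟩, hy⟩

end ClosedRange

/-! ### The trivial representation and uniqueness of the projection -/

namespace RigidCStarTensorCategory

section UniversalAlgebra

variable {C : Type u} [Category.{v} C] [Preadditive C] [Linear ℂ C]
  [MonoidalCategory C] [MonoidalPreadditive C] [MonoidalLinear ℂ C] [RightRigidCategory C]
  [CStarTensorCategory C] [RigidCStarTensorCategory C]

/-- The extension of an admissible representation to the universal C*-algebra. -/
noncomputable def evalRep (Θ : AdmissibleRep C) :
    UniversalCStarAlgebra C →⋆ₐ[ℂ] (Θ.K →L[ℂ] Θ.K) :=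
  (BoundedFamilies.eval Θ).comp (ClosedRange.incl (universalRep C))

theorem evalRep_toUniversal (Θ : AdmissibleRep C) (x : FusionAlgebra C) :
    evalRep Θ (toUniversal C x) = Θ.Θ x := rfl

/-- The norm is a supremum over admissible representations, so estimates uniform in the
representation hold in C_u(C). -/
theorem universal_norm_le {x : UniversalCStarAlgebra C} {M : ℝ} (hM : 0 ≤ M)
    (h : ∀ Θ, ‖evalRep Θ x‖ ≤ M) : ‖x‖ ≤ M :=
  BoundedFamilies.norm_le_of_forall_le (x := ClosedRange.incl (universalRep C) x) hM h

theorem universal_ext {x y : UniversalCStarAlgebra C} (h : ∀ Θ, evalRep Θ x = evalRep Θ y) :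
    x = y := by
  rw [← sub_eq_zero, ← norm_le_zero_iff]
  exact universal_norm_le le_rfl fun Θ => by rw [map_sub, h, sub_self, norm_zero]

variable (C) in
theorem denseRange_toUniversal : DenseRange (toUniversal C) :=
  ClosedRange.denseRange_restrict _

/-- The nonnegative constant functions are cp-multipliers. -/
theorem isCPMultiplier_const {r : ℝ} (hr : 0 ≤ r) : IsCPMultiplier fun _ : Irr C => (r : ℂ) := by
  refine ⟨{ toFun := fun X Y => (r : ℂ) • LinearMap.id, natural := ?_, amplify := ?_ },
    Multiplier.isPositiveType_of_nonneg fun X Y x hx => ?_,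
    { toFun := fun X Y Z W => (r : ℂ) • LinearMap.id, natural := ?_, restrict := ?_ }, ?_⟩
  · intro X₁ Y₁ X₂ Y₂ x a b a' b'
    change (r : ℂ) • _ = (a' ⊗ₘ b') ≫ ((r : ℂ) • x) ≫ (a ⊗ₘ b)
    rw [Linear.smul_comp, Linear.comp_smul]
    rfl
  · intro X₂ X₁ Y₁ Y₂ x
    exact (amplification_smul X₂ Y₂ (r : ℂ) x).symm
  · change (0 : End (X ⊗ Y)) ≤ (r : ℂ) • (show End (X ⊗ Y) from x)
    obtain ⟨g, hg⟩ := exists_eq_comp_dag hx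
    have h1 : (r : ℂ) • x = ((Real.sqrt r : ℂ) • g) ≫ dag ((Real.sqrt r : ℂ) • g) := by
      rw [dag_smul, Linear.comp_smul, Linear.smul_comp, smul_smul, ← hg]
      congr 1
      rw [Complex.star_def, Complex.conj_ofReal, ← Complex.ofReal_mul, Real.mul_self_sqrt hr]
    exact h1 ▸ comp_dag_nonneg ((Real.sqrt r : ℂ) • g)
  · intro X₁ Y₁ Z₁ W₁ X₂ Y₂ Z₂ W₂ x a b a' b'
    change (r : ℂ) • _ = (a' ⊗ₘ b') ≫ ((r : ℂ) • x) ≫ (a ⊗ₘ b)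
    rw [Linear.smul_comp, Linear.comp_smul]
    rfl
  · intro X Y x
    rfl
  · intro X hX v
    rfl

variable (C) in
/-- The trivial representation on a one-dimensional Hilbert space. -/
noncomputable def trivialRep : AdmissibleRep C where
  K := EuclideanSpace ℂ PUnit.{u + 1}
  Θ := (StarAlgHom.ofId ℂ _).comp (dimHom C)
  admissible ξ := by
    -- Dividing by the dimension turns the coefficient of `ξ` into the constant `‖ξ‖ ^ 2`.
    convert isCPMultiplier_const (C := C) (r := ‖ξ‖ ^ 2) (by positivity) using 2 with π
    have h0 : (dim π.rep : ℂ) ≠ 0 := by exact_mod_cast dim_ne_zero π.irreducible_rep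
    have h1 : ((StarAlgHom.ofId ℂ (EuclideanSpace ℂ PUnit.{u + 1} →L[ℂ]
        EuclideanSpace ℂ PUnit.{u + 1})).comp (dimHom C)) (FusionAlgebra.basis π) ξ =
        (dim π.rep : ℂ) • ξ := by
      rw [← dimHom_basis]
      rfl
    rw [h1, inner_smul_right, inner_self_eq_norm_sq_to_K, inv_mul_cancel_left₀ h0]
    simp

theorem trivialRep_apply (x : FusionAlgebra C) (ξ : (trivialRep C).K) :
    (trivialRep C).Θ x ξ = dimHom C x • ξ := rfl

variable (C) in
theorem exists_trivialVector : ∃ e : (trivialRep C).K, ‖e‖ = 1 :=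
  have h : ∃ e : EuclideanSpace ℂ PUnit.{u + 1}, ‖e‖ = 1 :=
    ⟨EuclideanSpace.single PUnit.unit (1 : ℂ), by simp⟩
  h

variable (C) in
/-- A unit vector of the trivial representation. -/
noncomputable def trivialVector : (trivialRep C).K := (exists_trivialVector C).choose

theorem inner_trivialVector : inner ℂ (trivialVector C) (trivialVector C) = 1 := by
  rw [inner_self_eq_norm_sq_to_K, trivialVector, (exists_trivialVector C).choose_spec]
  simp

/-- The operators are scalars on the dense fusion algebra, hence everywhere; this makes the vector
functional multiplicative. -/
theorem evalRep_trivialRep (x : UniversalCStarAlgebra C) : evalRep (trivialRep C) x =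
    inner ℂ (trivialVector C) (evalRep (trivialRep C) x (trivialVector C)) • 1 := by
  have hc : Continuous (evalRep (trivialRep C)) := map_continuous _
  refine (denseRange_toUniversal C).induction_on x (isClosed_eq hc (by fun_prop)) fun a => ?_
  rw [evalRep_toUniversal, trivialRep_apply, inner_smul_right, inner_trivialVector, mul_one]
  rfl

variable (C) in
/-- The trivial representation of the universal C*-algebra as a character. -/
noncomputable def trivialCharacter : UniversalCStarAlgebra C →⋆ₐ[ℂ] ℂ :=
  have key : ∀ {c : ℂ} {x : UniversalCStarAlgebra C}, evalRep (trivialRep C) x = c • 1 →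
      inner ℂ (trivialVector C) (evalRep (trivialRep C) x (trivialVector C)) = c := by
    intro c x h
    rw [h]
    change inner ℂ _ (c • trivialVector C) = _
    rw [inner_smul_right, inner_trivialVector, mul_one]
  { toFun := fun x => inner ℂ (trivialVector C) (evalRep (trivialRep C) x (trivialVector C))
    map_one' := key (by rw [map_one, one_smul])
    map_mul' := fun x y => key (by
      conv_lhs => rw [map_mul, evalRep_trivialRep x, evalRep_trivialRep y, smul_mul_smul_comm,
        one_mul])
    map_zero' := key (by rw [map_zero, zero_smul])
    map_add' := fun x y => key (by
      conv_lhs => rw [map_add, evalRep_trivialRep x, evalRep_trivialRep y, ← add_smul])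
    commutes' := fun c => key (by
      rw [AlgHomClass.commutes, Algebra.algebraMap_eq_smul_one]
      rfl)
    map_star' := fun x => key (by
      conv_lhs => rw [map_star, evalRep_trivialRep x, star_smul, star_one]) }

theorem trivialCharacter_toUniversal (a : FusionAlgebra C) :
    trivialCharacter C (toUniversal C a) = dimHom C a := by
  change inner ℂ _ (dimHom C a • trivialVector C) = _
  rw [inner_smul_right, inner_trivialVector, mul_one]

theorem isTrivialRep_trivialCharacter : IsTrivialRep (trivialCharacter C) := fun X =>
  (trivialCharacter_toUniversal _).trans (dimHom_of X)

theorem IsTrivialRep.eq_trivialCharacter {e : UniversalCStarAlgebra C →⋆ₐ[ℂ] ℂ}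
    (he : IsTrivialRep e) : e = trivialCharacter C := by
  refine StarAlgHom.ext fun x => ?_
  refine (denseRange_toUniversal C).induction_on x
    (isClosed_eq (map_continuous e) (map_continuous _)) fun a => ?_
  obtain ⟨n, V, c, rfl⟩ := exists_sum_of a
  simp only [map_sum, map_smul]
  exact Finset.sum_congr rfl fun i _ => congrArg _
    ((he (V i)).trans (isTrivialRep_trivialCharacter (V i)).symm)

/-- A projection as in the definition of `IsTrivialProjection` absorbs all elements. -/
theorem IsTrivialProjection.mul_eq {p : UniversalCStarAlgebra C} (hp : IsTrivialProjection p)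
    (x : UniversalCStarAlgebra C) : x * p = trivialCharacter C x • p := by
  refine (denseRange_toUniversal C).induction_on x (isClosed_eq (by fun_prop)
    ((map_continuous (trivialCharacter C)).smul continuous_const)) fun a => ?_
  obtain ⟨n, V, c, rfl⟩ := exists_sum_of a
  simp only [map_sum, map_smul, Finset.sum_mul, Finset.sum_smul, smul_mul_assoc]
  refine Finset.sum_congr rfl fun i _ => ?_
  have h1 := isTrivialRep_trivialCharacter (V i)
  have h2 := hp.2.2 (V i)
  rw [objElement] at h1 h2
  rw [h1, h2, smul_smul, smul_eq_mul]

/-- Idempotence and absorption give p = p p = ε(p) p with p ≠ 0. -/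
theorem IsTrivialProjection.trivialCharacter_eq {p : UniversalCStarAlgebra C}
    (hp : IsTrivialProjection p) : trivialCharacter C p = 1 := by
  have h1 := hp.mul_eq p
  rw [hp.2.1.isIdempotentElem.eq] at h1
  by_contra hne
  have h2 : (trivialCharacter C p - 1) • p = 0 := by rw [sub_smul, ← h1, one_smul, sub_self]
  exact hp.1 ((smul_eq_zero.1 h2).resolve_left (sub_ne_zero.2 hne))

theorem IsTrivialProjection.eq_mul {p : UniversalCStarAlgebra C} (hp : IsTrivialProjection p)
    (x : UniversalCStarAlgebra C) : p * x = trivialCharacter C x • p := by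
  have h1 := congrArg star (hp.mul_eq (star x))
  rwa [star_mul, star_star, star_smul, map_star, star_star, hp.2.1.isSelfAdjoint.star_eq] at h1

/-- The product q p equals p by absorption into p on the right, and q by absorption into q on the
left. -/
theorem IsTrivialProjection.unique {p q : UniversalCStarAlgebra C} (hp : IsTrivialProjection p)
    (hq : IsTrivialProjection q) : q = p := by
  have h1 := hp.mul_eq q
  have h2 := hq.eq_mul p
  rw [hq.trivialCharacter_eq, one_smul] at h1
  rw [hp.trivialCharacter_eq, one_smul] at h2
  exact h2.symm.trans h1

end UniversalAlgebra

end RigidCStarTensorCategory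


/-! ### Two estimates on powers -/

theorem le_of_forall_pow_two_pow_le {a b c : ℝ} (hb : 0 ≤ b)
    (h : ∀ n : ℕ, a ^ 2 ^ n ≤ c * b ^ 2 ^ n) : a ≤ b := by
  by_contra! hab
  rcases hb.eq_or_lt with rfl | hb'
  · have := h 0
    simp at this
    linarith
  · have h1 : 1 < a / b := (one_lt_div hb').2 hab
    obtain ⟨n, hn⟩ := pow_unbounded_of_one_lt c h1
    have h2 : (a / b) ^ n ≤ (a / b) ^ 2 ^ n := pow_le_pow_right₀ h1.le Nat.lt_two_pow_self.le
    have h3 := h n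
    rw [← div_le_iff₀ (by positivity), ← div_pow] at h3
    linarith

/-- If `B` is a positive operator that fixes a subspace and is at most `r < 1` on its orthogonal
complement, then the powers of `B` converge to the orthogonal projection. -/
theorem norm_pow_sub_starProjection_le {H : Type*} [NormedAddCommGroup H] [InnerProductSpace ℂ H]
    [CompleteSpace H] (B : H →L[ℂ] H) (hB : IsSelfAdjoint B) (V : Submodule ℂ H)
    [V.HasOrthogonalProjection] (hV : ∀ x ∈ V, B x = x) {r : ℝ} (hr : 0 ≤ r)
    (h0 : ∀ x, 0 ≤ (inner ℂ x (B x)).re)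
    (h1 : ∀ x ∈ Vᗮ, (inner ℂ x (B x)).re ≤ r * ‖x‖ ^ 2) (n : ℕ) :
    ‖B ^ (n + 1) - V.starProjection‖ ≤ r ^ (n + 1) := by
  set P := V.starProjection with hP
  have hPs : IsSelfAdjoint P := isSelfAdjoint_starProjection V
  have hPm : ∀ x, P x ∈ V := fun x => Submodule.starProjection_apply_mem V x
  have hPP : P * P = P := by
    ext x
    exact Submodule.starProjection_eq_self_iff.2 (hPm x)
  have hBP : B * P = P := by
    ext x
    exact hV _ (hPm x)
  have hPB : P * B = P := by
    have := congrArg star hBP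
    rwa [star_mul, hB.star_eq, hPs.star_eq] at this
  -- Since B P = P B = P² = P, all mixed terms cancel. The formula starts at exponent one: at zero
  -- the left side is 1 and the right side is 1 − P.
  have hpow : ∀ k : ℕ, (B - P) ^ (k + 1) = B ^ (k + 1) - P := by
    intro k
    induction k with
    | zero => simp
    | succ k ih =>
      have hk : B ^ (k + 1) * P = P := by
        clear ih
        induction k with
        | zero => simpa using hBP
        | succ k ih => rw [pow_succ, mul_assoc, hBP, ih]
      rw [pow_succ, ih, sub_mul, mul_sub, mul_sub, hk, hPB, hPP, ← pow_succ]
      abel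
  have hs : IsSelfAdjoint (B - P) := hB.sub hPs
  -- B − P is B compressed to the orthogonal complement of V, so `h0` and `h1` become 0 ≤ B − P ≤ r.
  have hin : ∀ x, inner ℂ x ((B - P) x) = inner ℂ (x - P x) (B (x - P x)) := by
    intro x
    have h2 : (B - P) x = B (x - P x) := by
      rw [map_sub, hV _ (hPm x)]
      rfl
    have h3 : inner ℂ (P x) (B (x - P x)) = 0 := by
      rw [← ContinuousLinearMap.adjoint_inner_left, ← ContinuousLinearMap.star_eq_adjoint,
        hB.star_eq, hV _ (hPm x)]
      exact inner_eq_zero_symm.1 (Submodule.starProjection_inner_eq_zero x _ (hPm x))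
    rw [h2, inner_sub_left, h3, sub_zero]
  have hnn : (0 : H →L[ℂ] H) ≤ B - P := by
    rw [ContinuousLinearMap.nonneg_iff_isPositive]
    refine ContinuousLinearMap.isPositive_def'.2 ⟨hs, fun x => ?_⟩
    rw [ContinuousLinearMap.reApplyInnerSelf_apply, inner_re_symm, hin]
    exact h0 _
  have hle : ‖B - P‖ ≤ r := by
    rw [CStarAlgebra.norm_le_iff_le_algebraMap _ hr hnn, ContinuousLinearMap.le_def]
    refine ContinuousLinearMap.isPositive_def'.2 ⟨?_, fun x => ?_⟩
    · exact (IsSelfAdjoint.algebraMap _ (IsSelfAdjoint.all r)).sub hs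
    have h2 : (algebraMap ℝ (H →L[ℂ] H) r - (B - P)) x = (r : ℂ) • x - (B - P) x := rfl
    have h3 : ‖x - P x‖ ≤ ‖x‖ := by
      rw [← Submodule.starProjection_orthogonal_val]
      exact Submodule.norm_starProjection_apply_le _ x
    have h4 := h1 (x - P x) (Submodule.sub_starProjection_mem_orthogonal x)
    have h5 : r * ‖x - P x‖ ^ 2 ≤ r * ‖x‖ ^ 2 := by gcongr
    rw [ContinuousLinearMap.reApplyInnerSelf_apply, inner_re_symm, h2, inner_sub_right, hin,
      inner_smul_right, inner_self_eq_norm_sq_to_K]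
    have h6 : RCLike.re ((r : ℂ) * ((‖x‖ : ℝ) : ℂ) ^ 2) = r * ‖x‖ ^ 2 := by
      rw [← Complex.ofReal_pow, ← Complex.ofReal_mul]
      rfl
    rw [map_sub]
    erw [h6]
    change 0 ≤ r * ‖x‖ ^ 2 - (inner ℂ (x - P x) (B (x - P x))).re
    linarith
  rw [← hpow]
  exact (norm_pow_le' _ n.succ_pos).trans (pow_le_pow_left₀ (norm_nonneg _) hle _)

/-! ### Sharp norm bounds in admissible representations -/

namespace RigidCStarTensorCategory

section NormBounds

variable {C : Type u} [Category.{v} C] [Preadditive C] [Linear ℂ C]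
  [MonoidalCategory C] [MonoidalPreadditive C] [MonoidalLinear ℂ C] [RightRigidCategory C]
  [CStarTensorCategory C] [RigidCStarTensorCategory C]

theorem dim_nonneg (X : C) : 0 ≤ dim X := by
  obtain ⟨n, Y, a, hY, h⟩ := exists_irreducible_orthSum X
  rw [dim_orthSum h]
  exact Finset.sum_nonneg fun i _ => (dim_pos (hY i)).le

theorem exists_of_pow (X : C) (n : ℕ) : ∃ Z : C, FusionAlgebra.of X ^ n = FusionAlgebra.of Z ∧
    dim Z = dim X ^ n := by
  induction n with
  | zero =>
    refine ⟨𝟙_ C, ?_, ?_⟩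
    · rw [FusionAlgebra.of_irreducible irreducible_unit, pow_zero]
      rfl
    · rw [dim_unit, pow_zero]
  | succ n ih =>
    obtain ⟨Z, h1, h2⟩ := ih
    exact ⟨Z ⊗ X, by rw [pow_succ, h1, FusionAlgebra.of_mul_of], by rw [dim_tensor, h2, pow_succ]⟩

theorem AdmissibleRep.norm_of_le_four (Θ : AdmissibleRep C) (X : C) :
    ‖Θ.Θ (FusionAlgebra.of X)‖ ≤ 4 * dim X := by
  obtain ⟨n, Y, a, hY, h⟩ := exists_irreducible_orthSum X
  rw [dim_orthSum h, FusionAlgebra.of_isDirectSum h, map_sum, Finset.mul_sum]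
  refine norm_sum_le_of_le _ fun i _ => ?_
  rw [FusionAlgebra.of_irreducible (hY i)]
  refine (Θ.admissible.norm_le _).trans_eq ?_
  rw [dim_rep_unit, dim_rep_mk, abs_one, inv_one, mul_one, abs_of_pos (dim_pos (hY i))]

/-- The crude constant 4 is removed by taking powers. With T the operator of X, T* T is the operator
of the object Xᘁ ⊗ X, and so its powers are operators of objects whose dimension is the
corresponding power. For self-adjoint elements the norm commutes with powers of exponent 2ⁿ, so the
constant disappears as n grows. -/
theorem AdmissibleRep.norm_of_le (Θ : AdmissibleRep C) (X : C) :
    ‖Θ.Θ (FusionAlgebra.of X)‖ ≤ dim X := by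
  set T := Θ.Θ (FusionAlgebra.of X) with hT
  have hS : star T * T = Θ.Θ (FusionAlgebra.of (Xᘁ ⊗ X)) := by
    rw [hT, ← map_star, ← map_mul, FusionAlgebra.star_of, FusionAlgebra.of_mul_of]
  have h1 : ‖star T * T‖ ≤ dim X ^ 2 := by
    refine le_of_forall_pow_two_pow_le (c := 4) (by positivity) fun n => ?_
    obtain ⟨Z, hZ, hd⟩ := exists_of_pow (Xᘁ ⊗ X) (2 ^ n)
    have h2 := (IsSelfAdjoint.star_mul_self T).nnnorm_pow_two_pow n
    have h3 : ‖(star T * T) ^ 2 ^ n‖ = ‖star T * T‖ ^ 2 ^ n := by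
      simpa only [coe_nnnorm, NNReal.coe_pow] using congrArg NNReal.toReal h2
    rw [← h3, hS, ← map_pow, hZ]
    refine (Θ.norm_of_le_four Z).trans_eq ?_
    rw [hd, dim_tensor, dim_dual, sq]
  rw [CStarRing.norm_star_mul_self, ← sq] at h1
  exact le_of_sq_le_sq h1 (dim_nonneg X)

theorem AdmissibleRep.norm_basis_le (Θ : AdmissibleRep C) (π : Irr C) :
    ‖Θ.Θ (FusionAlgebra.basis π)‖ ≤ dim π.rep := by
  rw [← FusionAlgebra.of_rep]
  exact Θ.norm_of_le _

end NormBounds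

end RigidCStarTensorCategory


/-! ### Fixed vectors by convexity -/

/-- A family of contractions that preserves the convex hull of a nonempty set has a common fixed
vector in the closed convex hull. -/
theorem exists_fixed_of_contractions {H I : Type*} [NormedAddCommGroup H] [InnerProductSpace ℂ H]
    [CompleteSpace H] {S : Set H} (hS : S.Nonempty) (T : I → H →L[ℂ] H) (hT : ∀ i, ‖T i‖ ≤ 1)
    (hTS : ∀ i, ∀ x ∈ S, T i x ∈ convexHull ℝ S) (ξ : H) {c : ℝ}
    (hc : ∀ x ∈ S, c ≤ (inner ℂ ξ x).re) :
    ∃ η, (∀ i, T i η = η) ∧ c ≤ (inner ℂ ξ η).re := by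
  let _ : InnerProductSpace ℝ H := InnerProductSpace.rclikeToReal ℂ H
  set Q : Set H := closure (convexHull ℝ S) with hQ
  have hconv : Convex ℝ Q := (convex_convexHull ℝ S).closure
  have hne : Q.Nonempty := (hS.convexHull (𝕜 := ℝ)).closure
  -- The fixed vector is the element of least norm of the closed convex hull. Each contraction keeps
  -- it in the hull without increasing its norm, and the parallelogram law shows that the minimiser
  -- is unique.
  obtain ⟨η, hη, hmin⟩ := exists_norm_eq_iInf_of_complete_convex hne
    isClosed_closure.isComplete hconv (0 : H)
  have hle : ∀ x ∈ Q, ‖η‖ ≤ ‖x‖ := by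
    intro x hx
    have h1 : (⨅ w : Q, ‖(0 : H) - w‖) ≤ ‖(0 : H) - x‖ :=
      ciInf_le (f := fun w : Q => ‖(0 : H) - w‖) ⟨0, by rintro _ ⟨w, rfl⟩; exact norm_nonneg _⟩
        ⟨x, hx⟩
    rw [← hmin] at h1
    simpa using h1
  have huniq : ∀ x ∈ Q, ‖x‖ ≤ ‖η‖ → x = η := by
    intro x hx hxη
    have h1 : (2⁻¹ : ℝ) • x + (2⁻¹ : ℝ) • η ∈ Q :=
      hconv hx hη (by norm_num) (by norm_num) (by norm_num)
    have h2 := hle _ h1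
    rw [← smul_add, norm_smul, Real.norm_of_nonneg (by norm_num)] at h2
    have h3 := parallelogram_law_with_norm ℝ x η
    have h4 : ‖x - η‖ = 0 := by
      have := norm_nonneg (x - η)
      have := norm_nonneg x
      have := norm_nonneg η
      nlinarith
    exact sub_eq_zero.1 (norm_eq_zero.1 h4)
  have hmaps : ∀ i, ∀ x ∈ Q, T i x ∈ Q := by
    intro i x hx
    refine map_mem_closure (T i).continuous hx fun y hy => ?_
    have h1 : ((T i).toLinearMap.restrictScalars ℝ) y ∈
        ((T i).toLinearMap.restrictScalars ℝ) '' convexHull ℝ S := ⟨y, hy, rfl⟩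
    rw [LinearMap.image_convexHull] at h1
    refine convexHull_min ?_ (convex_convexHull ℝ S) h1
    rintro _ ⟨z, hz, rfl⟩
    exact hTS i z hz
  refine ⟨η, fun i => huniq _ (hmaps i η hη) ?_, ?_⟩
  · simpa using (T i).le_of_opNorm_le (hT i) η
  · have hcont : Continuous fun x : H => (inner ℂ ξ x).re := by fun_prop
    have h1 : Q ⊆ {x | c ≤ (inner ℂ ξ x).re} := by
      refine closure_minimal (convexHull_min hc ?_) (isClosed_le continuous_const hcont)
      intro x hx y hy a b ha hb hab
      change c ≤ (inner ℂ ξ (a • x + b • y)).re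
      have e : ∀ (t : ℝ) (z : H), (inner ℂ ξ (t • z)).re = t * (inner ℂ ξ z).re := by
        intro t z
        rw [RCLike.real_smul_eq_coe_smul (K := ℂ), inner_smul_right]
        simp
      rw [inner_add_right, Complex.add_re, e, e]
      have hx' : c ≤ (inner ℂ ξ x).re := hx
      have hy' : c ≤ (inner ℂ ξ y).re := hy
      calc c = a * c + b * c := by rw [← add_mul, hab, one_mul]
        _ ≤ _ := by gcongr
    exact h1 hη

/-! ### Invariant vectors and a finite form of property (T) -/

namespace RigidCStarTensorCategory

section Invariants

variable {C : Type u} [Category.{v} C] [Preadditive C] [Linear ℂ C]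
  [MonoidalCategory C] [MonoidalPreadditive C] [MonoidalLinear ℂ C] [RightRigidCategory C]
  [CStarTensorCategory C] [RigidCStarTensorCategory C]

/-- The invariant vectors of an admissible representation. -/
noncomputable def AdmissibleRep.invariants (Θ : AdmissibleRep C) : Submodule ℂ Θ.K :=
  ⨅ π : Irr C, LinearMap.ker
    (Θ.Θ (FusionAlgebra.basis π) - (dim π.rep : ℂ) • (1 : Θ.K →L[ℂ] Θ.K)).toLinearMap

theorem AdmissibleRep.mem_invariants {Θ : AdmissibleRep C} {η : Θ.K} :
    η ∈ Θ.invariants ↔ ∀ π, Θ.Θ (FusionAlgebra.basis π) η = (dim π.rep : ℂ) • η := by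
  simp only [AdmissibleRep.invariants, Submodule.mem_iInf, LinearMap.mem_ker]
  exact forall_congr' fun π => sub_eq_zero

instance (Θ : AdmissibleRep C) : CompleteSpace Θ.invariants := by
  have : IsClosed (Θ.invariants : Set Θ.K) := by
    rw [AdmissibleRep.invariants, Submodule.coe_iInf]
    exact isClosed_iInter fun π => ContinuousLinearMap.isClosed_ker _
  exact this.completeSpace_coe

theorem AdmissibleRep.apply_invariants {Θ : AdmissibleRep C} {η : Θ.K} (h : η ∈ Θ.invariants)
    (x : FusionAlgebra C) : Θ.Θ x η = dimHom C x • η := by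
  induction x using FusionAlgebra.induction_on with
  | h0 => simp
  | hadd x y hx hy => rw [map_add, map_add, add_apply, hx, hy, add_smul]
  | hb c π =>
    rw [map_smul, map_smul, dimHom_basis, smul_apply, AdmissibleRep.mem_invariants.1 h, smul_smul,
      smul_eq_mul]

/-- A vector whose coefficients are bounded below is not orthogonal to the invariant vectors. -/
theorem AdmissibleRep.exists_invariant (Θ : AdmissibleRep C) (ξ : Θ.K) {c : ℝ}
    (hc : ∀ π, c * dim π.rep ≤ (inner ℂ ξ (Θ.Θ (FusionAlgebra.basis π) ξ)).re) :
    ∃ η ∈ Θ.invariants, c ≤ (inner ℂ ξ η).re := by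
  have hd : ∀ π : Irr C, 0 < dim π.rep := fun π => dim_pos π.irreducible_rep
  have hd' : ∀ π : Irr C, (dim π.rep : ℂ) ≠ 0 := fun π => by exact_mod_cast (hd π).ne'
  -- Normalised by the dimension, the operators become contractions; this needs the bound
  -- `norm_basis_le` with constant one.
  let τ : Irr C → Θ.K →L[ℂ] Θ.K := fun π => (dim π.rep : ℂ)⁻¹ • Θ.Θ (FusionAlgebra.basis π)
  have hτ : ∀ π, Θ.Θ (FusionAlgebra.basis π) = (dim π.rep : ℂ) • τ π := fun π => by
    simp only [τ]
    rw [smul_smul, mul_inv_cancel₀ (hd' π), one_smul]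
  have hcontr : ∀ π, ‖τ π‖ ≤ 1 := fun π => by
    simp only [τ]
    rw [norm_smul, norm_inv, Complex.norm_real, Real.norm_of_nonneg (hd π).le,
      inv_mul_le_iff₀ (hd π), mul_one]
    exact Θ.norm_basis_le π
  have hmaps : ∀ β, ∀ x ∈ Set.range fun π => τ π ξ,
      τ β x ∈ convexHull ℝ (Set.range fun π => τ π ξ) := by
    rintro β _ ⟨π, rfl⟩
    obtain ⟨n, Y, a, hY, h⟩ := exists_irreducible_orthSum (β.rep ⊗ π.rep)
    -- The normalised fusion rules form a convex combination: the weights d(Y i) / (d(β) d(π)) are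
    -- positive and sum to one since d is additive and multiplicative.
    have e1 : τ β (τ π ξ) = ∑ i, ((dim β.rep)⁻¹ * (dim π.rep)⁻¹ * dim (Y i)) •
        τ (Irr.mk (Y i) (hY i)) ξ := by
      have e2 : τ β (τ π ξ) = ((dim β.rep : ℂ)⁻¹ * (dim π.rep : ℂ)⁻¹) •
          Θ.Θ (FusionAlgebra.basis β * FusionAlgebra.basis π) ξ := by
        simp only [τ]
        rw [smul_apply, smul_apply, map_smul, smul_smul, map_mul]
        rfl
      rw [e2, FusionAlgebra.basis_mul_basis, FusionAlgebra.of_isDirectSum h, map_sum, sum_apply,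
        Finset.smul_sum]
      refine Finset.sum_congr rfl fun i _ => ?_
      rw [FusionAlgebra.of_irreducible (hY i), hτ, dim_rep_mk, smul_apply, smul_smul,
        RCLike.real_smul_eq_coe_smul (K := ℂ)]
      congr 1
      simp
    rw [e1]
    refine (convex_convexHull ℝ _).sum_mem (fun i _ => ?_) ?_ fun i _ =>
      subset_convexHull ℝ _ ⟨_, rfl⟩
    · have := hd β
      have := hd π
      have := dim_pos (hY i)
      positivity
    · rw [← Finset.mul_sum, ← dim_orthSum h, dim_tensor]
      have := (hd β).ne'
      have := (hd π).ne'
      field_simp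
  have hlow : ∀ x ∈ Set.range fun π => τ π ξ, c ≤ (inner ℂ ξ x).re := by
    rintro _ ⟨π, rfl⟩
    have h3 := hc π
    rw [hτ, smul_apply, inner_smul_right, Complex.re_ofReal_mul, mul_comm] at h3
    exact le_of_mul_le_mul_left h3 (hd π)
  obtain ⟨η, h1, h2⟩ := exists_fixed_of_contractions
    (Set.nonempty_of_mem (Set.mem_range_self (f := fun π => τ π ξ) (Irr.unit C))) τ hcontr hmaps ξ hlow
  refine ⟨η, AdmissibleRep.mem_invariants.2 fun π => ?_, h2⟩
  rw [hτ, smul_apply, h1]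

/-- Property (T) in terms of finite sets. -/
theorem HasPropertyT.exists_finset (h : HasPropertyT C) : ∃ (F : Finset (Irr C)) (n : ℕ),
    ∀ φ : Irr C → ℂ, IsCPMultiplier φ → (∀ π ∈ F, ‖φ π - 1‖ < 1 / ((n : ℝ) + 1)) →
      ∀ π, ‖φ π - 1‖ ≤ 1 / 2 := by
  classical
  by_contra! hcon
  choose φ hφ hF π hπ using hcon
  -- The counterexamples, one for each finite set and each tolerance, form a net: it converges to 1
  -- pointwise, but never within 1/2 uniformly.
  have h1 := h (Finset (Irr C) × ℕ) (fun i => φ i.1 i.2) (fun i => hφ i.1 i.2) fun ρ => by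
    rw [Metric.tendsto_atTop]
    intro r hr
    obtain ⟨N, hN⟩ := exists_nat_one_div_lt hr
    refine ⟨({ρ}, N), fun i hi => ?_⟩
    rw [dist_eq_norm]
    refine (hF i.1 i.2 ρ (hi.1 (Finset.mem_singleton_self ρ))).trans (lt_of_le_of_lt ?_ hN)
    have : (N : ℝ) ≤ i.2 := by exact_mod_cast hi.2
    gcongr
  rw [Metric.tendstoUniformly_iff] at h1
  obtain ⟨i, hi⟩ := (h1 (1 / 2) (by norm_num)).exists
  have h2 := hi (π i.1 i.2)
  rw [dist_comm, dist_eq_norm] at h2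
  exact absurd h2 (hπ i.1 i.2).not_gt

end Invariants

end RigidCStarTensorCategory


/-! ### Spectral gap and construction of the projection -/

namespace RigidCStarTensorCategory

section SpectralGap

variable {C : Type u} [Category.{v} C] [Preadditive C] [Linear ℂ C]
  [MonoidalCategory C] [MonoidalPreadditive C] [MonoidalLinear ℂ C] [RightRigidCategory C]
  [CStarTensorCategory C] [RigidCStarTensorCategory C]

/-- The lazy symmetric random walk operator of a finite set of irreducible objects. -/
noncomputable def markov (F : Finset (Irr C)) : FusionAlgebra C :=
  (((2 * F.card + 1 : ℝ)⁻¹ : ℝ) : ℂ) • (((F.card + 1 : ℝ) : ℂ) • 1 +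
    ∑ π ∈ F, (((2 * dim π.rep)⁻¹ : ℝ) : ℂ) •
      (FusionAlgebra.basis π + star (FusionAlgebra.basis π)))

theorem star_markov (F : Finset (Irr C)) : star (markov F) = markov F := by
  simp only [markov, star_smul, star_add, star_sum, star_one, star_star, Complex.star_def,
    Complex.conj_ofReal]
  congr 3
  funext π
  rw [add_comm]

/-- The weights are normalised to total mass one, so that invariant vectors are fixed. -/
theorem dimHom_markov (F : Finset (Irr C)) : dimHom C (markov F) = 1 := by
  have h1 : ∀ π ∈ F, (((2 * dim π.rep)⁻¹ : ℝ) : ℂ) •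
      (dimHom C (FusionAlgebra.basis π) + star (dimHom C (FusionAlgebra.basis π))) = 1 := by
    intro π _
    have : (dim π.rep : ℂ) ≠ 0 := by exact_mod_cast dim_ne_zero π.irreducible_rep
    rw [dimHom_basis, Complex.star_def, Complex.conj_ofReal]
    push_cast
    rw [smul_eq_mul]
    field_simp
    norm_num
  simp only [markov, map_smul, map_add, map_sum, map_one, map_star]
  rw [Finset.sum_congr rfl h1]
  have h2 : (2 * (F.card : ℂ) + 1) ≠ 0 := by exact_mod_cast (by positivity : (2 * (F.card : ℝ) + 1) ≠ 0)
  simp only [Finset.sum_const, nsmul_eq_mul, smul_eq_mul, mul_one]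
  push_cast
  field_simp
  ring

theorem AdmissibleRep.re_inner_markov (Θ : AdmissibleRep C) (F : Finset (Irr C)) (ξ : Θ.K) :
    (2 * F.card + 1) * (inner ℂ ξ (Θ.Θ (markov F) ξ)).re = (F.card + 1) * ‖ξ‖ ^ 2 +
      ∑ π ∈ F, (dim π.rep)⁻¹ * (inner ℂ ξ (Θ.Θ (FusionAlgebra.basis π) ξ)).re := by
  have h1 : ∀ π : Irr C, (inner ℂ ξ (star (Θ.Θ (FusionAlgebra.basis π)) ξ)).re =
      (inner ℂ ξ (Θ.Θ (FusionAlgebra.basis π) ξ)).re := by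
    intro π
    rw [ContinuousLinearMap.star_eq_adjoint, ContinuousLinearMap.adjoint_inner_right]
    exact inner_re_symm (𝕜 := ℂ) _ _
  have h2 : (inner ℂ ξ ξ).re = ‖ξ‖ ^ 2 := (inner_self_eq_norm_sq (𝕜 := ℂ) ξ)
  simp only [markov, map_smul, map_add, map_sum, map_one, map_star, smul_apply, add_apply,
    sum_apply, one_apply_eq_self, inner_smul_right, inner_add_right, inner_sum,
    Complex.re_ofReal_mul, Complex.add_re, Complex.re_sum, h1, h2]
  have h3 : (2 * (F.card : ℝ) + 1) ≠ 0 := by positivity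
  rw [mul_inv_cancel_left₀ h3]
  congr 1
  refine Finset.sum_congr rfl fun π _ => ?_
  rw [mul_inv]
  ring

theorem AdmissibleRep.norm_coefficient_le (Θ : AdmissibleRep C) (π : Irr C) (ξ : Θ.K) :
    ‖inner ℂ ξ (Θ.Θ (FusionAlgebra.basis π) ξ)‖ ≤ dim π.rep * ‖ξ‖ ^ 2 := by
  refine (norm_inner_le_norm _ _).trans ?_
  have h := (Θ.Θ (FusionAlgebra.basis π)).le_of_opNorm_le (Θ.norm_basis_le π) ξ
  calc ‖ξ‖ * _ ≤ ‖ξ‖ * (dim π.rep * ‖ξ‖) := by gcongr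
    _ = _ := by ring

theorem AdmissibleRep.abs_re_coefficient_le (Θ : AdmissibleRep C) (π : Irr C) (ξ : Θ.K) :
    |(dim π.rep)⁻¹ * (inner ℂ ξ (Θ.Θ (FusionAlgebra.basis π) ξ)).re| ≤ ‖ξ‖ ^ 2 := by
  have hd := dim_pos π.irreducible_rep
  rw [abs_mul, abs_of_pos (inv_pos.2 hd), inv_mul_le_iff₀ hd]
  exact (Complex.abs_re_le_norm _).trans (Θ.norm_coefficient_le π ξ)

/-- Laziness serves this purpose: the identity has weight |F| + 1, while the |F| remaining terms are
each at least −‖ξ‖². -/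
theorem AdmissibleRep.re_inner_markov_nonneg (Θ : AdmissibleRep C) (F : Finset (Irr C)) (ξ : Θ.K) :
    0 ≤ (inner ℂ ξ (Θ.Θ (markov F) ξ)).re := by
  have h1 := Θ.re_inner_markov F ξ
  have h2 : ∑ π ∈ F, -‖ξ‖ ^ 2 ≤
      ∑ π ∈ F, (dim π.rep)⁻¹ * (inner ℂ ξ (Θ.Θ (FusionAlgebra.basis π) ξ)).re :=
    Finset.sum_le_sum fun π _ => (abs_le.1 (Θ.abs_re_coefficient_le π ξ)).1
  rw [Finset.sum_const, nsmul_eq_mul] at h2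
  have h3 : 0 ≤ (2 * (F.card : ℝ) + 1) * (inner ℂ ξ (Θ.Θ (markov F) ξ)).re := by
    rw [h1]
    nlinarith [sq_nonneg ‖ξ‖]
  exact nonneg_of_mul_nonneg_right h3 (by positivity)

/-- Expand |z − 1|² = |z|² + 1 − 2 Re z. -/
theorem re_le_of_norm_sub_one_ge {z : ℂ} (hz : ‖z‖ ≤ 1) {δ : ℝ} (hδ : 0 ≤ δ) (h : δ ≤ ‖z - 1‖) :
    z.re ≤ 1 - δ ^ 2 / 2 := by
  have h1 : δ ^ 2 ≤ ‖z - 1‖ ^ 2 := by gcongr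
  have h2 : ‖z‖ ^ 2 ≤ 1 := by nlinarith [norm_nonneg z]
  rw [Complex.sq_norm, Complex.normSq_apply] at h1 h2
  simp at h1
  nlinarith

/-- Property (T) gives a spectral gap, uniformly over all admissible representations. -/
theorem HasPropertyT.exists_gap (h : HasPropertyT C) : ∃ (F : Finset (Irr C)) (r : ℝ),
    0 ≤ r ∧ r < 1 ∧ ∀ (Θ : AdmissibleRep C), ∀ ξ ∈ Θ.invariantsᗮ,
      (inner ℂ ξ (Θ.Θ (markov F) ξ)).re ≤ r * ‖ξ‖ ^ 2 := by
  obtain ⟨F, n, hF⟩ := h.exists_finset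
  set δ : ℝ := 1 / ((n : ℝ) + 1) with hδ
  have hδ0 : 0 < δ := by positivity
  have hδ1 : δ ≤ 1 := by
    rw [hδ, div_le_one (by positivity)]
    linarith [n.cast_nonneg (α := ℝ)]
  have hN : (0 : ℝ) < 2 * F.card + 1 := by positivity
  -- At least one element of F contributes a real part of at most 1 − δ²/2 and the others at most 1;
  -- the loss δ²/2 is divided by the total weight 2|F| + 1.
  refine ⟨F, 1 - δ ^ 2 / 2 / (2 * F.card + 1), ?_, ?_, fun Θ ξ hξ => ?_⟩
  · rw [sub_nonneg, div_le_one hN]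
    nlinarith [F.card.cast_nonneg (α := ℝ)]
  · have : 0 < δ ^ 2 / 2 / (2 * F.card + 1) := by positivity
    linarith
  rcases eq_or_ne ξ 0 with rfl | hne
  · simp
  suffices hunit : ∀ ζ ∈ Θ.invariantsᗮ, ‖ζ‖ = 1 →
      (inner ℂ ζ (Θ.Θ (markov F) ζ)).re ≤ 1 - δ ^ 2 / 2 / (2 * F.card + 1) by
    have hpos : 0 < ‖ξ‖ := norm_pos_iff.2 hne
    have h1 := hunit ((((‖ξ‖)⁻¹ : ℝ) : ℂ) • ξ) (Submodule.smul_mem _ _ hξ) (by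
      rw [norm_smul, Complex.norm_real, norm_inv, norm_norm, inv_mul_cancel₀ hpos.ne'])
    rw [map_smul, inner_smul_left, inner_smul_right, Complex.conj_ofReal, Complex.re_ofReal_mul,
      Complex.re_ofReal_mul, ← mul_assoc, ← mul_inv, inv_mul_le_iff₀ (by positivity)] at h1
    linarith
  intro ζ hζ hζ1
  have hcoef : ∀ π : Irr C, ((dim π.rep : ℂ)⁻¹ *
      inner ℂ ζ (Θ.Θ (FusionAlgebra.basis π) ζ)).re =
      (dim π.rep)⁻¹ * (inner ℂ ζ (Θ.Θ (FusionAlgebra.basis π) ζ)).re := by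
    intro π
    rw [← Complex.ofReal_inv, Complex.re_ofReal_mul]
  -- Otherwise the coefficient of `ζ` would be δ-close to 1 on F, hence within 1/2 of 1 everywhere,
  -- and `exists_invariant` would give an invariant vector not orthogonal to `ζ`.
  obtain ⟨ρ, hρF, hρ⟩ : ∃ ρ ∈ F, δ ≤ ‖(dim ρ.rep : ℂ)⁻¹ *
      inner ℂ ζ (Θ.Θ (FusionAlgebra.basis ρ) ζ) - 1‖ := by
    by_contra! hcon
    have h1 := hF _ (Θ.admissible ζ) hcon
    obtain ⟨η, hη, hη'⟩ := Θ.exists_invariant ζ (c := 1 / 2) fun π => by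
      have h2 := (Complex.abs_re_le_norm _).trans (h1 π)
      rw [Complex.sub_re, hcoef, Complex.one_re] at h2
      have h3 := (abs_le.1 h2).1
      have hd := dim_pos π.irreducible_rep
      have h4 : 1 / 2 ≤ (dim π.rep)⁻¹ * (inner ℂ ζ (Θ.Θ (FusionAlgebra.basis π) ζ)).re := by
        linarith
      rw [← div_eq_inv_mul, le_div_iff₀ hd] at h4
      exact h4
    rw [Submodule.inner_left_of_mem_orthogonal hη hζ] at hη'
    norm_num at hη'
  have hρ' : (dim ρ.rep)⁻¹ * (inner ℂ ζ (Θ.Θ (FusionAlgebra.basis ρ) ζ)).re ≤ 1 - δ ^ 2 / 2 := by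
    rw [← hcoef]
    refine re_le_of_norm_sub_one_ge ?_ hδ0.le hρ
    have hd := dim_pos ρ.irreducible_rep
    have h1 := Θ.norm_coefficient_le ρ ζ
    rw [hζ1, one_pow, mul_one] at h1
    rw [norm_mul, norm_inv, Complex.norm_real, Real.norm_of_nonneg hd.le, inv_mul_le_iff₀ hd,
      mul_one]
    exact h1
  have hsum : ∑ π ∈ F, (dim π.rep)⁻¹ * (inner ℂ ζ (Θ.Θ (FusionAlgebra.basis π) ζ)).re ≤
      F.card - δ ^ 2 / 2 := by
    classical
    rw [← Finset.add_sum_erase F _ hρF]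
    have h1 : ∑ π ∈ F.erase ρ, (dim π.rep)⁻¹ * (inner ℂ ζ (Θ.Θ (FusionAlgebra.basis π) ζ)).re ≤
        ∑ π ∈ F.erase ρ, 1 := Finset.sum_le_sum fun π _ => by
      have := (abs_le.1 (Θ.abs_re_coefficient_le π ζ)).2
      rwa [hζ1, one_pow] at this
    rw [Finset.sum_const, nsmul_eq_mul, mul_one, Finset.card_erase_of_mem hρF,
      Nat.cast_sub (Finset.card_pos.2 ⟨ρ, hρF⟩)] at h1
    push_cast at h1
    linarith
  have h1 := Θ.re_inner_markov F ζ
  rw [hζ1] at h1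
  rw [← mul_le_mul_iff_right₀ hN, h1, mul_sub, mul_div_cancel₀ _ hN.ne']
  linarith

theorem AdmissibleRep.norm_markov_pow_le (Θ : AdmissibleRep C) {F : Finset (Irr C)} {r : ℝ}
    (hr : 0 ≤ r) (h : ∀ ξ ∈ Θ.invariantsᗮ, (inner ℂ ξ (Θ.Θ (markov F) ξ)).re ≤ r * ‖ξ‖ ^ 2)
    (n : ℕ) : ‖evalRep Θ (toUniversal C (markov F) ^ (n + 1)) - Θ.invariants.starProjection‖ ≤
      r ^ (n + 1) := by
  rw [map_pow, evalRep_toUniversal]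
  refine norm_pow_sub_starProjection_le _ ?_ Θ.invariants (fun ξ hξ => ?_) hr
    (Θ.re_inner_markov_nonneg F) h n
  · rw [IsSelfAdjoint, ← map_star, star_markov]
  · rw [AdmissibleRep.apply_invariants hξ, dimHom_markov, one_smul]

theorem trivialRep_mem_invariants (ξ : (trivialRep C).K) : ξ ∈ (trivialRep C).invariants :=
  AdmissibleRep.mem_invariants.2 fun π => by rw [trivialRep_apply, dimHom_basis]

/-- The powers of the random walk element converge at a geometric rate common to all
representations, hence in C_u(C). All properties of the limit can be read in each representation,
where it is the projection onto the invariant vectors; the trivial representation shows that it is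
nonzero. -/
theorem HasPropertyT.exists_isTrivialProjection (h : HasPropertyT C) :
    ∃ p : UniversalCStarAlgebra C, IsTrivialProjection p := by
  obtain ⟨F, r, hr0, hr1, hgap⟩ := h.exists_gap
  set b := toUniversal C (markov F) with hb
  have hbound := fun Θ : AdmissibleRep C => Θ.norm_markov_pow_le hr0 (hgap Θ)
  have hcauchy : CauchySeq fun n : ℕ => b ^ (n + 1) := by
    -- Consecutive powers are compared through the common limit: the error is at most r^(n+1) +
    -- r^(n+2) ≤ 2r · rⁿ.
    refine cauchySeq_of_le_geometric r (2 * r) hr1 fun n => ?_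
    rw [dist_eq_norm]
    refine universal_norm_le (by positivity) fun Θ => ?_
    have h1 := hbound Θ n
    have h2 := hbound Θ (n + 1)
    have h3 : r ^ (n + 1 + 1) ≤ r ^ (n + 1) := pow_le_pow_of_le_one hr0 hr1.le (Nat.le_succ _)
    rw [map_sub, ← sub_sub_sub_cancel_right _ _ Θ.invariants.starProjection]
    refine (norm_sub_le _ _).trans ?_
    calc _ ≤ r ^ (n + 1) + r ^ (n + 1 + 1) := add_le_add h1 h2
      _ ≤ 2 * r * r ^ n := by rw [pow_succ r n] at *; linarith
  obtain ⟨p, hp⟩ := cauchySeq_tendsto_of_complete hcauchy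
  have heval : ∀ Θ : AdmissibleRep C, evalRep Θ p = Θ.invariants.starProjection := by
    intro Θ
    have hc : Continuous (evalRep Θ) := map_continuous _
    refine tendsto_nhds_unique ((hc.tendsto p).comp hp) ?_
    rw [tendsto_iff_norm_sub_tendsto_zero]
    exact squeeze_zero (fun _ => norm_nonneg _) (hbound Θ)
      ((tendsto_pow_atTop_nhds_zero_of_lt_one hr0 hr1).comp (Filter.tendsto_add_atTop_nat 1))
  refine ⟨p, ?_, ⟨?_, ?_⟩, fun X => ?_⟩
  · rintro rfl
    have h1 := heval (trivialRep C)
    rw [map_zero] at h1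
    have h2 := congrArg (fun T => T (trivialVector C)) h1
    simp only [zero_apply, Submodule.starProjection_eq_self_iff.2
      (trivialRep_mem_invariants (trivialVector C))] at h2
    have h3 := inner_trivialVector (C := C)
    rw [← h2, inner_zero_left] at h3
    exact zero_ne_one h3
  · refine universal_ext fun Θ => ?_
    rw [map_mul, heval]
    exact Submodule.isIdempotentElem_starProjection _
  · refine universal_ext fun Θ => ?_
    rw [map_star, heval]
    exact isSelfAdjoint_starProjection _
  · refine universal_ext fun Θ => ?_
    rw [map_mul, map_smul, heval, objElement, evalRep_toUniversal]
    ext ξ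
    change Θ.Θ (FusionAlgebra.of X) (Θ.invariants.starProjection ξ) = _
    rw [AdmissibleRep.apply_invariants (Submodule.starProjection_apply_mem _ ξ), dimHom_of]
    rfl

end SpectralGap

end RigidCStarTensorCategory


/-! ### Estimates for states -/

section States

open scoped ComplexOrder

variable {A : Type*} [CStarAlgebra A]

theorem IsState.norm_sq_le {ω : A →L[ℂ] ℂ} (hω : IsState ω) (x y : A) :
    ‖ω (x * y)‖ ^ 2 ≤ (ω (x * star x)).re * (ω (star y * y)).re := by
  simpa using norm_sq_le_of_nonneg ω.toLinearMap hω.1 (star x) y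

/-- Cauchy–Schwarz against the unit and the C*-identity give ‖ω‖² ≤ ‖ω‖. -/
theorem IsState.norm_le_one {ω : A →L[ℂ] ℂ} (hω : IsState ω) : ‖ω‖ ≤ 1 := by
  have h1 : ‖ω‖ ≤ Real.sqrt ‖ω‖ := by
    refine ω.opNorm_le_bound (Real.sqrt_nonneg _) fun x => ?_
    refine le_of_sq_le_sq ?_ (by positivity)
    have h2 := hω.norm_sq_le x 1
    rw [mul_one, star_one, mul_one, hω.2, Complex.one_re, mul_one] at h2
    rw [mul_pow, Real.sq_sqrt (norm_nonneg _)]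
    calc _ ≤ (ω (x * star x)).re := h2
      _ ≤ ‖ω (x * star x)‖ := Complex.re_le_norm _
      _ ≤ ‖ω‖ * ‖x * star x‖ := ω.le_opNorm _
      _ = _ := by rw [CStarRing.norm_self_mul_star, sq]
  have h2 : ‖ω‖ ^ 2 ≤ ‖ω‖ := (Real.le_sqrt (norm_nonneg _) (norm_nonneg _)).1 h1
  by_contra! h3
  nlinarith

theorem IsState.norm_apply_le {ω : A →L[ℂ] ℂ} (hω : IsState ω) (x : A) : ‖ω x‖ ≤ ‖x‖ := by
  simpa using ω.le_of_opNorm_le hω.norm_le_one x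

theorem isState_characterFunctional (e : A →⋆ₐ[ℂ] ℂ) : IsState (characterFunctional e) := by
  refine ⟨fun x => ?_, map_one e⟩
  change 0 ≤ e (star x * x)
  rw [map_mul, map_star]
  exact star_mul_self_nonneg _

/-- If `x p = e(x) p` for a character `e` and a projection `p`, then the distance from a state `ω`
to `e` is controlled by `ω(p)`. -/
theorem IsState.norm_sub_characterFunctional_le {ω : A →L[ℂ] ℂ} (hω : IsState ω)
    {e : A →⋆ₐ[ℂ] ℂ} {p : A} (hp : IsStarProjection p) (h : ∀ x, x * p = e x • p) :
    ‖ω - characterFunctional e‖ ≤ Real.sqrt ‖ω p - 1‖ + ‖ω p - 1‖ := by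
  refine ContinuousLinearMap.opNorm_le_bound _ (by positivity) fun x => ?_
  -- Splitting x into x(1 − p) and x p = e(x) p: the first part is bounded by Cauchy–Schwarz, using
  -- that 1 − p is a projection with ω(1 − p) = 1 − ω(p).
  have h1 : (ω - characterFunctional e) x = ω (x * (1 - p)) + (ω p - 1) * e x := by
    change ω x - e x = _
    rw [mul_sub, mul_one, h, map_sub, map_smul, smul_eq_mul]
    ring
  have hq : star (1 - p) * (1 - p) = 1 - p := by
    have := hp.one_sub
    rw [this.isSelfAdjoint.star_eq, this.isIdempotentElem.eq]
  have h2 : ‖ω (x * (1 - p))‖ ≤ Real.sqrt ‖ω p - 1‖ * ‖x‖ := by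
    refine le_of_sq_le_sq ?_ (by positivity)
    rw [mul_pow, Real.sq_sqrt (norm_nonneg _)]
    have h3 := hω.norm_sq_le x (1 - p)
    rw [hq] at h3
    have h4 : (ω (x * star x)).re ≤ ‖x‖ ^ 2 := by
      refine (Complex.re_le_norm _).trans ((hω.norm_apply_le _).trans_eq ?_)
      rw [CStarRing.norm_self_mul_star, sq]
    have h5 : (ω (1 - p)).re ≤ ‖ω p - 1‖ := by
      refine (Complex.re_le_norm _).trans_eq ?_
      rw [map_sub, hω.2, norm_sub_rev]
    have h6 : 0 ≤ (ω (1 - p)).re := by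
      rw [← hq]
      exact (Complex.nonneg_iff.1 (hω.1 _)).1
    calc _ ≤ _ := h3
      _ ≤ ‖x‖ ^ 2 * ‖ω p - 1‖ := mul_le_mul h4 h5 h6 (by positivity)
      _ = _ := mul_comm _ _
  have h3 : ‖e x‖ ≤ ‖x‖ := (isState_characterFunctional e).norm_apply_le x
  rw [h1, add_mul]
  refine (norm_add_le _ _).trans (add_le_add h2 ?_)
  rw [norm_mul]
  gcongr

/-- Pointwise convergence of states on a dense set implies weak* convergence. -/
theorem IsState.tendsto_of_dense {R ι : Type*} {l : Filter ι} {j : R → A} (hj : DenseRange j)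
    {ω : ι → A →L[ℂ] ℂ} (hω : ∀ n, IsState (ω n)) {ψ : A →L[ℂ] ℂ} (hψ : IsState ψ)
    (h : ∀ a, Filter.Tendsto (fun n => ω n (j a)) l (nhds (ψ (j a)))) (x : A) :
    Filter.Tendsto (fun n => ω n x) l (nhds (ψ x)) := by
  rw [Metric.tendsto_nhds]
  intro r hr
  obtain ⟨a, ha⟩ := hj.exists_dist_lt x (by positivity : 0 < r / 3)
  filter_upwards [Metric.tendsto_nhds.1 (h a) (r / 3) (by positivity)] with n hn
  rw [dist_eq_norm] at *
  have h1 := (hω n).norm_apply_le (x - j a)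
  have h2 := hψ.norm_apply_le (x - j a)
  rw [map_sub] at h1 h2
  have h3 : ω n x - ψ x = (ω n x - ω n (j a)) + (ω n (j a) - ψ (j a)) - (ψ x - ψ (j a)) := by ring
  rw [h3]
  refine (norm_sub_le _ _).trans_lt ?_
  have h4 := norm_add_le (ω n x - ω n (j a)) (ω n (j a) - ψ (j a))
  linarith

end States

/-! ### States, cp-multipliers and the remaining implications -/

namespace RigidCStarTensorCategory

section Equivalence

variable {C : Type u} [Category.{v} C] [Preadditive C] [Linear ℂ C]
  [MonoidalCategory C] [MonoidalPreadditive C] [MonoidalLinear ℂ C] [RightRigidCategory C]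
  [CStarTensorCategory C] [RigidCStarTensorCategory C]

open scoped ComplexOrder

theorem norm_toUniversal_basis_le (π : Irr C) :
    ‖toUniversal C (FusionAlgebra.basis π)‖ ≤ dim π.rep :=
  universal_norm_le (dim_pos π.irreducible_rep).le fun Θ => Θ.norm_basis_le π

/-- A normalised cp-multiplier defines a state on the universal C*-algebra. -/
theorem IsCPMultiplier.exists_state {φ : Irr C → ℂ} (h : IsCPMultiplier φ)
    (h0 : φ (Irr.unit C) ≠ 0) : ∃ ω : UniversalCStarAlgebra C →L[ℂ] ℂ, IsState ω ∧
      ∀ π, φ (Irr.unit C) * ω (toUniversal C (FusionAlgebra.basis π)) = dim π.rep * φ π := by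
  obtain ⟨Θ, ξ, hξ⟩ := h.exists_admissibleRep h0
  have h1 : inner ℂ ξ ξ = φ (Irr.unit C) := by
    have h2 := hξ (Irr.unit C)
    rw [show FusionAlgebra.basis (Irr.unit C) = 1 from rfl, map_one, dim_rep_unit,
      Complex.ofReal_one, one_mul] at h2
    exact h2
  let ev : UniversalCStarAlgebra C →L[ℂ] (Θ.K →L[ℂ] Θ.K) :=
    ⟨(evalRep Θ).toAlgHom.toLinearMap, map_continuous (evalRep Θ)⟩
  -- The vector functional of `ξ` takes the value `φ (Irr.unit C)` at 1, so dividing by it gives a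
  -- state.
  let ω : UniversalCStarAlgebra C →L[ℂ] ℂ :=
    (φ (Irr.unit C))⁻¹ • (innerSL ℂ ξ ∘L ContinuousLinearMap.apply ℂ Θ.K ξ ∘L ev)
  have hω : ∀ x, ω x = (φ (Irr.unit C))⁻¹ * inner ℂ ξ (evalRep Θ x ξ) := fun x => rfl
  refine ⟨ω, ⟨fun x => ?_, ?_⟩, fun π => ?_⟩
  · rw [hω, map_mul, map_star, mul_apply_eq_comp, ContinuousLinearMap.star_eq_adjoint,
      ContinuousLinearMap.adjoint_inner_right, inner_self_eq_norm_sq_to_K]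
    refine mul_nonneg (inv_nonneg.2 h.unit_nonneg) ?_
    rw [← RCLike.ofReal_pow]
    exact Complex.zero_le_real.2 (sq_nonneg _)
  · rw [hω, map_one]
    change _ * inner ℂ ξ ξ = 1
    rw [h1, inv_mul_cancel₀ h0]
  · rw [hω, evalRep_toUniversal, mul_inv_cancel_left₀ h0, hξ]

variable (C) in
/-- Weak* convergence of states to the trivial representation implies norm convergence. -/
def StatesConverge : Prop :=
  ∀ (ι : Type (u + 1)) [Preorder ι] [IsDirectedOrder ι] [Nonempty ι]
    (ω : ι → UniversalCStarAlgebra C →L[ℂ] ℂ), (∀ n, IsState (ω n)) →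
    (∀ x, Filter.Tendsto (fun n => ω n x) Filter.atTop (nhds (trivialCharacter C x))) →
    Filter.Tendsto (fun n => ‖ω n - characterFunctional (trivialCharacter C)‖)
      Filter.atTop (nhds 0)

/-- Weak* convergence is needed at the single element `p`, where the limit is 1. -/
theorem IsTrivialProjection.statesConverge {p : UniversalCStarAlgebra C}
    (hp : IsTrivialProjection p) : StatesConverge C := by
  intro ι _ _ _ ω hω hlim
  have h1 := hlim p
  rw [hp.trivialCharacter_eq, tendsto_iff_norm_sub_tendsto_zero] at h1
  refine squeeze_zero (fun n => norm_nonneg _)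
    (fun n => (hω n).norm_sub_characterFunctional_le hp.2.1 hp.mul_eq) ?_
  have h2 := (Real.continuous_sqrt.tendsto 0).comp h1
  rw [Real.sqrt_zero] at h2
  simpa using h2.add h1

/-- Each cp-multiplier, divided by its value at the unit, is a state. Norm convergence of the states
is uniform on the elements d(π)⁻¹π, which have norm at most one. -/
theorem StatesConverge.hasPropertyT (h : StatesConverge C) : HasPropertyT C := by
  classical
  intro ι _ _ _ φ hφ hlim
  have hex : ∀ n, ∃ ω : UniversalCStarAlgebra C →L[ℂ] ℂ, IsState ω ∧ (φ n (Irr.unit C) ≠ 0 →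
      ∀ π, φ n (Irr.unit C) * ω (toUniversal C (FusionAlgebra.basis π)) =
        dim π.rep * φ n π) := by
    intro n
    by_cases h0 : φ n (Irr.unit C) = 0
    -- A cp-multiplier vanishing at the unit has no normalisation; the trivial state serves as a
    -- default, which is harmless as the case does not occur eventually.
    · exact ⟨_, isState_characterFunctional (trivialCharacter C), fun h => absurd h0 h⟩
    · obtain ⟨ω, h1, h2⟩ := (hφ n).exists_state h0
      exact ⟨ω, h1, fun _ => h2⟩
  choose ω hω hωφ using hex
  have hne : ∀ᶠ n in Filter.atTop, φ n (Irr.unit C) ≠ 0 :=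
    (hlim (Irr.unit C)).eventually_ne one_ne_zero
  have hd : ∀ π : Irr C, (dim π.rep : ℂ) ≠ 0 := fun π => by
    exact_mod_cast dim_ne_zero π.irreducible_rep
  have hpt : ∀ x, Filter.Tendsto (fun n => ω n x) Filter.atTop (nhds (trivialCharacter C x)) := by
    refine IsState.tendsto_of_dense (denseRange_toUniversal C) hω
      (isState_characterFunctional (trivialCharacter C)) fun a => ?_
    change Filter.Tendsto _ _ (nhds (trivialCharacter C _))
    rw [trivialCharacter_toUniversal]
    induction a using FusionAlgebra.induction_on with
    | h0 => simp
    | hadd x y hx hy => simpa only [map_add] using hx.add hy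
    | hb c π =>
      simp only [map_smul]
      refine Filter.Tendsto.const_smul ?_ c
      rw [dimHom_basis]
      have h1 := ((hlim π).div (hlim (Irr.unit C)) one_ne_zero).const_mul (dim π.rep : ℂ)
      rw [div_one, mul_one] at h1
      refine h1.congr' ?_
      filter_upwards [hne] with n hn
      rw [Pi.div_apply, ← mul_div_assoc, ← hωφ n hn π, mul_div_cancel_left₀ _ hn]
  -- Nets of states are indexed one universe above nets of multipliers, so the index set is lifted;
  -- both directions of the lift are cofinal.
  have : IsDirectedOrder (ULift.{u + 1} ι) := ⟨fun a b => by
    obtain ⟨c, h1, h2⟩ := exists_ge_ge a.down b.down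
    exact ⟨⟨c⟩, h1, h2⟩⟩
  have hup : Filter.Tendsto (ULift.up : ι → ULift.{u + 1} ι) Filter.atTop Filter.atTop :=
    Filter.tendsto_atTop_atTop.2 fun b => ⟨b.down, fun a ha => ha⟩
  have hdown : Filter.Tendsto (ULift.down : ULift.{u + 1} ι → ι) Filter.atTop Filter.atTop :=
    Filter.tendsto_atTop_atTop.2 fun b => ⟨⟨b⟩, fun a ha => ha⟩
  have hnorm := (h (ULift.{u + 1} ι) (fun n => ω n.down) (fun n => hω _)
    fun x => (hpt x).comp hdown).comp hup
  have hbound : Filter.Tendsto (fun n => ‖φ n (Irr.unit C)‖ *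
      ‖ω n - characterFunctional (trivialCharacter C)‖ + ‖φ n (Irr.unit C) - 1‖)
      Filter.atTop (nhds 0) := by
    have h1 := ((hlim (Irr.unit C)).norm.mul hnorm).add
      (tendsto_iff_norm_sub_tendsto_zero.1 (hlim (Irr.unit C)))
    simpa using h1
  rw [Metric.tendstoUniformly_iff]
  intro r hr
  filter_upwards [hne, hbound.eventually_lt_const hr] with n hn hlt π
  rw [dist_comm, dist_eq_norm]
  refine lt_of_le_of_lt ?_ hlt
  set χ := characterFunctional (trivialCharacter C) with hχ
  have h1 : χ (toUniversal C (FusionAlgebra.basis π)) = dim π.rep :=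
    (trivialCharacter_toUniversal _).trans (dimHom_basis π)
  -- The difference separates into the error of the state at π and the error of normalisation at the
  -- unit; neither bound depends on π.
  have h2 : φ n π - 1 = φ n (Irr.unit C) * ((dim π.rep : ℂ)⁻¹ *
      (ω n - χ) (toUniversal C (FusionAlgebra.basis π))) + (φ n (Irr.unit C) - 1) := by
    have h3 := hωφ n hn π
    rw [sub_apply, h1]
    have h4 : φ n π = (dim π.rep : ℂ)⁻¹ *
        (φ n (Irr.unit C) * ω n (toUniversal C (FusionAlgebra.basis π))) := by
      rw [h3, inv_mul_cancel_left₀ (hd π)]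
    rw [h4]
    have := hd π
    field_simp
    ring
  have hpos := dim_pos π.irreducible_rep
  have h5 : ‖(dim π.rep : ℂ)⁻¹ * (ω n - χ) (toUniversal C (FusionAlgebra.basis π))‖ ≤
      ‖ω n - χ‖ := by
    rw [norm_mul, norm_inv, Complex.norm_real, Real.norm_of_nonneg hpos.le, inv_mul_le_iff₀ hpos,
      mul_comm]
    exact (ContinuousLinearMap.le_opNorm _ _).trans
      (mul_le_mul_of_nonneg_left (norm_toUniversal_basis_le π) (norm_nonneg _))
  rw [h2]
  refine (norm_add_le _ _).trans ?_
  rw [norm_mul]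
  gcongr

end Equivalence

end RigidCStarTensorCategory

/-! ### The equivalence -/

theorem proposition5p5
    {C : Type u} [Category.{v} C] [Preadditive C] [Linear ℂ C] [MonoidalCategory C]
    [MonoidalPreadditive C] [MonoidalLinear ℂ C] [RightRigidCategory C]
    [CStarTensorCategory C] [RigidCStarTensorCategory C] :
    ∃ ε : UniversalCStarAlgebra C →⋆ₐ[ℂ] ℂ,
      IsTrivialRep ε ∧ (∀ ε', IsTrivialRep ε' → ε' = ε) ∧
      List.TFAE [
        HasPropertyT C,
        ∃ p : UniversalCStarAlgebra C, IsTrivialProjection p,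
        ∀ (ι : Type (u + 1)) [Preorder ι] [IsDirectedOrder ι] [Nonempty ι]
          (ω : ι → UniversalCStarAlgebra C →L[ℂ] ℂ), (∀ n, IsState (ω n)) →
          (∀ x, Filter.Tendsto (fun n => ω n x) Filter.atTop (nhds (ε x))) →
          Filter.Tendsto (fun n => ‖ω n - characterFunctional ε‖)
            Filter.atTop (nhds 0)] ∧
      ∀ p : UniversalCStarAlgebra C, IsTrivialProjection p →
        ε p = 1 ∧ ∀ q, IsTrivialProjection q → q = p := by
  refine ⟨trivialCharacter C, isTrivialRep_trivialCharacter, fun e he => he.eq_trivialCharacter,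
    ?_, fun p hp => ⟨hp.trivialCharacter_eq, fun q hq => hp.unique hq⟩⟩
  tfae_have 1 → 2 := fun h => h.exists_isTrivialProjection
  tfae_have 2 → 3 := fun ⟨_, hp⟩ => hp.statesConverge
  tfae_have 3 → 1 := fun h => StatesConverge.hasPropertyT h
  tfae_finish
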